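/- Let $Z$ be a lattice spanning a $d$-dimensional Euclidean space $V$ (polynomials on $V$ are polynomials in linear coordinates). Let $R$ be a random walk on $Z$ started at $0$, with i.i.d. steps which are bounded and have mean zero, such that every $z\in Z$ is reached with positive probability. Write $P_n(z)=\mathbb{P}(R_n=z)$, write $R$ also for a single step, and for $n\ge 0$ put $$D_n f(z)=\frac1{n!}\sum_{x\in Z}\mathbb{P}(R=x)\,\frac{\partial^n f}{\partial x^n}(z).$$ Let $\mu_d(r)=r^{2-d}$ for $d\neq2$ and $\mu_2(r)=\log r$. Then the following hold. * The series $a(z)=\sum_{n\ge0}\bigl(P_n(0)-P_n(z)\bigr)$ (the harmonic potential, as the limit of the partial sums) converges for every $z\in Z$. * There is a linear bijection $A$ of $V$ such that $AR$ is spherical, i.e. $\mathbb{E}\langle AR,u\rangle\langle AR,v\rangle=C\langle u,v\rangle$ for all $u,v\in V$ and some constant $C$. (If $R$ itself is spherical one may take $A=\mathrm{id}$.) * If $R$ is reversible (i.e. $R$ and $-R$ have the same law), then $D_3\equiv0$ on smooth functions. Moreover, let $A$ be any linear bijection such that $AR$ is spherical. Then $a$ has an asymptotic expansion $$a(z)=\tau\,\mu_d(\|Az\|)+\sum_{k=0}^{K-1}h_k(z)+O(\|z\|^{-K})\qquad(z\in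 Z\setminus\{0\})\quad\text{for every integer }K\ge0,$$ with a constant $\tau$ and functions $h_k:V\setminus\{0\}\to\mathbb{R}$ that do not depend on $K$, where $h_k$ is continuous and homogeneous of degree $-k$ ("the term of order $-k$"). For every such expansion and every $k\ge1$: 1. $h_k(z)=P(z)/\|Az\|^{\alpha}$ for an integer $\alpha\ge k$ and a homogeneous polynomial $P$ of degree $\alpha-k$ (or $P=0$), such that, if $h_k\not\equiv0$, $\alpha\le 4k+2-d$ and $\deg P=\alpha-k\le 3k+2-d$. 2. If $D_3\equiv0$ (in particular if $R$ is reversible), then $h_k(z)=P(z)/\|Az\|^{\alpha}$ for an integer $\alpha\ge k$ and a homogeneous polynomial $P$ of degree $\alpha-k$ (or $P=0$), such that, if $h_k\not\equiv0$, $\alpha\le 3k+2-d$ and $\deg P=\alpha-k\le 2k+2-d$. -/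

import Mathlib

open Filter Topology

noncomputable section

namespace LatticeWalk

/-- The law of `R_n`, for the walk `R_0 = 0` whose increments are independent with law `p`. -/
def walkLaw {G : Type*} [AddMonoid G] (p : PMF G) : ℕ → PMF G
  | 0 => PMF.pure 0
  | n + 1 => (walkLaw p n).bind fun y => p.map fun x => y + x

/-- `P_n(z)`, the probability that the walk is at `z` at time `n`. -/
def stepProb {G : Type*} [AddMonoid G] (p : PMF G) (n : ℕ) (z : G) : ℝ :=
  (walkLaw p n z).toReal

/-- Partial sums of the series `∑ n, (P_n(0) - P_n(z))`. -/
def potentialPartialSum {G : Type*} [AddMonoid G] (p : PMF G) (z : G) (N : ℕ) : ℝ :=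
  ∑ n ∈ Finset.range N, (stepProb p n 0 - stepProb p n z)

/-- The discrete harmonic potential `a(z) = ∑ n, (P_n(0) - P_n(z))`. The series need not converge
absolutely, so the sum is the limit of the partial sums. -/
def harmonicPotential {G : Type*} [AddMonoid G] (p : PMF G) (z : G) : ℝ :=
  limUnder atTop (potentialPartialSum p z)

section Lattice

variable {V : Type*} [NormedAddCommGroup V] [InnerProductSpace ℝ V] {Z : Submodule ℤ V}

/-- The step law `p` defines a random walk on the lattice `Z`: every point of `Z` is reached with
positive probability. -/
def IsRandomWalk (p : PMF Z) : Prop :=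
  ∀ z : Z, ∃ n : ℕ, 0 < stepProb p n z

/-- The steps are bounded. -/
def IsBoundedWalk (p : PMF Z) : Prop :=
  Bornology.IsBounded p.support

/-- The drift `𝔼 R` is zero. -/
def IsBalanced (p : PMF Z) : Prop :=
  ∑' x : Z, (p x).toReal • (x : V) = 0

/-- The walk is reversible (symmetric): `R` and `-R` have the same law. -/
def IsReversible (p : PMF Z) : Prop :=
  ∀ x : Z, p (-x) = p x

/-- The linear image `A R` of the walk has a constant correlation matrix:
`𝔼 ⟨A R, u⟩ ⟨A R, v⟩ = C ⟨u, v⟩`. For `A = id` this says that `R` itself is spherical. -/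
def IsSphericalUnder (p : PMF Z) (A : V ≃ₗ[ℝ] V) : Prop :=
  ∃ C : ℝ, ∀ u v : V,
    ∑' x : Z, (p x).toReal * (inner ℝ (A (x : V)) u * inner ℝ (A (x : V)) v) = C * inner ℝ u v

/-- The differential operator `D_n = (1 / n!) ∑ x, p(x) ∂^n / ∂x^n` in the Taylor expansion of the
discrete Laplacian of the walk. -/
def diffOp (p : PMF Z) (n : ℕ) (f : V → ℝ) (z : V) : ℝ :=
  (1 / (n.factorial : ℝ)) *
    ∑' x : Z, (p x).toReal * iteratedFDeriv ℝ n f z (fun _ => (x : V))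

/-- `D_n ≡ 0` as a differential operator on smooth functions. -/
def DiffOpVanishes (p : PMF Z) (n : ℕ) : Prop :=
  ∀ f : V → ℝ, ContDiff ℝ ((⊤ : ℕ∞) : WithTop ℕ∞) f → ∀ z : V, diffOp p n f z = 0

/-- The radial function `μ_d`: `log r` for `d = 2`, and `r ^ (2 - d)` otherwise. -/
def radial (d : ℕ) (r : ℝ) : ℝ :=
  if d = 2 then Real.log r else r ^ (2 - (d : ℤ))

/-- `a(z) = τ μ_d(‖A z‖) + ∑_{k < K} h_k(z) + O(‖z‖^{-K})` on the lattice, for every `K`, where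
`h_k` is continuous outside the origin and homogeneous of degree `-k`; `h_k` is the term of
order `-k`. -/
structure IsExpansion (d : ℕ) (a : Z → ℝ) (A : V ≃ₗ[ℝ] V) (τ : ℝ) (h : ℕ → V → ℝ) : Prop where
  continuousOn : ∀ k, ContinuousOn (h k) {0}ᶜ
  homogeneous : ∀ k, ∀ t : ℝ, 0 < t → ∀ z : V, z ≠ 0 → h k (t • z) = t ^ (-(k : ℤ)) * h k z
  bound : ∀ K : ℕ, ∃ C : ℝ, ∀ z : Z, z ≠ 0 →
    |a z - τ * radial d ‖A (z : V)‖ - ∑ k ∈ Finset.range K, h k (z : V)|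
      ≤ C * ‖(z : V)‖ ^ (-(K : ℤ))

/-- The function `g` is `P(z) / ‖A z‖ ^ α` outside the origin, where `P` is a homogeneous polynomial
of degree `α - k` in the coordinates of `z`. Unless `P = 0` (that is, `g` vanishes),
`α ≤ αMax` and `deg P ≤ degMax`. -/
def IsQuotientTerm {d : ℕ} (b : Module.Basis (Fin d) ℝ V) (A : V ≃ₗ[ℝ] V) (k : ℕ) (g : V → ℝ)
    (αMax degMax : ℤ) : Prop :=
  ∃ (α : ℕ) (P : MvPolynomial (Fin d) ℝ), k ≤ α ∧ P.IsHomogeneous (α - k) ∧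
    (∀ z : V, z ≠ 0 → g z = MvPolynomial.eval (fun i => b.repr z i) P / ‖A z‖ ^ α) ∧
    (P ≠ 0 → (α : ℤ) ≤ αMax ∧ (P.totalDegree : ℤ) ≤ degMax)

end Lattice

end LatticeWalk

end

/-!
The walk is run in continuous time. With `φ(u) = 𝔼 exp (i ⟨R, u⟩)`, `ψ = 1 - φ` and a fundamental
cell `D` of the dual lattice, Fourier inversion (`integral_char_pow_mul_wave`) turns the partial sums
of the potential into integrals over `D`. Dominated convergence gives
`a(z) = |D|⁻¹ ∫_D Re ((1 - exp (-i ⟨z, u⟩)) / ψ(u)) du`. Real parts are bounded, since a centred walk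
has `Im ψ = O(‖u‖³)`; this covers dimensions one and two and needs no aperiodicity. Writing `1 / ψ` as
the integral of `exp (-t ψ)` over `t > 0` gives `a(z) = ∫ (p_t(0) - p_t(z)) dt`, where `p_t` is the
heat kernel of the walk in continuous time (`harmonicPotential_eq`).

For a spherical walk `ψ(u) = q ‖u‖² - g(iu) + …`, where `g` is a polynomial all of whose monomials
have degree at least three. Hence `exp (-t ψ)` is approximated by `exp (-t q ‖u‖²) ∑ t^m g(iu)^m / m!`
with an error of the order `t^(-J/2)` for the heat kernel (`exists_edgeworth_bound`,
`exists_abs_heat_sub_edgeworth_le`). A homogeneous component of degree `n` of `g^m` transforms into a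
Gaussian times a polynomial whose homogeneous components have degrees `n, n - 2, …`
(`exists_gaussTransform_eq`). Parabolic scaling shows that the time integral of such a kernel is
homogeneous: it is a polynomial divided by a power of `‖z‖`, the order being `d - 2 + n - 2 m`
(`isTermKernel_of_mem_parityLE`). The term with `m = 0` gives `μ_d` and a constant
(`exists_integral_leadKernel_eq`). For `t` below a small multiple of `‖z‖` all kernels are negligible,
by finite speed of propagation (`abs_heat_le`); for larger `t` the error of the approximation is
integrated (`exists_expansion_of_order`).

The exponent of the denominator at order `k = d - 1 + j`, where `j = n - 2 m - 1`, is at most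
`d + 2 j + 2 m`, so it is controlled by the number `m` of factors. Since `3 m ≤ n`, one has
`m ≤ j + 1`, and `4 m ≤ n`, that is `2 m ≤ j + 1`, if the third moments vanish. The latter is what
`D_3 ≡ 0` means, as the cubes of linear functionals show (`moment_three_eq_zero`).

Along the ray through a lattice point an expansion is an expansion in powers of `1 / n`, and these
rays are dense. Thus the terms are unique up to a multiple of `‖A z‖^(2 - d)`, which for `3 ≤ d` is
itself a term of order `d - 2` and can be traded with `τ` (`exists_eq_add_of_hasExpansion`). This
makes the terms independent of the order `K`, and gives the claim for every expansion.
-/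

noncomputable section
open MeasureTheory Finset

/-! ### The law of the walk -/

namespace LatticeWalk

section Law

variable {G : Type*} [AddCommGroup G]

theorem stepProb_nonneg (p : PMF G) (n : ℕ) (z : G) : 0 ≤ stepProb p n z :=
  ENNReal.toReal_nonneg

theorem stepProb_le_one (p : PMF G) (n : ℕ) (z : G) : stepProb p n z ≤ 1 := by
  have h := (walkLaw p n).coe_le_one z
  exact ENNReal.toReal_le_of_le_ofReal zero_le_one (by simpa using h)

theorem stepProb_zero [DecidableEq G] (p : PMF G) (z : G) :
    stepProb p 0 z = if z = 0 then 1 else 0 := by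
  simp only [stepProb, walkLaw, PMF.pure_apply]
  split_ifs <;> simp

theorem walkLaw_succ_apply (p : PMF G) (n : ℕ) (z : G) :
    walkLaw p (n + 1) z = ∑' x, p x * walkLaw p n (z - x) := by
  classical
  have h1 : ∀ y : G, (p.map fun x => y + x) z = p (z - y) := by
    intro y
    rw [PMF.map_apply, tsum_eq_single (z - y)]
    · simp
    · intro b hb
      rw [if_neg]
      rintro rfl
      simp at hb
  simp only [walkLaw, PMF.bind_apply, h1]
  rw [← (Equiv.subLeft z).tsum_eq]
  simp [mul_comm]

/-- The Markov property, conditioning on the last step. -/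
theorem stepProb_succ (p : PMF G) (S : Finset G) (hS : ∀ x, p x ≠ 0 → x ∈ S) (n : ℕ) (z : G) :
    stepProb p (n + 1) z = ∑ x ∈ S, (p x).toReal * stepProb p n (z - x) := by
  rw [stepProb, walkLaw_succ_apply, tsum_eq_sum (s := S), ENNReal.toReal_sum]
  · simp [stepProb, ENNReal.toReal_mul]
  · intro x _
    exact ENNReal.mul_ne_top (PMF.apply_ne_top _ _) (PMF.apply_ne_top _ _)
  · intro x hx
    have : p x = 0 := by
      by_contra h
      exact hx (hS x h)
    simp [this]

theorem exists_step_of_stepProb_succ_ne_zero (p : PMF G) (n : ℕ) (z : G)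
    (h : stepProb p (n + 1) z ≠ 0) : ∃ x, p x ≠ 0 ∧ stepProb p n (z - x) ≠ 0 := by
  by_contra! hc
  apply h
  rw [stepProb, walkLaw_succ_apply]
  have : ∀ x, p x * walkLaw p n (z - x) = 0 := by
    intro x
    by_cases hx : p x = 0
    · simp [hx]
    · have := hc x hx
      rw [stepProb, ENNReal.toReal_eq_zero_iff] at this
      rcases this with h0 | h0
      · simp [h0]
      · exact absurd h0 (PMF.apply_ne_top _ _)
  simp [this]

/-- A walk only visits the additive monoid generated by its steps. -/
theorem mem_of_stepProb_ne_zero (p : PMF G) (H : AddSubmonoid G) (hH : ∀ x, p x ≠ 0 → x ∈ H)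
    (n : ℕ) (z : G) (h : stepProb p n z ≠ 0) : z ∈ H := by
  classical
  induction n generalizing z with
  | zero =>
    rw [stepProb_zero] at h
    have : z = 0 := by
      by_contra hz
      simp [hz] at h
    exact this ▸ H.zero_mem
  | succ n ih =>
    obtain ⟨x, hx, hz⟩ := exists_step_of_stepProb_succ_ne_zero p n z h
    have := H.add_mem (ih _ hz) (hH x hx)
    simpa using this

/-- A walk with steps of size at most `B` is within `n * B` of the origin at time `n`. -/
theorem norm_le_of_stepProb_ne_zero {E : Type*} [SeminormedAddCommGroup E] (p : PMF G)
    (f : G →+ E) (B : ℝ) (hB : ∀ x, p x ≠ 0 → ‖f x‖ ≤ B)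
    (n : ℕ) (z : G) (h : stepProb p n z ≠ 0) : ‖f z‖ ≤ n * B := by
  classical
  induction n generalizing z with
  | zero =>
    rw [stepProb_zero] at h
    have : z = 0 := by
      by_contra hz
      simp [hz] at h
    simp [this]
  | succ n ih =>
    obtain ⟨x, hx, hz⟩ := exists_step_of_stepProb_succ_ne_zero p n z h
    have h1 := ih _ hz
    have h2 := hB x hx
    have h3 : f z = f (z - x) + f x := by rw [← map_add]; simp
    rw [h3]
    refine (norm_add_le _ _).trans ?_
    push_cast
    linarith

theorem sum_toReal_eq_one {G : Type*} (p : PMF G) (S : Finset G) (hS : ∀ x, p x ≠ 0 → x ∈ S) :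
    ∑ x ∈ S, (p x).toReal = 1 := by
  rw [← ENNReal.toReal_sum (fun x _ => PMF.apply_ne_top _ _)]
  have := p.tsum_coe
  rw [tsum_eq_sum (s := S)] at this
  · simp [this]
  · intro x hx
    by_contra h
    exact hx (hS x h)

end Law

/-- A random walk on an abelian group, embedded as a lattice in `ℝ^d` in such a way that the
steps are finitely many, centred, and spherical with covariance `2 q` times the identity. The
vectors `basis i` generate the lattice. -/
structure SphericalWalk (G : Type*) [AddCommGroup G] (d : ℕ) where
  /-- the law of a step -/
  law : PMF G
  /-- the position in space of a group element -/
  pos : G →+ EuclideanSpace ℝ (Fin d)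
  /-- the possible steps -/
  steps : Finset G
  mem_steps : ∀ x, law x ≠ 0 → x ∈ steps
  reach : ∀ z, ∃ n, 0 < stepProb law n z
  mean_zero : ∑ x ∈ steps, (law x).toReal • pos x = 0
  /-- half the variance of a coordinate of a step -/
  q : ℝ
  q_pos : 0 < q
  spherical : ∀ u, ∑ x ∈ steps, (law x).toReal * (inner ℝ (pos x) u) ^ 2 = 2 * q * ‖u‖ ^ 2
  /-- a basis of the lattice -/
  basis : Module.Basis (Fin d) ℝ (EuclideanSpace ℝ (Fin d))
  basis_mem : ∀ i, ∃ z, pos z = basis i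
  coord_int : ∀ z i, ∃ n : ℤ, basis.repr (pos z) i = n
  pos_injective : Function.Injective pos

namespace SphericalWalk

variable {G : Type*} [AddCommGroup G] {d : ℕ} (W : SphericalWalk G d)

/-- The probability of a step, as a real number. -/
def wt (x : G) : ℝ := (W.law x).toReal

theorem wt_nonneg (x : G) : 0 ≤ W.wt x := ENNReal.toReal_nonneg

theorem sum_wt : ∑ x ∈ W.steps, W.wt x = 1 := sum_toReal_eq_one _ _ W.mem_steps

theorem sum_wt_inner (u : EuclideanSpace ℝ (Fin d)) :
    ∑ x ∈ W.steps, W.wt x * inner ℝ (W.pos x) u = 0 := by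
  have h : inner ℝ (∑ x ∈ W.steps, (W.law x).toReal • W.pos x) u = 0 := by
    rw [W.mean_zero, inner_zero_left]
  rw [sum_inner] at h
  simpa only [real_inner_smul_left, wt] using h

theorem sum_wt_inner_sq (u : EuclideanSpace ℝ (Fin d)) :
    ∑ x ∈ W.steps, W.wt x * (inner ℝ (W.pos x) u) ^ 2 = 2 * W.q * ‖u‖ ^ 2 := W.spherical u

theorem exists_step_bound : ∃ B : ℝ, 1 ≤ B ∧ ∀ x ∈ W.steps, ‖W.pos x‖ ≤ B := by
  refine ⟨1 + ∑ x ∈ W.steps, ‖W.pos x‖, ?_, ?_⟩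
  · have : 0 ≤ ∑ x ∈ W.steps, ‖W.pos x‖ := Finset.sum_nonneg fun _ _ => norm_nonneg _
    linarith
  · intro x hx
    have := Finset.single_le_sum (f := fun x => ‖W.pos x‖) (fun _ _ => norm_nonneg _) hx
    linarith

/-- A bound, at least `1`, for the length of the steps. -/
def B : ℝ := W.exists_step_bound.choose

theorem one_le_B : 1 ≤ W.B := W.exists_step_bound.choose_spec.1

theorem norm_pos_le {x : G} (hx : x ∈ W.steps) : ‖W.pos x‖ ≤ W.B :=
  W.exists_step_bound.choose_spec.2 x hx

theorem abs_inner_le {x : G} (hx : x ∈ W.steps) (u : EuclideanSpace ℝ (Fin d)) :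
    |inner ℝ (W.pos x) u| ≤ W.B * ‖u‖ :=
  (abs_real_inner_le_norm _ _).trans (by gcongr; exact W.norm_pos_le hx)

/-- Finite speed of propagation, in exponential form. -/
theorem stepProb_le_exp (n : ℕ) (z : G) :
    stepProb W.law n z ≤ Real.exp (n - ‖W.pos z‖ / W.B) := by
  by_cases h : stepProb W.law n z = 0
  · rw [h]; positivity
  · have h1 := norm_le_of_stepProb_ne_zero W.law W.pos W.B
      (fun x hx => W.norm_pos_le (W.mem_steps x hx)) n z h
    have hB := W.one_le_B
    have h2 : ‖W.pos z‖ / W.B ≤ n := by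
      rw [div_le_iff₀ (by linarith)]
      exact h1
    refine (stepProb_le_one _ _ _).trans ?_
    apply Real.one_le_exp
    linarith

end SphericalWalk
end LatticeWalk

/-! ### The characteristic function -/

namespace LatticeWalk
theorem eq_zero_of_forall_inner_basis_eq_zero {ι E : Type*} [NormedAddCommGroup E]
    [InnerProductSpace ℝ E] (b : Module.Basis ι ℝ E) {u : E} (h : ∀ i, inner ℝ (b i) u = 0) :
    u = 0 := by
  have h1 : (innerₗ E).flip u = 0 := b.ext fun i => by simpa [real_inner_comm] using h i
  have h2 := LinearMap.congr_fun h1 u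
  simpa using h2

namespace SphericalWalk

variable {G : Type*} [AddCommGroup G] {d : ℕ} (W : SphericalWalk G d)

/-- The characteristic function `𝔼 exp (i ⟨R, u⟩)` of a step. -/
def char (u : EuclideanSpace ℝ (Fin d)) : ℂ :=
  ∑ x ∈ W.steps, (W.wt x : ℂ) * Complex.exp ((inner ℝ (W.pos x) u : ℝ) * Complex.I)

/-- The symbol `1 - 𝔼 exp (i ⟨R, u⟩)` of the discrete Laplacian of the walk. -/
def symbol (u : EuclideanSpace ℝ (Fin d)) : ℂ := 1 - W.char u

/-- A fundamental cell for the dual lattice: the parallelepiped where all `⟨basis i, u⟩` lie in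
`[-π, π]`. -/
def cell : Set (EuclideanSpace ℝ (Fin d)) := {u | ∀ i, |inner ℝ (W.basis i) u| ≤ Real.pi}

@[fun_prop]
theorem continuous_char : Continuous W.char := by
  unfold char
  fun_prop

@[fun_prop]
theorem continuous_symbol : Continuous W.symbol := by
  unfold symbol
  fun_prop

theorem norm_char_le_one (u : EuclideanSpace ℝ (Fin d)) : ‖W.char u‖ ≤ 1 := by
  rw [← W.sum_wt, char]
  refine norm_sum_le_of_le _ fun x _ => ?_
  rw [norm_mul, Complex.norm_exp_ofReal_mul_I, mul_one, Complex.norm_real, Real.norm_eq_abs,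
    abs_of_nonneg (W.wt_nonneg x)]

theorem char_re (u : EuclideanSpace ℝ (Fin d)) :
    (W.char u).re = ∑ x ∈ W.steps, W.wt x * Real.cos (inner ℝ (W.pos x) u) := by
  simp only [char, Complex.re_sum]
  refine Finset.sum_congr rfl fun x _ => ?_
  rw [Complex.re_ofReal_mul, Complex.exp_ofReal_mul_I_re]

theorem char_im (u : EuclideanSpace ℝ (Fin d)) :
    (W.char u).im = ∑ x ∈ W.steps, W.wt x * Real.sin (inner ℝ (W.pos x) u) := by
  simp only [char, Complex.im_sum]
  refine Finset.sum_congr rfl fun x _ => ?_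
  rw [Complex.im_ofReal_mul, Complex.exp_ofReal_mul_I_im]

theorem symbol_re (u : EuclideanSpace ℝ (Fin d)) :
    (W.symbol u).re = ∑ x ∈ W.steps, W.wt x * (1 - Real.cos (inner ℝ (W.pos x) u)) := by
  simp only [symbol, Complex.sub_re, Complex.one_re, char_re, mul_sub, mul_one,
    Finset.sum_sub_distrib, W.sum_wt]

theorem symbol_im (u : EuclideanSpace ℝ (Fin d)) : (W.symbol u).im = -(W.char u).im := by
  simp [symbol]

/-- The linear isomorphism recording the frequencies `⟨basis i, u⟩`. -/
def freq : EuclideanSpace ℝ (Fin d) ≃L[ℝ] (Fin d → ℝ) :=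
  LinearEquiv.toContinuousLinearEquiv <| LinearEquiv.ofInjectiveOfFinrankEq
    (LinearMap.pi fun i => (innerSL ℝ (W.basis i)).toLinearMap)
    (by
      rw [← LinearMap.ker_eq_bot, LinearMap.ker_eq_bot']
      intro u hu
      refine eq_zero_of_forall_inner_basis_eq_zero W.basis fun i => ?_
      simpa using congrFun hu i)
    (by simp)

theorem freq_apply (u : EuclideanSpace ℝ (Fin d)) (i : Fin d) :
    W.freq u i = inner ℝ (W.basis i) u := rfl

theorem cell_eq_preimage :
    W.cell = W.freq ⁻¹' (Set.Icc (fun _ => -Real.pi) (fun _ => Real.pi)) := by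
  ext u
  simp only [cell, Set.mem_ofPred_eq, Set.mem_preimage, Set.mem_Icc, Pi.le_def, abs_le, freq_apply]
  exact forall_and

theorem isCompact_cell : IsCompact W.cell := by
  rw [cell_eq_preimage]
  exact W.freq.toHomeomorph.isCompact_preimage.mpr isCompact_Icc

theorem measurableSet_cell : MeasurableSet W.cell := W.isCompact_cell.measurableSet

theorem exists_ball_subset_cell : ∃ δ : ℝ, 0 < δ ∧ ∀ u, ‖u‖ ≤ δ → u ∈ W.cell := by
  have h : W.cell ∈ 𝓝 (0 : EuclideanSpace ℝ (Fin d)) := by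
    rw [cell_eq_preimage]
    refine W.freq.continuous.continuousAt.preimage_mem_nhds ?_
    rw [map_zero, ← Set.pi_univ_Icc]
    refine set_pi_mem_nhds Set.finite_univ fun i _ => ?_
    exact Icc_mem_nhds (by simp [Real.pi_pos]) (by simp [Real.pi_pos])
  obtain ⟨δ, hδ, hs⟩ := Metric.nhds_basis_closedBall.mem_iff.mp h
  exact ⟨δ, hδ, fun u hu => hs (by simpa using hu)⟩

/-- Irreducibility: the symbol vanishes in the cell at the origin only. -/
theorem eq_zero_of_symbol_re_eq_zero {u : EuclideanSpace ℝ (Fin d)} (hu : u ∈ W.cell)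
    (h : (W.symbol u).re = 0) : u = 0 := by
  rw [symbol_re, Finset.sum_eq_zero_iff_of_nonneg] at h
  swap
  · intro x _
    exact mul_nonneg (W.wt_nonneg x) (by linarith [Real.cos_le_one (inner ℝ (W.pos x) u)])
  let H : AddSubmonoid G :=
    { carrier := {z | ∃ k : ℤ, (k : ℝ) * (2 * Real.pi) = inner ℝ (W.pos z) u}
      zero_mem' := ⟨0, by simp⟩
      add_mem' := by
        rintro a b ⟨k, hk⟩ ⟨l, hl⟩
        exact ⟨k + l, by rw [map_add, inner_add_left, ← hk, ← hl]; push_cast; ring⟩ }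
  have hH : ∀ x, W.law x ≠ 0 → x ∈ H := by
    intro x hx
    have h1 := h x (W.mem_steps x hx)
    have h2 : W.wt x ≠ 0 := by
      rw [wt, ne_eq, ENNReal.toReal_eq_zero_iff]
      exact not_or.mpr ⟨hx, PMF.apply_ne_top _ _⟩
    have h3 : Real.cos (inner ℝ (W.pos x) u) = 1 := by
      have := (mul_eq_zero.mp h1).resolve_left h2
      linarith
    exact (Real.cos_eq_one_iff _).mp h3
  refine eq_zero_of_forall_inner_basis_eq_zero W.basis fun i => ?_
  obtain ⟨z, hz⟩ := W.basis_mem i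
  obtain ⟨n, hn⟩ := W.reach z
  obtain ⟨k, hk⟩ := mem_of_stepProb_ne_zero W.law H hH n z hn.ne'
  rw [hz] at hk
  have h4 := hu i
  rw [← hk, abs_mul, abs_of_pos (by positivity : 0 < 2 * Real.pi)] at h4
  have h5 : |(k : ℝ)| < 1 := by
    have := Real.pi_pos
    nlinarith
  have h6 : k = 0 := by
    rw [← Int.abs_lt_one_iff]
    exact_mod_cast h5
  rw [← hk, h6]
  simp

/-- The quadratic lower bound for the real part of the symbol. -/
theorem exists_le_symbol_re : ∃ c : ℝ, 0 < c ∧ ∀ u ∈ W.cell, c * ‖u‖ ^ 2 ≤ (W.symbol u).re := by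
  have hB := W.one_le_B
  have hpi := Real.pi_pos
  set δ : ℝ := Real.pi / W.B with hδ
  have hδ0 : 0 < δ := by positivity
  have near : ∀ u : EuclideanSpace ℝ (Fin d), ‖u‖ ≤ δ →
      (2 / Real.pi ^ 2 * (2 * W.q)) * ‖u‖ ^ 2 ≤ (W.symbol u).re := by
    intro u hu
    rw [mul_assoc, ← W.sum_wt_inner_sq, symbol_re, Finset.mul_sum]
    refine Finset.sum_le_sum fun x hx => ?_
    have h1 : |inner ℝ (W.pos x) u| ≤ Real.pi := by
      refine (W.abs_inner_le hx u).trans ?_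
      rw [hδ, le_div_iff₀ (by linarith)] at hu
      linarith
    have h2 := Real.cos_le_one_sub_mul_cos_sq h1
    have h3 := W.wt_nonneg x
    nlinarith
  have hq := W.q_pos
  have hK : IsCompact (W.cell ∩ {u | δ ≤ ‖u‖}) :=
    W.isCompact_cell.inter_right (isClosed_le continuous_const continuous_norm)
  have far : ∃ c : ℝ, 0 < c ∧ ∀ u ∈ W.cell ∩ {u | δ ≤ ‖u‖}, c * ‖u‖ ^ 2 ≤ (W.symbol u).re := by
    rcases (W.cell ∩ {u | δ ≤ ‖u‖}).eq_empty_or_nonempty with he | hne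
    · exact ⟨1, one_pos, by simp [he]⟩
    · have hcont : ContinuousOn (fun u => (W.symbol u).re / ‖u‖ ^ 2)
          (W.cell ∩ {u | δ ≤ ‖u‖}) := by
        refine ContinuousOn.div (by fun_prop) (by fun_prop) ?_
        intro u hu
        have : 0 < ‖u‖ := hδ0.trans_le hu.2
        positivity
      obtain ⟨v, hv, hmin⟩ := hK.exists_isMinOn hne hcont
      have hv0 : 0 < ‖v‖ := hδ0.trans_le hv.2
      refine ⟨(W.symbol v).re / ‖v‖ ^ 2, ?_, ?_⟩
      · refine div_pos (lt_of_le_of_ne ?_ ?_) (by positivity)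
        · rw [symbol_re]
          exact Finset.sum_nonneg fun x _ => mul_nonneg (W.wt_nonneg x)
            (by linarith [Real.cos_le_one (inner ℝ (W.pos x) v)])
        · intro h0
          exact norm_pos_iff.mp hv0 (W.eq_zero_of_symbol_re_eq_zero hv.1 h0.symm)
      · intro u hu
        have hu0 : 0 < ‖u‖ := hδ0.trans_le hu.2
        have := hmin hu
        simp only [Set.mem_ofPred_eq] at this
        rwa [le_div_iff₀ (by positivity)] at this
  obtain ⟨c, hc, hfar⟩ := far
  refine ⟨min c (2 / Real.pi ^ 2 * (2 * W.q)), by positivity, fun u hu => ?_⟩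
  rcases le_total ‖u‖ δ with h | h
  · exact (mul_le_mul_of_nonneg_right (min_le_right _ _) (by positivity)).trans (near u h)
  · exact (mul_le_mul_of_nonneg_right (min_le_left _ _) (by positivity)).trans (hfar u ⟨hu, h⟩)

/-- The constant in the quadratic lower bound for the symbol. -/
def c : ℝ := W.exists_le_symbol_re.choose

theorem c_pos : 0 < W.c := W.exists_le_symbol_re.choose_spec.1

theorem le_symbol_re {u : EuclideanSpace ℝ (Fin d)} (hu : u ∈ W.cell) :
    W.c * ‖u‖ ^ 2 ≤ (W.symbol u).re :=
  W.exists_le_symbol_re.choose_spec.2 u hu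

theorem symbol_ne_zero {u : EuclideanSpace ℝ (Fin d)} (hu : u ∈ W.cell) (h0 : u ≠ 0) :
    W.symbol u ≠ 0 := by
  intro h
  exact h0 (W.eq_zero_of_symbol_re_eq_zero hu (by simp [h]))

theorem symbol_re_le (u : EuclideanSpace ℝ (Fin d)) : (W.symbol u).re ≤ W.q * ‖u‖ ^ 2 := by
  have h : W.q * ‖u‖ ^ 2 = ∑ x ∈ W.steps, W.wt x * (inner ℝ (W.pos x) u) ^ 2 / 2 := by
    rw [← Finset.sum_div, W.sum_wt_inner_sq]; ring
  rw [h, symbol_re]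
  refine Finset.sum_le_sum fun x _ => ?_
  have h2 := Real.one_sub_sq_div_two_le_cos (x := inner ℝ (W.pos x) u)
  have h3 := W.wt_nonneg x
  nlinarith

theorem abs_sin_sub_self_le (x : ℝ) : |Real.sin x - x| ≤ |x| ^ 3 := by
  have key : ∀ y : ℝ, 0 ≤ y → |Real.sin y - y| ≤ y ^ 3 := by
    intro y hy
    rcases hy.eq_or_lt with rfl | hy
    · simp
    have h1 := Real.sin_le hy.le
    rw [abs_of_nonpos (by linarith)]
    have h2 := Real.sin_gt_sub_cube hy
    have h3 : 0 < y ^ 3 := by positivity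
    linarith
  rcases le_total 0 x with h | h
  · rw [abs_of_nonneg h]; exact key x h
  · have := key (-x) (by linarith)
    rw [abs_of_nonpos h]
    rw [Real.sin_neg, show -Real.sin x - -x = -(Real.sin x - x) by ring, abs_neg] at this
    exact this

/-- As the walk is centred, the imaginary part of its characteristic function is cubic. -/
theorem abs_char_im_le (u : EuclideanSpace ℝ (Fin d)) :
    |(W.char u).im| ≤ W.B ^ 3 * ‖u‖ ^ 3 := by
  have h1 : (W.char u).im = ∑ x ∈ W.steps, W.wt x *
      (Real.sin (inner ℝ (W.pos x) u) - inner ℝ (W.pos x) u) := by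
    simp only [mul_sub, Finset.sum_sub_distrib, W.sum_wt_inner, sub_zero, char_im]
  have h2 : W.B ^ 3 * ‖u‖ ^ 3 = ∑ x ∈ W.steps, W.wt x * (W.B ^ 3 * ‖u‖ ^ 3) := by
    rw [← Finset.sum_mul, W.sum_wt, one_mul]
  rw [h1, h2]
  refine (Finset.abs_sum_le_sum_abs _ _).trans (Finset.sum_le_sum fun x hx => ?_)
  rw [abs_mul, abs_of_nonneg (W.wt_nonneg x)]
  refine mul_le_mul_of_nonneg_left ?_ (W.wt_nonneg x)
  refine (abs_sin_sub_self_le _).trans ?_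
  rw [← mul_pow]
  exact pow_le_pow_left₀ (abs_nonneg _) (W.abs_inner_le hx u) 3

end SphericalWalk
end LatticeWalk

/-! ### Fourier inversion and the walk in continuous time -/

namespace LatticeWalk
namespace SphericalWalk

variable {G : Type*} [AddCommGroup G] {d : ℕ} (W : SphericalWalk G d)

/-- The volume of the cell. -/
def vol : ℝ := volume.real W.cell

theorem vol_pos : 0 < W.vol := by
  obtain ⟨δ, hδ, h⟩ := W.exists_ball_subset_cell
  have h1 : 0 < volume W.cell :=
    (Metric.measure_ball_pos volume (0 : EuclideanSpace ℝ (Fin d)) hδ).trans_le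
      (measure_mono fun u hu => h u (by simpa using (Metric.mem_ball.mp hu).le))
  exact ENNReal.toReal_pos h1.ne' W.isCompact_cell.measure_lt_top.ne

/-- The character `exp (-i ⟨z, u⟩)`. -/
def wave (z : G) (u : EuclideanSpace ℝ (Fin d)) : ℂ :=
  Complex.exp (-(inner ℝ (W.pos z) u : ℝ) * Complex.I)

@[fun_prop]
theorem continuous_wave (z : G) : Continuous (W.wave z) := by
  unfold wave
  fun_prop

theorem norm_wave (z : G) (u : EuclideanSpace ℝ (Fin d)) : ‖W.wave z u‖ = 1 := by
  rw [wave, ← Complex.ofReal_neg, Complex.norm_exp_ofReal_mul_I]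

theorem wave_zero (u : EuclideanSpace ℝ (Fin d)) : W.wave 0 u = 1 := by
  simp [wave]

theorem integrableOn_cell {F : Type*} [NormedAddCommGroup F]
    {f : EuclideanSpace ℝ (Fin d) → F} (hf : Continuous f) : IntegrableOn f W.cell :=
  hf.continuousOn.integrableOn_compact W.isCompact_cell

theorem integral_Icc_exp_int_mul (n : ℤ) (hn : n ≠ 0) :
    ∫ s in Set.Icc (-Real.pi) Real.pi, Complex.exp (-((n : ℝ) * s : ℝ) * Complex.I) = 0 := by
  rw [integral_Icc_eq_integral_Ioc,
    ← intervalIntegral.integral_of_le (by linarith [Real.pi_pos])]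
  have h1 : ∀ s : ℝ, Complex.exp (-((n : ℝ) * s : ℝ) * Complex.I)
      = Complex.exp ((-(n : ℂ) * Complex.I) * s) := by
    intro s; congr 1; push_cast; ring
  simp only [h1]
  rw [integral_exp_mul_complex (by simp [hn])]
  have h2 : Complex.exp (-(n : ℂ) * Complex.I * (Real.pi : ℝ))
      = Complex.exp (-(n : ℂ) * Complex.I * ((-Real.pi : ℝ) : ℂ)) := by
    rw [Complex.exp_eq_exp_iff_exists_int]
    exact ⟨-n, by push_cast; ring⟩
  rw [h2, sub_self, zero_div]

/-- Orthogonality of characters over the cell. -/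
theorem integral_wave {z : G} (hz : z ≠ 0) : ∫ u in W.cell, W.wave z u = 0 := by
  choose n hn using W.coord_int z
  have hne : ∃ i, n i ≠ 0 := by
    by_contra! h
    apply hz
    apply W.pos_injective
    rw [map_zero]
    apply W.basis.repr.injective
    ext i
    simp [hn, h]
  have hwave : ∀ u, W.wave z u =
      ∏ i, Complex.exp (-((n i : ℝ) * W.freq u i : ℝ) * Complex.I) := by
    intro u
    rw [← Complex.exp_sum, wave]
    congr 1
    conv_lhs => rw [← W.basis.sum_repr (W.pos z)]
    simp only [sum_inner, real_inner_smul_left, hn, freq_apply]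
    push_cast
    rw [← Finset.sum_mul, Finset.sum_neg_distrib]
  have hmap : ∃ κ : NNReal, (volume : Measure (EuclideanSpace ℝ (Fin d))).map W.freq
      = κ • volume := by
    have : ((volume : Measure (EuclideanSpace ℝ (Fin d))).map W.freq).IsAddHaarMeasure :=
      W.freq.isAddHaarMeasure_map _
    exact ⟨_, Measure.isAddLeftInvariant_eq_smul _ _⟩
  obtain ⟨κ, hκ⟩ := hmap
  have hemb : MeasurableEmbedding W.freq := W.freq.toHomeomorph.measurableEmbedding
  have h1 : ∫ u in W.cell, W.wave z u =
      ∫ θ in Set.Icc (fun _ => -Real.pi) (fun _ => Real.pi),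
        ∏ i, Complex.exp (-((n i : ℝ) * θ i : ℝ) * Complex.I)
        ∂((volume : Measure (EuclideanSpace ℝ (Fin d))).map W.freq) := by
    rw [hemb.setIntegral_map, ← cell_eq_preimage]
    simp only [hwave]
  rw [h1, hκ, Measure.restrict_smul, integral_smul_nnreal_measure, ← Set.pi_univ_Icc, volume_pi,
    Measure.restrict_pi_pi, integral_fintype_prod_eq_prod
      (f := fun i (s : ℝ) => Complex.exp (-((n i : ℝ) * s : ℝ) * Complex.I))]
  obtain ⟨i, hi⟩ := hne
  rw [Finset.prod_eq_zero (Finset.mem_univ i) (integral_Icc_exp_int_mul (n i) hi), smul_zero]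

/-- Fourier inversion for the law of the walk at time `n`. -/
theorem integral_char_pow_mul_wave (n : ℕ) (z : G) :
    ∫ u in W.cell, W.char u ^ n * W.wave z u = W.vol * stepProb W.law n z := by
  classical
  induction n generalizing z with
  | zero =>
    rw [stepProb_zero]
    split_ifs with h
    · subst h
      simp [wave_zero, vol]
    · simp [W.integral_wave h]
  | succ n ih =>
    have h1 : ∀ u, W.char u ^ (n + 1) * W.wave z u =
        ∑ x ∈ W.steps, (W.wt x : ℂ) * (W.char u ^ n * W.wave (z - x) u) := by
      intro u
      have h2 : ∀ x, W.wave (z - x) u =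
          Complex.exp ((inner ℝ (W.pos x) u : ℝ) * Complex.I) * W.wave z u := by
        intro x
        rw [wave, wave, ← Complex.exp_add, map_sub, inner_sub_left]
        congr 1
        push_cast
        ring
      simp only [h2]
      rw [pow_succ, mul_assoc]
      nth_rewrite 2 [char]
      rw [Finset.sum_mul, Finset.mul_sum]
      refine Finset.sum_congr rfl fun x _ => ?_
      ring
    simp only [h1]
    rw [integral_finsetSum]
    · rw [stepProb_succ W.law W.steps W.mem_steps]
      simp only [integral_const_mul, ih]
      push_cast
      rw [Finset.mul_sum]
      refine Finset.sum_congr rfl fun x _ => ?_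
      rw [wt]
      ring
    · intro x _
      exact W.integrableOn_cell (by fun_prop)

/-- The transition probabilities `e^{-t} ∑ n, t ^ n / n! * P_n(z)` of the walk run in continuous
time, written as a Fourier integral. -/
def heat (t : ℝ) (z : G) : ℝ :=
  W.vol⁻¹ * ∫ u in W.cell, (Complex.exp (-t * W.symbol u) * W.wave z u).re

/-- Finite speed of propagation in continuous time. -/
theorem abs_heat_le {t : ℝ} (ht : 0 ≤ t) (z : G) :
    |W.heat t z| ≤ Real.exp (2 * t - ‖W.pos z‖ / W.B) := by
  have hv := W.vol_pos
  set F : ℕ → EuclideanSpace ℝ (Fin d) → ℂ := fun n u =>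
    (Real.exp (-t) * (t ^ n / n.factorial) : ℝ) * (W.char u ^ n * W.wave z u) with hF
  have hFint : ∀ n, IntegrableOn (F n) W.cell := fun n => W.integrableOn_cell (by fun_prop)
  have hnorm : ∀ n u, ‖F n u‖ ≤ Real.exp (-t) * (t ^ n / n.factorial) := by
    intro n u
    simp only [hF]
    rw [norm_mul, norm_mul, norm_wave, mul_one, Complex.norm_real, Real.norm_eq_abs,
      abs_of_nonneg (by positivity), norm_pow]
    exact mul_le_of_le_one_right (by positivity)
      (pow_le_one₀ (norm_nonneg _) (W.norm_char_le_one u))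
  have hsum : Summable fun n : ℕ => Real.exp (-t) * (t ^ n / n.factorial) :=
    (Real.summable_pow_div_factorial t).mul_left _
  have hS : ∀ u, ∑' n, F n u = Complex.exp (-t * W.symbol u) * W.wave z u := by
    intro u
    have h1 : -(t : ℂ) * W.symbol u = ((-t : ℝ) : ℂ) + t * W.char u := by
      rw [symbol]; push_cast; ring
    have h2 : Complex.exp (t * W.char u) = ∑' n : ℕ, (t * W.char u) ^ n / (n.factorial : ℂ) := by
      rw [Complex.exp_eq_exp_ℂ, NormedSpace.exp_eq_tsum_div]
    rw [h1, Complex.exp_add, h2, ← tsum_mul_left, ← tsum_mul_right]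
    refine tsum_congr fun n => ?_
    simp only [hF]
    push_cast
    rw [mul_pow]
    ring
  have hI := hasSum_integral_of_summable_integral_norm (μ := volume.restrict W.cell) hFint (by
    refine Summable.of_nonneg_of_le (fun n => integral_nonneg fun _ => norm_nonneg _) (fun n => ?_)
      (hsum.mul_left W.vol)
    calc ∫ u in W.cell, ‖F n u‖ ≤ ∫ u in W.cell, Real.exp (-t) * (t ^ n / n.factorial) :=
          integral_mono (hFint n).norm (W.integrableOn_cell continuous_const) (hnorm n)
      _ = W.vol * (Real.exp (-t) * (t ^ n / n.factorial)) := by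
          rw [setIntegral_const, smul_eq_mul, vol])
  simp only [hS] at hI
  have hre : W.heat t z = W.vol⁻¹ * (∫ u in W.cell,
      Complex.exp (-t * W.symbol u) * W.wave z u).re := by
    rw [heat]
    congr 1
    exact integral_re (𝕜 := ℂ) (f := fun u => Complex.exp (-t * W.symbol u) * W.wave z u)
      (W.integrableOn_cell (by fun_prop))
  have hterm : ∀ n, ‖∫ u in W.cell, F n u‖ ≤
      W.vol * Real.exp (-t - ‖W.pos z‖ / W.B) * ((Real.exp 1 * t) ^ n / n.factorial) := by
    intro n
    simp only [hF]
    rw [integral_const_mul, integral_char_pow_mul_wave, ← Complex.ofReal_mul, ← Complex.ofReal_mul,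
      Complex.norm_real, Real.norm_eq_abs, abs_of_nonneg (by
        have := stepProb_nonneg W.law n z
        positivity)]
    have h1 := W.stepProb_le_exp n z
    calc Real.exp (-t) * (t ^ n / n.factorial) * (W.vol * stepProb W.law n z)
        ≤ Real.exp (-t) * (t ^ n / n.factorial) * (W.vol * Real.exp (n - ‖W.pos z‖ / W.B)) := by
          gcongr
      _ = _ := by
          rw [mul_pow, ← Real.exp_nat_mul, mul_one, sub_eq_add_neg, sub_eq_add_neg, Real.exp_add,
            Real.exp_add]
          ring
  have hle : ‖∫ u in W.cell, Complex.exp (-t * W.symbol u) * W.wave z u‖ ≤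
      W.vol * Real.exp (-t - ‖W.pos z‖ / W.B) * Real.exp (Real.exp 1 * t) := by
    rw [← hI.tsum_eq]
    refine tsum_of_norm_bounded ?_ hterm
    refine HasSum.mul_left _ ?_
    have h1 := NormedSpace.expSeries_div_hasSum_exp (𝔸 := ℝ) (Real.exp 1 * t)
    rwa [← Real.exp_eq_exp_ℝ] at h1
  rw [hre, abs_mul, abs_of_pos (inv_pos.mpr hv)]
  calc W.vol⁻¹ * |(∫ u in W.cell, Complex.exp (-t * W.symbol u) * W.wave z u).re|
      ≤ W.vol⁻¹ * (W.vol * Real.exp (-t - ‖W.pos z‖ / W.B) * Real.exp (Real.exp 1 * t)) := by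
        gcongr
        exact (Complex.abs_re_le_norm _).trans hle
    _ = Real.exp (-t - ‖W.pos z‖ / W.B + Real.exp 1 * t) := by
        rw [Real.exp_add]; field_simp
    _ ≤ _ := by
        apply Real.exp_le_exp.mpr
        have := Real.exp_one_lt_d9
        nlinarith

end SphericalWalk
end LatticeWalk

/-! ### The time integral of the heat kernel -/

namespace LatticeWalk
namespace SphericalWalk

variable {G : Type*} [AddCommGroup G] {d : ℕ} (W : SphericalWalk G d)

theorem wave_re (z : G) (u : EuclideanSpace ℝ (Fin d)) :
    (W.wave z u).re = Real.cos (inner ℝ (W.pos z) u) := by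
  rw [wave, ← Complex.ofReal_neg, Complex.exp_ofReal_mul_I_re, Real.cos_neg]

theorem wave_im (z : G) (u : EuclideanSpace ℝ (Fin d)) :
    (W.wave z u).im = -Real.sin (inner ℝ (W.pos z) u) := by
  rw [wave, ← Complex.ofReal_neg, Complex.exp_ofReal_mul_I_im, Real.sin_neg]

theorem abs_one_sub_wave_re_le (z : G) (u : EuclideanSpace ℝ (Fin d)) :
    |(1 - W.wave z u).re| ≤ ‖W.pos z‖ ^ 2 * ‖u‖ ^ 2 := by
  rw [Complex.sub_re, Complex.one_re, wave_re,
    abs_of_nonneg (by linarith [Real.cos_le_one (inner ℝ (W.pos z) u)]), ← mul_pow]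
  have h1 := Real.one_sub_sq_div_two_le_cos (x := inner ℝ (W.pos z) u)
  have h2 := sq_le_sq' (neg_le_of_abs_le (abs_real_inner_le_norm (W.pos z) u))
    (le_of_abs_le (abs_real_inner_le_norm (W.pos z) u))
  nlinarith

theorem abs_one_sub_wave_im_le (z : G) (u : EuclideanSpace ℝ (Fin d)) :
    |(1 - W.wave z u).im| ≤ ‖W.pos z‖ * ‖u‖ := by
  rw [Complex.sub_im, Complex.one_im, wave_im, zero_sub, neg_neg]
  exact (Real.abs_sin_le_abs).trans (abs_real_inner_le_norm _ _)

theorem norm_exp_neg_mul_symbol_le {t : ℝ} (ht : 0 ≤ t) {u : EuclideanSpace ℝ (Fin d)}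
    (hu : u ∈ W.cell) : ‖Complex.exp (-t * W.symbol u)‖ ≤ Real.exp (-(W.c * ‖u‖ ^ 2 * t)) := by
  rw [Complex.norm_exp, ← Complex.ofReal_neg, Complex.re_ofReal_mul]
  apply Real.exp_le_exp.mpr
  nlinarith [W.le_symbol_re hu]

theorem abs_exp_neg_mul_symbol_im_le {t : ℝ} (ht : 0 ≤ t) {u : EuclideanSpace ℝ (Fin d)}
    (hu : u ∈ W.cell) : |(Complex.exp (-t * W.symbol u)).im| ≤
      Real.exp (-(W.c * ‖u‖ ^ 2 * t)) * (t * (W.B ^ 3 * ‖u‖ ^ 3)) := by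
  rw [Complex.exp_im, abs_mul, Real.abs_exp, ← Complex.ofReal_neg, Complex.re_ofReal_mul,
    Complex.im_ofReal_mul]
  gcongr
  · nlinarith [W.le_symbol_re hu]
  · refine (Real.abs_sin_le_abs).trans ?_
    rw [abs_mul, abs_neg, abs_of_nonneg ht, symbol_im, abs_neg]
    gcongr
    exact W.abs_char_im_le u

/-- The constant in `abs_re_mul_exp_le`. -/
def potBound (z : G) : ℝ := ‖W.pos z‖ ^ 2 + 2 * ‖W.pos z‖ * W.B ^ 3 / W.c

theorem potBound_nonneg (z : G) : 0 ≤ W.potBound z := by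
  have := W.c_pos
  have := W.one_le_B
  unfold potBound
  positivity

/-- Taking real parts gains a factor `‖u‖`, since the imaginary part of the symbol is cubic. This
makes the Fourier integral of the potential absolutely convergent in dimension one as well. -/
theorem abs_re_mul_exp_le (z : G) {t : ℝ} (ht : 0 ≤ t) {u : EuclideanSpace ℝ (Fin d)}
    (hu : u ∈ W.cell) : |((1 - W.wave z u) * Complex.exp (-t * W.symbol u)).re| ≤
      W.potBound z * ‖u‖ ^ 2 * Real.exp (-(W.c / 2 * ‖u‖ ^ 2) * t) := by
  have hc := W.c_pos
  have hB := W.one_le_B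
  have h1 := W.abs_one_sub_wave_re_le z u
  have h2 := W.abs_one_sub_wave_im_le z u
  have h3 := (Complex.abs_re_le_norm _).trans (W.norm_exp_neg_mul_symbol_le ht hu)
  have h4 := W.abs_exp_neg_mul_symbol_im_le ht hu
  set y := W.c / 2 * ‖u‖ ^ 2 * t with hy
  have hy0 : 0 ≤ y := by positivity
  have e1 : Real.exp (-(W.c * ‖u‖ ^ 2 * t)) = Real.exp (-y) * Real.exp (-y) := by
    rw [← Real.exp_add]; congr 1; rw [hy]; ring
  have e2 : Real.exp (-(W.c / 2 * ‖u‖ ^ 2) * t) = Real.exp (-y) := by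
    congr 1; rw [hy]; ring
  have e3 : Real.exp (-y) ≤ 1 := Real.exp_le_one_iff.mpr (by linarith)
  have e4 : y * Real.exp (-y) ≤ 1 := by
    rw [Real.exp_neg, ← div_eq_mul_inv, div_le_one (Real.exp_pos _)]
    linarith [Real.add_one_le_exp y]
  rw [e1] at h3 h4
  rw [e2, Complex.mul_re]
  refine (abs_sub _ _).trans ?_
  rw [abs_mul, abs_mul]
  have k1 : |(1 - W.wave z u).re| * |(Complex.exp (-t * W.symbol u)).re| ≤
      ‖W.pos z‖ ^ 2 * ‖u‖ ^ 2 * Real.exp (-y) := by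
    refine mul_le_mul h1 (h3.trans ?_) (abs_nonneg _) (by positivity)
    exact mul_le_of_le_one_left (Real.exp_pos _).le e3
  have k2 : |(1 - W.wave z u).im| * |(Complex.exp (-t * W.symbol u)).im| ≤
      2 * ‖W.pos z‖ * W.B ^ 3 / W.c * ‖u‖ ^ 2 * Real.exp (-y) := by
    calc _ ≤ (‖W.pos z‖ * ‖u‖) *
          (Real.exp (-y) * Real.exp (-y) * (t * (W.B ^ 3 * ‖u‖ ^ 3))) :=
          mul_le_mul h2 h4 (abs_nonneg _) (by positivity)
      _ = 2 * ‖W.pos z‖ * W.B ^ 3 / W.c * ‖u‖ ^ 2 * Real.exp (-y) * (y * Real.exp (-y)) := by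
          rw [hy]; field_simp
      _ ≤ _ := mul_le_of_le_one_right (by positivity) e4
  rw [potBound]
  linarith

theorem integral_exp_neg_mul_Ioi {b : ℝ} (hb : 0 < b) :
    IntegrableOn (fun t => Real.exp (-b * t)) (Set.Ioi 0) ∧
      ∫ t in Set.Ioi (0 : ℝ), Real.exp (-b * t) = b⁻¹ := by
  refine ⟨integrableOn_exp_mul_Ioi (by linarith) 0, ?_⟩
  rw [integral_exp_mul_Ioi (by linarith)]
  simp

/-- Joint integrability in time and frequency, so that the two integrals can be exchanged. -/
theorem integrable_re_mul_exp (z : G) :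
    Integrable (fun s : ℝ × EuclideanSpace ℝ (Fin d) =>
      ((1 - W.wave z s.2) * Complex.exp (-s.1 * W.symbol s.2)).re)
      ((volume.restrict (Set.Ioi 0)).prod (volume.restrict W.cell)) := by
  have hcont : Continuous (fun s : ℝ × EuclideanSpace ℝ (Fin d) =>
      ((1 - W.wave z s.2) * Complex.exp (-s.1 * W.symbol s.2)).re) := by fun_prop
  have hc := W.c_pos
  have hM := W.potBound_nonneg z
  have hb : ∀ u ∈ W.cell, u ≠ 0 →
      Integrable (fun t : ℝ => ((1 - W.wave z u) * Complex.exp (-t * W.symbol u)).re)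
        (volume.restrict (Set.Ioi 0)) ∧
      ∫ t in Set.Ioi (0 : ℝ), ‖((1 - W.wave z u) * Complex.exp (-t * W.symbol u)).re‖ ≤
        W.potBound z * (2 / W.c) := by
    intro u hu hu0
    have hn : 0 < ‖u‖ := norm_pos_iff.mpr hu0
    obtain ⟨hi, hv⟩ := integral_exp_neg_mul_Ioi (b := W.c / 2 * ‖u‖ ^ 2) (by positivity)
    have hi' := hi.const_mul (W.potBound z * ‖u‖ ^ 2)
    have hle : ∀ᵐ t : ℝ ∂(volume.restrict (Set.Ioi (0 : ℝ))),
        ‖((1 - W.wave z u) * Complex.exp (-t * W.symbol u)).re‖ ≤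
        W.potBound z * ‖u‖ ^ 2 * Real.exp (-(W.c / 2 * ‖u‖ ^ 2) * t) := by
      filter_upwards [ae_restrict_mem measurableSet_Ioi] with t ht
      exact W.abs_re_mul_exp_le z (le_of_lt ht) hu
    have hint : Integrable (fun t : ℝ => ((1 - W.wave z u) * Complex.exp (-t * W.symbol u)).re)
        (volume.restrict (Set.Ioi 0)) :=
      hi'.mono' (Continuous.aestronglyMeasurable (by fun_prop)) hle
    refine ⟨hint, (integral_mono_ae hint.norm hi' hle).trans (le_of_eq ?_)⟩
    rw [integral_const_mul, hv]
    field_simp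
  have hae : ∀ᵐ u ∂(volume.restrict W.cell), u ∈ W.cell := ae_restrict_mem W.measurableSet_cell
  have h0 : ∀ u ∈ W.cell,
      Integrable (fun t : ℝ => ((1 - W.wave z u) * Complex.exp (-t * W.symbol u)).re)
        (volume.restrict (Set.Ioi 0)) ∧
      ∫ t in Set.Ioi (0 : ℝ), ‖((1 - W.wave z u) * Complex.exp (-t * W.symbol u)).re‖ ≤
        W.potBound z * (2 / W.c) := by
    intro u hu
    by_cases hu0 : u = 0
    · have : W.wave z u = 1 := by simp [hu0, wave]
      simp only [this, sub_self, zero_mul, Complex.zero_re]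
      refine ⟨integrable_zero _ _ _, ?_⟩
      simp only [norm_zero, integral_zero]
      positivity
    · exact hb u hu hu0
  rw [integrable_prod_iff' hcont.aestronglyMeasurable]
  refine ⟨hae.mono fun u hu => (h0 u hu).1, ?_⟩
  have hfin : IsFiniteMeasure (volume.restrict W.cell) :=
    ⟨by simpa using W.isCompact_cell.measure_lt_top⟩
  refine (integrable_const (W.potBound z * (2 / W.c))).mono'
    hcont.norm.aestronglyMeasurable.prod_swap.integral_prod_right' ?_
  filter_upwards [hae] with u hu
  rw [Real.norm_eq_abs, abs_of_nonneg (integral_nonneg fun _ => norm_nonneg _)]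
  exact (h0 u hu).2

theorem heat_zero_sub_heat (t : ℝ) (z : G) : W.heat t 0 - W.heat t z =
    W.vol⁻¹ * ∫ u in W.cell, ((1 - W.wave z u) * Complex.exp (-t * W.symbol u)).re := by
  rw [heat, heat, ← mul_sub, ← integral_sub]
  · congr 1
    refine integral_congr_ae (ae_of_all _ fun u => ?_)
    simp only [wave_zero, mul_one, ← Complex.sub_re]
    congr 1
    ring
  · exact W.integrableOn_cell (by fun_prop)
  · exact W.integrableOn_cell (by fun_prop)

theorem integrableOn_heat_sub (z : G) :
    IntegrableOn (fun t => W.heat t 0 - W.heat t z) (Set.Ioi 0) := by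
  simp only [heat_zero_sub_heat]
  exact (W.integrable_re_mul_exp z).integral_prod_left.const_mul _

theorem integral_re_mul_exp {u : EuclideanSpace ℝ (Fin d)} (z : G) (hu : u ∈ W.cell)
    (hu0 : u ≠ 0) :
    ∫ t in Set.Ioi (0 : ℝ), ((1 - W.wave z u) * Complex.exp (-t * W.symbol u)).re =
      ((1 - W.wave z u) / W.symbol u).re := by
  have hn : 0 < ‖u‖ := norm_pos_iff.mpr hu0
  have hre : 0 < (W.symbol u).re := by
    have := W.c_pos
    exact lt_of_lt_of_le (by positivity) (W.le_symbol_re hu)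
  have hre' : (-W.symbol u).re < 0 := by simpa using hre
  have h1 : ∀ t : ℝ, Complex.exp (-t * W.symbol u) = Complex.exp (-W.symbol u * t) := by
    intro t; congr 1; ring
  have hint := (integrableOn_exp_mul_complex_Ioi hre' 0).const_mul (1 - W.wave z u)
  simp only [h1]
  have h2 := integral_re (𝕜 := ℂ) hint
  simp only [RCLike.re_eq_complex_re] at h2
  rw [h2, integral_const_mul, integral_exp_mul_complex_Ioi hre']
  congr 1
  simp [div_eq_mul_inv]

/-- The integral over time of the continuous-time transition probabilities, as a Fourier
integral. -/
theorem integral_heat_sub [NeZero d] (z : G) : ∫ t in Set.Ioi 0, (W.heat t 0 - W.heat t z) =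
    W.vol⁻¹ * ∫ u in W.cell, ((1 - W.wave z u) / W.symbol u).re := by
  simp only [heat_zero_sub_heat]
  rw [integral_const_mul, integral_integral_swap (W.integrable_re_mul_exp z)]
  congr 1
  refine setIntegral_congr_ae W.measurableSet_cell ?_
  filter_upwards [Measure.ae_ne volume (0 : EuclideanSpace ℝ (Fin d))] with u hu0 hu
  exact W.integral_re_mul_exp z hu hu0

end SphericalWalk
end LatticeWalk

/-! ### Convergence of the potential -/

namespace LatticeWalk

theorem ae_inner_ne {E : Type*} [NormedAddCommGroup E] [InnerProductSpace ℝ E]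
    [MeasurableSpace E] [BorelSpace E] [FiniteDimensional ℝ E] (μ : Measure E)
    [μ.IsAddHaarMeasure] {v : E} (hv : v ≠ 0) (a : ℝ) : ∀ᵐ u ∂μ, inner ℝ v u ≠ a := by
  let s : AffineSubspace ℝ E :=
    { carrier := {u | inner ℝ v u = a}
      smul_vsub_vadd_mem' := by
        intro c p₁ p₂ p₃ h1 h2 h3
        simp only [Set.mem_ofPred_eq] at h1 h2 h3 ⊢
        simp [inner_add_right, inner_smul_right, inner_sub_right, h1, h2, h3] }
  have hs : s ≠ ⊤ := by
    intro h
    have h1 : (0 : E) ∈ s := by rw [h]; exact AffineSubspace.mem_top _ _ _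
    have h2 : v ∈ s := by rw [h]; exact AffineSubspace.mem_top _ _ _
    have h1' : inner ℝ v (0 : E) = a := h1
    have h2' : inner ℝ v v = a := h2
    rw [inner_zero_right] at h1'
    rw [← h1'] at h2'
    exact hv (inner_self_eq_zero.mp h2')
  rw [ae_iff]
  simp only [ne_eq, not_not]
  exact Measure.addHaar_affineSubspace μ s hs

theorem nat_mul_pow_mul_le_one {y : ℝ} (h0 : 0 ≤ y) (h1 : y ≤ 1) (N : ℕ) :
    N * (1 - y) ^ (N - 1) * y ≤ 1 := by
  have h2 : (N : ℝ) * (1 - y) ^ (N - 1) ≤ ∑ k ∈ range N, (1 - y) ^ k := by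
    calc (N : ℝ) * (1 - y) ^ (N - 1) = ∑ k ∈ range N, (1 - y) ^ (N - 1) := by simp
      _ ≤ _ := Finset.sum_le_sum fun k hk => ?_
    exact pow_le_pow_of_le_one (by linarith) (by linarith) (by
      have := Finset.mem_range.mp hk; omega)
  have h3 := mul_neg_geom_sum (1 - y) N
  have h4 : 0 ≤ (1 - y) ^ N := pow_nonneg (by linarith) _
  have h5 : (∑ k ∈ range N, (1 - y) ^ k) * y = 1 - (1 - y) ^ N := by
    rw [← h3]; ring
  calc _ ≤ (∑ k ∈ range N, (1 - y) ^ k) * y := mul_le_mul_of_nonneg_right h2 h0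
    _ ≤ 1 := by rw [h5]; linarith

theorem abs_pow_im_le (w : ℂ) (N : ℕ) : |(w ^ N).im| ≤ N * ‖w‖ ^ (N - 1) * |w.im| := by
  induction N with
  | zero => simp
  | succ N ih =>
    rw [pow_succ, Complex.mul_im]
    refine (abs_add_le _ _).trans ?_
    rw [abs_mul, abs_mul]
    have h1 : |(w ^ N).re| ≤ ‖w‖ ^ N := by
      rw [← norm_pow]; exact Complex.abs_re_le_norm _
    have h2 := Complex.abs_re_le_norm w
    have h3 : |(w ^ N).im| * |w.re| ≤ N * ‖w‖ ^ N * |w.im| := by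
      rcases N with _ | N
      · simp
      · calc _ ≤ (((N + 1 : ℕ) : ℝ) * ‖w‖ ^ (N + 1 - 1) * |w.im|) * ‖w‖ :=
            mul_le_mul ih h2 (abs_nonneg _) (by positivity)
          _ = _ := by rw [Nat.add_sub_cancel, pow_succ]; ring
    have h4 := mul_le_mul_of_nonneg_right h1 (abs_nonneg w.im)
    rw [Nat.add_sub_cancel]
    push_cast
    linarith

namespace SphericalWalk

variable {G : Type*} [AddCommGroup G] {d : ℕ} (W : SphericalWalk G d)

theorem one_sub_norm_char_sq (u : EuclideanSpace ℝ (Fin d)) : 1 - ‖W.char u‖ ^ 2 =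
    ∑ x ∈ W.steps, ∑ y ∈ W.steps,
      W.wt x * W.wt y * (1 - Real.cos (inner ℝ (W.pos x - W.pos y) u)) := by
  have h1 : ‖W.char u‖ ^ 2 = (W.char u).re * (W.char u).re + (W.char u).im * (W.char u).im := by
    rw [← Complex.normSq_eq_norm_sq, Complex.normSq_apply]
  have h2 : (1 : ℝ) = ∑ x ∈ W.steps, ∑ y ∈ W.steps, W.wt x * W.wt y := by
    rw [← Finset.sum_mul_sum, W.sum_wt, mul_one]
  rw [h1, char_re, char_im, Finset.sum_mul_sum, Finset.sum_mul_sum, ← Finset.sum_add_distrib]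
  nth_rewrite 1 [h2]
  rw [← Finset.sum_sub_distrib]
  refine Finset.sum_congr rfl fun x _ => ?_
  rw [← Finset.sum_add_distrib, ← Finset.sum_sub_distrib]
  refine Finset.sum_congr rfl fun y _ => ?_
  rw [inner_sub_left, Real.cos_sub]
  ring

/-- A centred walk with positive variance has two different steps. -/
theorem exists_two_steps [NeZero d] :
    ∃ x ∈ W.steps, ∃ y ∈ W.steps, 0 < W.wt x * W.wt y ∧ W.pos x - W.pos y ≠ 0 := by
  by_contra! h
  have hex : ∃ x ∈ W.steps, 0 < W.wt x := by
    by_contra! h0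
    have := Finset.sum_nonpos h0
    rw [W.sum_wt] at this
    linarith
  obtain ⟨x, hx, hx0⟩ := hex
  have h1 : ∀ y ∈ W.steps, W.wt y ≠ 0 → W.pos y = W.pos x := by
    intro y hy hy0
    have := h x hx y hy (mul_pos hx0 (lt_of_le_of_ne (W.wt_nonneg y) hy0.symm))
    exact (sub_eq_zero.mp this).symm
  have h2 : ∀ u, inner ℝ (W.pos x) u = 0 := by
    intro u
    have h3 := W.sum_wt_inner u
    have h4 : ∀ y ∈ W.steps, W.wt y * inner ℝ (W.pos y) u = W.wt y * inner ℝ (W.pos x) u := by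
      intro y hy
      by_cases hy0 : W.wt y = 0
      · simp [hy0]
      · rw [h1 y hy hy0]
    rw [Finset.sum_congr rfl h4, ← Finset.sum_mul, W.sum_wt, one_mul] at h3
    exact h3
  obtain ⟨u, hu⟩ := exists_ne (0 : EuclideanSpace ℝ (Fin d))
  have h5 := W.sum_wt_inner_sq u
  rw [Finset.sum_eq_zero] at h5
  · have := W.q_pos
    have := norm_pos_iff.mpr hu
    have : 0 < 2 * W.q * ‖u‖ ^ 2 := by positivity
    linarith
  · intro y hy
    by_cases hy0 : W.wt y = 0
    · simp [hy0]
    · rw [h1 y hy hy0, h2 u]; simp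

/-- The characteristic function has modulus less than one off a null set; periodic walks show that
the exceptional set need not be the origin. -/
theorem ae_norm_char_lt_one [NeZero d] : ∀ᵐ u, ‖W.char u‖ < 1 := by
  obtain ⟨x, hx, y, hy, hw, hv⟩ := W.exists_two_steps
  have h : ∀ᵐ u, ∀ k : ℤ, inner ℝ (W.pos x - W.pos y) u ≠ (k : ℝ) * (2 * Real.pi) :=
    ae_all_iff.mpr fun k => ae_inner_ne volume hv _
  filter_upwards [h] with u hu
  have h1 : Real.cos (inner ℝ (W.pos x - W.pos y) u) ≠ 1 := by
    rw [ne_eq, Real.cos_eq_one_iff]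
    rintro ⟨k, hk⟩
    exact hu k hk.symm
  have h2 := lt_of_le_of_ne (Real.cos_le_one _) h1
  have hnn : ∀ x y, 0 ≤ W.wt x * W.wt y * (1 - Real.cos (inner ℝ (W.pos x - W.pos y) u)) :=
    fun x y => mul_nonneg (mul_nonneg (W.wt_nonneg x) (W.wt_nonneg y))
      (by linarith [Real.cos_le_one (inner ℝ (W.pos x - W.pos y) u)])
  have h3 : 0 < 1 - ‖W.char u‖ ^ 2 := by
    rw [one_sub_norm_char_sq]
    refine lt_of_lt_of_le (mul_pos hw (sub_pos.mpr h2)) ?_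
    refine le_trans (Finset.single_le_sum (f := fun y =>
      W.wt x * W.wt y * (1 - Real.cos (inner ℝ (W.pos x - W.pos y) u)))
      (fun y _ => hnn x y) hy) ?_
    exact Finset.single_le_sum (f := fun x => ∑ y ∈ W.steps,
      W.wt x * W.wt y * (1 - Real.cos (inner ℝ (W.pos x - W.pos y) u)))
      (fun x _ => Finset.sum_nonneg fun y _ => hnn x y) hx
  nlinarith [norm_nonneg (W.char u)]

theorem norm_one_sub_wave_le (z : G) (u : EuclideanSpace ℝ (Fin d)) :
    ‖1 - W.wave z u‖ ≤ ‖W.pos z‖ * ‖u‖ := by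
  rw [norm_sub_rev, wave, ← Complex.ofReal_neg, mul_comm]
  refine (Real.norm_exp_I_mul_ofReal_sub_one_le).trans ?_
  rw [norm_neg, Real.norm_eq_abs]
  exact abs_real_inner_le_norm _ _

/-- The integrand of the Fourier representation of the potential is bounded. The imaginary part of
the quotient is only `O(1 / ‖u‖)`, which is not integrable in dimension one. -/
theorem abs_div_symbol_re_le (z : G) {u : EuclideanSpace ℝ (Fin d)} (hu : u ∈ W.cell)
    (hu0 : u ≠ 0) : |((1 - W.wave z u) / W.symbol u).re| ≤
      (‖W.pos z‖ ^ 2 * W.q + ‖W.pos z‖ * W.B ^ 3) / W.c ^ 2 := by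
  have hn : 0 < ‖u‖ := norm_pos_iff.mpr hu0
  have hc := W.c_pos
  have hq := W.q_pos
  have hB := W.one_le_B
  have hre := W.le_symbol_re hu
  have hre0 : 0 ≤ (W.symbol u).re := le_trans (by positivity) hre
  have h1 := W.abs_one_sub_wave_re_le z u
  have h2 := W.abs_one_sub_wave_im_le z u
  have h3 := W.symbol_re_le u
  have h4 := W.abs_char_im_le u
  have hN : W.c ^ 2 * ‖u‖ ^ 4 ≤ Complex.normSq (W.symbol u) := by
    rw [Complex.normSq_apply]
    have : (W.c * ‖u‖ ^ 2) ^ 2 ≤ (W.symbol u).re ^ 2 := pow_le_pow_left₀ (by positivity) hre 2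
    nlinarith [mul_self_nonneg (W.symbol u).im]
  have hN0 : 0 < Complex.normSq (W.symbol u) := lt_of_lt_of_le (by positivity) hN
  rw [Complex.div_re, ← add_div, abs_div, abs_of_pos hN0, div_le_div_iff₀ hN0 (by positivity)]
  have k1 : |(1 - W.wave z u).re * (W.symbol u).re| ≤ ‖W.pos z‖ ^ 2 * ‖u‖ ^ 2 *
      (W.q * ‖u‖ ^ 2) := by
    rw [abs_mul, abs_of_nonneg hre0]
    exact mul_le_mul h1 h3 hre0 (by positivity)
  have k2 : |(1 - W.wave z u).im * (W.symbol u).im| ≤ ‖W.pos z‖ * ‖u‖ *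
      (W.B ^ 3 * ‖u‖ ^ 3) := by
    rw [abs_mul, symbol_im, abs_neg]
    exact mul_le_mul h2 h4 (abs_nonneg _) (by positivity)
  have k3 := abs_add_le ((1 - W.wave z u).re * (W.symbol u).re)
    ((1 - W.wave z u).im * (W.symbol u).im)
  calc _ ≤ ((‖W.pos z‖ ^ 2 * W.q + ‖W.pos z‖ * W.B ^ 3) * ‖u‖ ^ 4) * W.c ^ 2 := by
        refine mul_le_mul_of_nonneg_right ?_ (by positivity)
        nlinarith
    _ = (‖W.pos z‖ ^ 2 * W.q + ‖W.pos z‖ * W.B ^ 3) * (W.c ^ 2 * ‖u‖ ^ 4) := by ring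
    _ ≤ _ := mul_le_mul_of_nonneg_left hN (by positivity)

/-- Near the origin `|Im (char ^ N)|` is of order `‖u‖`, uniformly in `N`. -/
theorem exists_abs_char_pow_im_le : ∃ C : ℝ, 0 ≤ C ∧ ∀ u ∈ W.cell, ∀ N : ℕ,
    |(W.char u ^ N).im| ≤ C * ‖u‖ := by
  have hc := W.c_pos
  have hq := W.q_pos
  have hB := W.one_le_B
  set δ : ℝ := min (1 / (1 + W.q)) (W.c / (2 * W.B ^ 3)) with hδ
  have hδ0 : 0 < δ := by positivity
  refine ⟨2 * W.B ^ 3 / W.c + 1 / δ, by positivity, fun u hu N => ?_⟩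
  rcases le_total ‖u‖ δ with h | h
  · have h1 : ‖u‖ ≤ 1 / (1 + W.q) := h.trans (min_le_left _ _)
    have h2 : ‖u‖ ≤ W.c / (2 * W.B ^ 3) := h.trans (min_le_right _ _)
    rw [le_div_iff₀ (by positivity)] at h1 h2
    have hn := norm_nonneg u
    have hre1 := W.le_symbol_re hu
    have hre2 := W.symbol_re_le u
    have him := W.abs_char_im_le u
    have hre3 : (W.char u).re = 1 - (W.symbol u).re := by simp [symbol]
    have hq1 : W.q * ‖u‖ ^ 2 ≤ 1 := by nlinarith
    set y := W.c / 2 * ‖u‖ ^ 2 with hy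
    have hy0 : 0 ≤ y := by positivity
    have hcub : W.B ^ 3 * ‖u‖ ^ 3 ≤ y := by
      rw [hy]; nlinarith [sq_nonneg ‖u‖]
    have hchar : ‖W.char u‖ ≤ 1 - y := by
      refine (Complex.norm_le_abs_re_add_abs_im _).trans ?_
      rw [abs_of_nonneg (by rw [hre3]; linarith), hre3]
      have : W.c * ‖u‖ ^ 2 = y + y := by rw [hy]; ring
      linarith
    have hy1 : y ≤ 1 := by linarith [norm_nonneg (W.char u)]
    have key := nat_mul_pow_mul_le_one hy0 hy1 N
    calc |(W.char u ^ N).im| ≤ N * ‖W.char u‖ ^ (N - 1) * |(W.char u).im| := abs_pow_im_le _ _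
      _ ≤ N * (1 - y) ^ (N - 1) * (W.B ^ 3 * ‖u‖ ^ 3) := by gcongr
      _ = (N * (1 - y) ^ (N - 1) * y) * (2 * W.B ^ 3 / W.c * ‖u‖) := by
          rw [hy]; field_simp
      _ ≤ 1 * (2 * W.B ^ 3 / W.c * ‖u‖) := by gcongr
      _ ≤ _ := by
          rw [one_mul]
          gcongr
          linarith [show 0 ≤ 1 / δ by positivity]
  · have h1 : |(W.char u ^ N).im| ≤ 1 := by
      refine (Complex.abs_im_le_norm _).trans ?_
      rw [norm_pow]
      exact pow_le_one₀ (norm_nonneg _) (W.norm_char_le_one u)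
    have h2 : 1 ≤ 1 / δ * ‖u‖ := by
      rw [div_mul_eq_mul_div, one_mul, le_div_iff₀ hδ0]; linarith
    have h3 : 0 ≤ 2 * W.B ^ 3 / W.c * ‖u‖ := by positivity
    linarith

theorem potentialPartialSum_eq (z : G) (N : ℕ) : potentialPartialSum W.law z N =
    W.vol⁻¹ * ∫ u in W.cell, ((1 - W.wave z u) * ∑ n ∈ range N, W.char u ^ n).re := by
  have hv := W.vol_pos
  have h1 : ∫ u in W.cell, ((1 - W.wave z u) * ∑ n ∈ range N, W.char u ^ n) =
      (W.vol * potentialPartialSum W.law z N : ℝ) := by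
    have h2 : ∀ u, (1 - W.wave z u) * ∑ n ∈ range N, W.char u ^ n =
        ∑ n ∈ range N, (W.char u ^ n * W.wave 0 u - W.char u ^ n * W.wave z u) := by
      intro u
      rw [Finset.mul_sum]
      refine Finset.sum_congr rfl fun n _ => ?_
      rw [wave_zero]; ring
    simp only [h2]
    rw [integral_finsetSum _ fun n _ => W.integrableOn_cell (by fun_prop), potentialPartialSum,
      Finset.mul_sum]
    push_cast
    refine Finset.sum_congr rfl fun n _ => ?_
    rw [integral_sub (W.integrableOn_cell (by fun_prop)) (W.integrableOn_cell (by fun_prop)),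
      integral_char_pow_mul_wave, integral_char_pow_mul_wave]
    ring
  have h3 := integral_re (𝕜 := ℂ)
    (f := fun u => (1 - W.wave z u) * ∑ n ∈ range N, W.char u ^ n)
    (W.integrableOn_cell (by fun_prop))
  simp only [RCLike.re_eq_complex_re] at h3
  rw [h3, h1, Complex.ofReal_re]
  field_simp

/-- The series defining the harmonic potential converges, and its sum is a Fourier integral. -/
theorem tendsto_potentialPartialSum [NeZero d] (z : G) :
    Tendsto (potentialPartialSum W.law z) atTop
      (𝓝 (W.vol⁻¹ * ∫ u in W.cell, ((1 - W.wave z u) / W.symbol u).re)) := by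
  have hc := W.c_pos
  obtain ⟨C, hC, hCb⟩ := W.exists_abs_char_pow_im_le
  rw [show potentialPartialSum W.law z = fun N => W.vol⁻¹ *
    ∫ u in W.cell, ((1 - W.wave z u) * ∑ n ∈ range N, W.char u ^ n).re from
    funext (W.potentialPartialSum_eq z)]
  refine Tendsto.const_mul _ ?_
  have hfin : IsFiniteMeasure (volume.restrict W.cell) :=
    ⟨by simpa using W.isCompact_cell.measure_lt_top⟩
  have hgeom : ∀ u ∈ W.cell, u ≠ 0 → ∀ N : ℕ, (1 - W.wave z u) * ∑ n ∈ range N, W.char u ^ n =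
      (1 - W.wave z u) / W.symbol u - (1 - W.wave z u) / W.symbol u * W.char u ^ N := by
    intro u hu hu0 N
    have hs := W.symbol_ne_zero hu hu0
    have h1 := mul_neg_geom_sum (W.char u) N
    have h2 : 1 - W.char u = W.symbol u := rfl
    rw [h2] at h1
    rw [← mul_one_sub, ← h1]
    field_simp
  set M := (‖W.pos z‖ ^ 2 * W.q + ‖W.pos z‖ * W.B ^ 3) / W.c ^ 2 with hM
  have hae0 : ∀ᵐ u ∂(volume.restrict W.cell), u ∈ W.cell ∧ u ≠ 0 ∧ ‖W.char u‖ < 1 := by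
    filter_upwards [ae_restrict_mem W.measurableSet_cell,
      ae_restrict_of_ae (Measure.ae_ne volume (0 : EuclideanSpace ℝ (Fin d))),
      ae_restrict_of_ae W.ae_norm_char_lt_one] with u h1 h2 h3 using ⟨h1, h2, h3⟩
  -- The imaginary part of the quotient is of order `1 / ‖u‖`; that of `char ^ N` makes up for it.
  refine tendsto_integral_of_dominated_convergence (fun _ => M + (M + ‖W.pos z‖ / W.c * C))
    (fun N => Continuous.aestronglyMeasurable (by fun_prop)) (integrable_const _) ?_ ?_
  · intro N
    filter_upwards [hae0] with u hu
    obtain ⟨hu, hu0, -⟩ := hu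
    have hn : 0 < ‖u‖ := norm_pos_iff.mpr hu0
    rw [hgeom u hu hu0, Complex.sub_re, Real.norm_eq_abs]
    have h1 := W.abs_div_symbol_re_le z hu hu0
    rw [← hM] at h1
    refine (abs_sub _ _).trans (add_le_add h1 ?_)
    rw [Complex.mul_re]
    refine (abs_sub _ _).trans (add_le_add ?_ ?_)
    · rw [abs_mul]
      refine (mul_le_of_le_one_right (abs_nonneg _) ?_).trans h1
      refine (Complex.abs_re_le_norm _).trans ?_
      rw [norm_pow]
      exact pow_le_one₀ (norm_nonneg _) (W.norm_char_le_one u)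
    · rw [abs_mul]
      have h2 : |((1 - W.wave z u) / W.symbol u).im| ≤ ‖W.pos z‖ * ‖u‖ / (W.c * ‖u‖ ^ 2) := by
        refine (Complex.abs_im_le_norm _).trans ?_
        rw [norm_div]
        gcongr
        · exact W.norm_one_sub_wave_le z u
        · exact (W.le_symbol_re hu).trans (Complex.re_le_norm _)
      calc _ ≤ ‖W.pos z‖ * ‖u‖ / (W.c * ‖u‖ ^ 2) * (C * ‖u‖) :=
            mul_le_mul h2 (hCb u hu N) (abs_nonneg _) (by positivity)
        _ = _ := by field_simp
  · filter_upwards [hae0] with u hu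
    obtain ⟨hu, hu0, hlt⟩ := hu
    simp only [hgeom u hu hu0]
    have h1 : Tendsto (fun N : ℕ => (1 - W.wave z u) / W.symbol u -
        (1 - W.wave z u) / W.symbol u * W.char u ^ N) atTop
        (𝓝 ((1 - W.wave z u) / W.symbol u - (1 - W.wave z u) / W.symbol u * 0)) :=
      tendsto_const_nhds.sub ((tendsto_pow_atTop_nhds_zero_of_norm_lt_one hlt).const_mul _)
    rw [mul_zero, sub_zero] at h1
    exact (Complex.continuous_re.tendsto _).comp h1

theorem tendsto_harmonicPotential [NeZero d] (z : G) :
    Tendsto (potentialPartialSum W.law z) atTop (𝓝 (harmonicPotential W.law z)) :=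
  tendsto_nhds_limUnder ⟨_, W.tendsto_potentialPartialSum z⟩

/-- The harmonic potential is the time integral of the continuous-time heat kernel differences. -/
theorem harmonicPotential_eq [NeZero d] (z : G) : harmonicPotential W.law z =
    ∫ t in Set.Ioi 0, (W.heat t 0 - W.heat t z) := by
  rw [integral_heat_sub]
  exact tendsto_nhds_unique (W.tendsto_harmonicPotential z) (W.tendsto_potentialPartialSum z)

end SphericalWalk
end LatticeWalk

/-! ### Fourier transforms of polynomials times Gaussians -/

namespace LatticeWalk

section GaussianMoments

variable {d : ℕ}

theorem add_pow_mul_exp_neg_le {c : ℝ} (hc : 0 < c) (n : ℕ) {r : ℝ} (hr : 0 ≤ r) :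
    (1 + r) ^ n * Real.exp (-c * r ^ 2) ≤
      (n.factorial * Real.exp (1 + 1 / (2 * c))) * Real.exp (-(c / 2) * r ^ 2) := by
  have h1 : (1 + r) ^ n ≤ n.factorial * Real.exp (1 + r) := by
    have := Real.pow_div_factorial_le_exp (1 + r) (by linarith) n
    rwa [div_le_iff₀ (by positivity), mul_comm] at this
  have h2 : r ≤ 1 / (2 * c) + c / 2 * r ^ 2 := by
    have h3 : 1 / (2 * c) + c / 2 * r ^ 2 - r = (1 - c * r) ^ 2 / (2 * c) := by
      field_simp; ring
    have h4 : 0 ≤ (1 - c * r) ^ 2 / (2 * c) := by positivity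
    linarith
  calc _ ≤ (n.factorial * Real.exp (1 + r)) * Real.exp (-c * r ^ 2) := by gcongr
    _ = n.factorial * Real.exp (1 + r + -c * r ^ 2) := by rw [Real.exp_add (1 + r)]; ring
    _ ≤ n.factorial * Real.exp (1 + 1 / (2 * c) + -(c / 2) * r ^ 2) := by
        refine mul_le_mul_of_nonneg_left (Real.exp_le_exp.mpr ?_) (by positivity)
        linarith
    _ = _ := by rw [Real.exp_add (1 + 1 / (2 * c))]; ring

theorem integrable_add_pow_mul_exp {c : ℝ} (hc : 0 < c) (n : ℕ) :
    Integrable fun u : EuclideanSpace ℝ (Fin d) => (1 + ‖u‖) ^ n * Real.exp (-c * ‖u‖ ^ 2) := by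
  have h1 : Integrable fun u : EuclideanSpace ℝ (Fin d) => Real.exp (-(c / 2) * ‖u‖ ^ 2) := by
    have h2 := (GaussianFourier.integrable_cexp_neg_mul_sq_norm_add
      (V := EuclideanSpace ℝ (Fin d)) (b := ((c / 2 : ℝ) : ℂ))
      (by rw [Complex.ofReal_re]; positivity) 0 0).norm
    refine h2.congr (ae_of_all _ fun u => ?_)
    simp only [Complex.norm_exp]
    congr 1
    norm_cast
    simp
  refine (h1.const_mul (n.factorial * Real.exp (1 + 1 / (2 * c)))).mono'
    (Continuous.aestronglyMeasurable (by fun_prop)) (ae_of_all _ fun u => ?_)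
  rw [Real.norm_eq_abs, abs_of_nonneg (by positivity)]
  exact add_pow_mul_exp_neg_le hc n (norm_nonneg u)

theorem integrable_pow_mul_exp {c : ℝ} (hc : 0 < c) (n : ℕ) :
    Integrable fun u : EuclideanSpace ℝ (Fin d) => ‖u‖ ^ n * Real.exp (-c * ‖u‖ ^ 2) := by
  refine (integrable_add_pow_mul_exp hc n).mono'
    (Continuous.aestronglyMeasurable (by fun_prop)) (ae_of_all _ fun u => ?_)
  rw [Real.norm_eq_abs, abs_of_nonneg (by positivity)]
  gcongr
  linarith

theorem integral_pow_mul_exp_sq {c ρ : ℝ} (hρ : 0 < ρ) (n : ℕ) :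
    ∫ u : EuclideanSpace ℝ (Fin d), ‖u‖ ^ n * Real.exp (-(c * ρ ^ 2) * ‖u‖ ^ 2) =
      (ρ ^ (n + d))⁻¹ * ∫ u : EuclideanSpace ℝ (Fin d), ‖u‖ ^ n * Real.exp (-c * ‖u‖ ^ 2) := by
  have h := Measure.integral_comp_smul_of_nonneg (μ := volume)
    (fun u : EuclideanSpace ℝ (Fin d) => ‖u‖ ^ n * Real.exp (-c * ‖u‖ ^ 2)) ρ (hR := hρ.le)
  rw [finrank_euclideanSpace_fin, smul_eq_mul] at h
  rw [pow_add, mul_inv, mul_assoc, ← h, ← integral_const_mul]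
  refine integral_congr_ae (ae_of_all _ fun u => ?_)
  simp only [norm_smul, Real.norm_eq_abs, abs_of_pos hρ, mul_pow]
  rw [← mul_assoc, ← mul_assoc, inv_mul_cancel₀ (by positivity), one_mul]
  congr 2
  ring

end GaussianMoments

section PolyEval

variable {d : ℕ}

/-- The value of a real polynomial at the imaginary point `i u`, that is the Fourier multiplier of
the differential operator with constant coefficients given by the polynomial. -/
def multiplier (P : MvPolynomial (Fin d) ℝ) (u : EuclideanSpace ℝ (Fin d)) : ℂ :=
  MvPolynomial.aeval (fun k => Complex.I * (u k : ℂ)) P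

@[fun_prop]
theorem continuous_multiplier (P : MvPolynomial (Fin d) ℝ) : Continuous (multiplier P) := by
  unfold multiplier
  simp only [MvPolynomial.aeval_def, MvPolynomial.eval₂_eq']
  fun_prop

theorem multiplier_X_mul (P : MvPolynomial (Fin d) ℝ) (k : Fin d)
    (u : EuclideanSpace ℝ (Fin d)) :
    multiplier (MvPolynomial.X k * P) u = Complex.I * (u k : ℂ) * multiplier P u := by
  simp [multiplier]

theorem exists_norm_multiplier_le (P : MvPolynomial (Fin d) ℝ) :
    ∃ C : ℝ, ∃ n : ℕ, 0 ≤ C ∧ ∀ u, ‖multiplier P u‖ ≤ C * (1 + ‖u‖) ^ n := by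
  induction P using MvPolynomial.induction_on with
  | C a => exact ⟨|a|, 0, abs_nonneg _, fun u => by simp [multiplier]⟩
  | add P Q hP hQ =>
    obtain ⟨C, n, hC, h1⟩ := hP
    obtain ⟨C', n', hC', h2⟩ := hQ
    refine ⟨C + C', max n n', by positivity, fun u => ?_⟩
    have hu : 1 ≤ 1 + ‖u‖ := by linarith [norm_nonneg u]
    have e : multiplier (P + Q) u = multiplier P u + multiplier Q u := by simp [multiplier]
    rw [e, add_mul]
    refine (norm_add_le _ _).trans (add_le_add ((h1 u).trans ?_) ((h2 u).trans ?_))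
    · gcongr; exact le_max_left _ _
    · gcongr; exact le_max_right _ _
  | mul_X P k hP =>
    obtain ⟨C, n, hC, h1⟩ := hP
    refine ⟨C, n + 1, hC, fun u => ?_⟩
    rw [mul_comm, multiplier_X_mul, norm_mul, norm_mul, Complex.norm_I, one_mul,
      Complex.norm_real, pow_succ]
    have h2 : ‖u k‖ ≤ 1 + ‖u‖ := by linarith [PiLp.norm_apply_le u k]
    calc _ ≤ (1 + ‖u‖) * (C * (1 + ‖u‖) ^ n) :=
          mul_le_mul h2 (h1 u) (norm_nonneg _) (by positivity)
      _ = _ := by ring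

theorem aeval_mul_of_isHomogeneous {A : Type*} [CommSemiring A] [Algebra ℝ A]
    {P : MvPolynomial (Fin d) ℝ} {n : ℕ} (hP : P.IsHomogeneous n) (c : A) (f : Fin d → A) :
    MvPolynomial.aeval (fun k => c * f k) P = c ^ n * MvPolynomial.aeval f P := by
  simp only [MvPolynomial.aeval_def, MvPolynomial.eval₂_eq', Finset.mul_sum]
  refine Finset.sum_congr rfl fun s hs => ?_
  have h : n = ∑ i, s i := by
    rw [hP.degree_eq_sum_deg_support hs]
    exact Finset.sum_subset (Finset.subset_univ _) fun i _ hi => by simpa using hi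
  simp only [mul_pow, Finset.prod_mul_distrib, Finset.prod_pow_eq_pow_sum, ← h]
  ring

theorem multiplier_smul {P : MvPolynomial (Fin d) ℝ} {n : ℕ} (hP : P.IsHomogeneous n) (c : ℝ)
    (u : EuclideanSpace ℝ (Fin d)) : multiplier P (c • u) = (c : ℂ) ^ n * multiplier P u := by
  rw [multiplier, multiplier, ← aeval_mul_of_isHomogeneous hP]
  congr 2
  ext k
  simp only [PiLp.smul_apply, smul_eq_mul]
  push_cast
  ring

theorem eval_smul_of_isHomogeneous {P : MvPolynomial (Fin d) ℝ} {n : ℕ} (hP : P.IsHomogeneous n)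
    (c : ℝ) (u : EuclideanSpace ℝ (Fin d)) :
    MvPolynomial.eval (c • u) P = c ^ n * MvPolynomial.eval u P := by
  have := aeval_mul_of_isHomogeneous hP c u
  rw [MvPolynomial.aeval_eq_eval] at this
  exact this

theorem hasDerivAt_eval (P : MvPolynomial (Fin d) ℝ) (y : EuclideanSpace ℝ (Fin d)) (k : Fin d) :
    HasDerivAt (fun s : ℝ => MvPolynomial.eval (y + s • EuclideanSpace.single k (1 : ℝ)) P)
      (MvPolynomial.eval y (MvPolynomial.pderiv k P)) 0 := by
  induction P using MvPolynomial.induction_on with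
  | C a => simpa using hasDerivAt_const (0 : ℝ) a
  | add P Q hP hQ =>
    simp only [map_add]
    exact hP.add hQ
  | mul_X P j hP =>
    have h1 : HasDerivAt (fun s : ℝ => y j + s * (EuclideanSpace.single k (1 : ℝ) :
        EuclideanSpace ℝ (Fin d)) j) ((EuclideanSpace.single k (1 : ℝ) :
        EuclideanSpace ℝ (Fin d)) j) 0 := by
      simpa using ((hasDerivAt_id (0 : ℝ)).mul_const
        ((EuclideanSpace.single k (1 : ℝ) : EuclideanSpace ℝ (Fin d)) j)).const_add (y j)
    have h2 := hP.mul h1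
    simp only [map_mul, MvPolynomial.eval_X, MvPolynomial.pderiv_mul, map_add,
      MvPolynomial.pderiv_X, PiLp.add_apply, PiLp.smul_apply, smul_eq_mul]
    convert! h2 using 1
    simp only [zero_smul, add_zero, zero_mul]
    congr 2
    by_cases hjk : j = k
    · subst hjk; simp
    · have : k ≠ j := fun h => hjk h.symm
      simp [hjk]

end PolyEval

section GaussTransform

variable {d : ℕ}

/-- The span of the homogeneous polynomials whose degree is at most `n` and has the parity
of `n`. -/
def parityLE (d n : ℕ) : Submodule ℝ (MvPolynomial (Fin d) ℝ) :=
  Submodule.span ℝ {R | ∃ k i : ℕ, R.IsHomogeneous k ∧ k + 2 * i = n}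

theorem X_mul_mem_parityLE {n : ℕ} {R : MvPolynomial (Fin d) ℝ} (hR : R ∈ parityLE d n)
    (j : Fin d) : MvPolynomial.X j * R ∈ parityLE d (n + 1) := by
  induction hR using Submodule.span_induction with
  | mem R h =>
    obtain ⟨k, i, hk, hn⟩ := h
    refine Submodule.subset_span ⟨1 + k, i, (MvPolynomial.isHomogeneous_X ℝ j).mul hk, by omega⟩
  | zero => simp
  | add P Q _ _ hP hQ => rw [mul_add]; exact add_mem hP hQ
  | smul a P _ hP => rw [mul_smul_comm]; exact Submodule.smul_mem _ _ hP

theorem pderiv_mem_parityLE {n : ℕ} {R : MvPolynomial (Fin d) ℝ} (hR : R ∈ parityLE d n)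
    (j : Fin d) : MvPolynomial.pderiv j R ∈ parityLE d (n + 1) := by
  induction hR using Submodule.span_induction with
  | mem R h =>
    obtain ⟨k, i, hk, hn⟩ := h
    rcases k with _ | k
    · rw [← MvPolynomial.totalDegree_zero_iff_isHomogeneous,
        MvPolynomial.totalDegree_eq_zero_iff_eq_C] at hk
      rw [hk, MvPolynomial.pderiv_C]
      exact zero_mem _
    · exact Submodule.subset_span ⟨k, i + 1, hk.pderiv, by omega⟩
  | zero => simp
  | add P Q _ _ hP hQ => rw [map_add]; exact add_mem hP hQ
  | smul a P _ hP => rw [Derivation.map_smul]; exact Submodule.smul_mem _ _ hP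

/-- The Fourier transform of a polynomial multiple of the Gaussian `exp (-q ‖u‖²)`. -/
def gaussTransform (q : ℝ) (P : MvPolynomial (Fin d) ℝ) (y : EuclideanSpace ℝ (Fin d)) : ℂ :=
  ∫ u, multiplier P u * Real.exp (-q * ‖u‖ ^ 2) * Complex.exp (-(inner ℝ y u : ℝ) * Complex.I)

theorem norm_exp_neg_ofReal_mul_I (s : ℝ) : ‖Complex.exp (-(s : ℂ) * Complex.I)‖ = 1 := by
  rw [← Complex.ofReal_neg, Complex.norm_exp_ofReal_mul_I]

theorem integrable_multiplier_mul_exp {q : ℝ} (hq : 0 < q) (P : MvPolynomial (Fin d) ℝ) :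
    Integrable fun u : EuclideanSpace ℝ (Fin d) =>
      multiplier P u * Real.exp (-q * ‖u‖ ^ 2) := by
  obtain ⟨C, n, hC, h⟩ := exists_norm_multiplier_le P
  refine ((integrable_add_pow_mul_exp hq n).const_mul C).mono'
    (Continuous.aestronglyMeasurable (by fun_prop)) (ae_of_all _ fun u => ?_)
  rw [norm_mul, Complex.norm_real, Real.norm_eq_abs, Real.abs_exp, ← mul_assoc]
  gcongr
  exact h u

theorem integrable_gaussTransform {q : ℝ} (hq : 0 < q) (P : MvPolynomial (Fin d) ℝ)
    (y : EuclideanSpace ℝ (Fin d)) :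
    Integrable fun u : EuclideanSpace ℝ (Fin d) => multiplier P u * Real.exp (-q * ‖u‖ ^ 2) *
      Complex.exp (-(inner ℝ y u : ℝ) * Complex.I) := by
  refine (integrable_multiplier_mul_exp hq P).norm.mono'
    (Continuous.aestronglyMeasurable (by fun_prop)) (ae_of_all _ fun u => ?_)
  rw [norm_mul, norm_exp_neg_ofReal_mul_I, mul_one]

theorem gaussTransform_one {q : ℝ} (hq : 0 < q) (y : EuclideanSpace ℝ (Fin d)) :
    gaussTransform q (1 : MvPolynomial (Fin d) ℝ) y =
      (((Real.pi / q) ^ ((d : ℝ) / 2) * Real.exp (-‖y‖ ^ 2 / (4 * q)) : ℝ) : ℂ) := by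
  have h := GaussianFourier.integral_cexp_neg_mul_sq_norm_add (V := EuclideanSpace ℝ (Fin d))
    (b := (q : ℂ)) (by simpa using hq) (-Complex.I) y
  rw [finrank_euclideanSpace_fin] at h
  have hpi : (0 : ℝ) ≤ Real.pi / q := by positivity
  rw [gaussTransform]
  convert! h using 1
  · refine integral_congr_ae (ae_of_all _ fun u => ?_)
    simp only [multiplier, map_one, one_mul]
    rw [Complex.ofReal_exp, ← Complex.exp_add]
    congr 1
    push_cast
    ring
  · push_cast [Complex.ofReal_cpow hpi]
    congr 2
    rw [neg_sq, Complex.I_sq]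
    ring

theorem hasDerivAt_gaussTransform {q : ℝ} (hq : 0 < q) (P : MvPolynomial (Fin d) ℝ)
    (y : EuclideanSpace ℝ (Fin d)) (k : Fin d) :
    HasDerivAt (fun s : ℝ => gaussTransform q P (y + s • EuclideanSpace.single k (1 : ℝ)))
      (-gaussTransform q (MvPolynomial.X k * P) y) 0 := by
  have hin : ∀ (s : ℝ) (u : EuclideanSpace ℝ (Fin d)),
      inner ℝ (y + s • EuclideanSpace.single k (1 : ℝ)) u = inner ℝ y u + s * u k := by
    intro s u
    rw [inner_add_left, real_inner_smul_left, EuclideanSpace.inner_single_left]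
    simp
  have key := hasDerivAt_integral_of_dominated_loc_of_deriv_le (μ := volume) (x₀ := (0 : ℝ))
    (s := Set.univ)
    (F := fun (s : ℝ) (u : EuclideanSpace ℝ (Fin d)) =>
      multiplier P u * Real.exp (-q * ‖u‖ ^ 2) *
        Complex.exp (-((inner ℝ y u + s * u k : ℝ) : ℂ) * Complex.I))
    (F' := fun (s : ℝ) (u : EuclideanSpace ℝ (Fin d)) =>
      -(multiplier (MvPolynomial.X k * P) u * Real.exp (-q * ‖u‖ ^ 2) *
        Complex.exp (-((inner ℝ y u + s * u k : ℝ) : ℂ) * Complex.I)))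
    (bound := fun u => ‖multiplier (MvPolynomial.X k * P) u * Real.exp (-q * ‖u‖ ^ 2)‖)
    univ_mem
    (Eventually.of_forall fun s => Continuous.aestronglyMeasurable (by fun_prop))
    (by simpa using integrable_gaussTransform hq P y)
    (Continuous.aestronglyMeasurable (by fun_prop))
    (ae_of_all _ fun u s _ => by
      rw [norm_neg, norm_mul, norm_exp_neg_ofReal_mul_I, mul_one])
    (integrable_multiplier_mul_exp hq _).norm
    (ae_of_all _ fun u s _ => by
      have h1 : HasDerivAt (fun s : ℝ => -((inner ℝ y u + s * u k : ℝ) : ℂ) * Complex.I)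
          (-(u k : ℂ) * Complex.I) s := by
        have h2 : HasDerivAt (fun s : ℝ => inner ℝ y u + s * u k) (u k) s := by
          simpa using ((hasDerivAt_id s).mul_const (u k)).const_add (inner ℝ y u)
        exact (h2.ofReal_comp.neg).mul_const _
      have h3 := (h1.cexp).const_mul (multiplier P u * Real.exp (-q * ‖u‖ ^ 2))
      convert! h3 using 1
      rw [multiplier_X_mul]
      ring)
  have h4 := key.2
  rw [integral_neg] at h4
  simp only [gaussTransform, hin]
  simpa using h4

/-- Hermite structure: the Fourier transform of a polynomial multiple of a Gaussian is a polynomial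
multiple of the dual Gaussian. Multiplication by a coordinate becomes, up to sign, a derivative, so
the polynomial changes degree by one and the parity alternates. -/
theorem exists_gaussTransform_eq {q : ℝ} (hq : 0 < q) {n : ℕ} {P : MvPolynomial (Fin d) ℝ}
    (hP : P.IsHomogeneous n) : ∃ R ∈ parityLE d n, ∀ y, gaussTransform q P y =
      ((MvPolynomial.eval y R * Real.exp (-‖y‖ ^ 2 / (4 * q)) : ℝ) : ℂ) := by
  have mono : ∀ (n : ℕ) (s : Fin d →₀ ℕ), s.degree = n → ∃ R ∈ parityLE d n, ∀ y,
      gaussTransform q (MvPolynomial.monomial s 1) y =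
      ((MvPolynomial.eval y R * Real.exp (-‖y‖ ^ 2 / (4 * q)) : ℝ) : ℂ) := by
    intro n
    induction n with
    | zero =>
      intro s hs
      have hs0 : s = 0 := (Finsupp.degree_eq_zero_iff s).mp hs
      subst hs0
      refine ⟨MvPolynomial.C ((Real.pi / q) ^ ((d : ℝ) / 2)),
        Submodule.subset_span ⟨0, 0, MvPolynomial.isHomogeneous_C _ _, rfl⟩, fun y => ?_⟩
      have : (MvPolynomial.monomial (0 : Fin d →₀ ℕ) (1 : ℝ)) = 1 := rfl
      rw [this, gaussTransform_one hq, MvPolynomial.eval_C]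
    | succ n ih =>
      intro s hs
      have hk : ∃ k, s k ≠ 0 := by
        by_contra! h
        have : s = 0 := Finsupp.ext h
        simp [this] at hs
      obtain ⟨k, hk⟩ := hk
      have hsk : Finsupp.single k 1 ≤ s := by
        rw [Finsupp.single_le_iff]; omega
      obtain ⟨s', rfl⟩ := le_iff_exists_add.mp hsk
      have hs' : s'.degree = n := by
        rw [map_add, Finsupp.degree_single] at hs; omega
      obtain ⟨R, hR, hRy⟩ := ih s' hs'
      refine ⟨(1 / (2 * q)) • (MvPolynomial.X k * R) - MvPolynomial.pderiv k R,
        sub_mem (Submodule.smul_mem _ _ (X_mul_mem_parityLE hR k)) (pderiv_mem_parityLE hR k),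
        fun y => ?_⟩
      have hmon : (MvPolynomial.monomial (Finsupp.single k 1 + s') (1 : ℝ)) =
          MvPolynomial.X k * MvPolynomial.monomial s' 1 := by
        rw [MvPolynomial.X, MvPolynomial.monomial_mul, one_mul]
      have h1 := hasDerivAt_gaussTransform hq (MvPolynomial.monomial s' 1) y k
      simp only [hRy] at h1
      have hnorm : HasDerivAt (fun s : ℝ =>
          -‖y + s • (EuclideanSpace.single k (1 : ℝ) : EuclideanSpace ℝ (Fin d))‖ ^ 2 / (4 * q))
          (-(2 * y k) / (4 * q)) 0 := by
        have h2 : HasDerivAt (fun s : ℝ =>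
            y + s • (EuclideanSpace.single k (1 : ℝ) : EuclideanSpace ℝ (Fin d)))
            (EuclideanSpace.single k (1 : ℝ)) 0 := by
          simpa using ((hasDerivAt_id (0 : ℝ)).smul_const
            (EuclideanSpace.single k (1 : ℝ) : EuclideanSpace ℝ (Fin d))).const_add y
        have h3 := (h2.norm_sq.neg).div_const (4 * q)
        convert! h3 using 3
        rw [zero_smul, add_zero, EuclideanSpace.inner_single_right]
        simp
      have h4 := ((hasDerivAt_eval R y k).mul hnorm.exp).ofReal_comp
      have h5 := h1.unique h4
      rw [hmon, neg_eq_iff_eq_neg.mp h5, ← Complex.ofReal_neg, Complex.ofReal_inj]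
      simp only [zero_smul, add_zero, map_sub, MvPolynomial.smul_eval, map_mul,
        MvPolynomial.eval_X]
      field_simp
      ring
  choose R hR hRy using fun s : Fin d →₀ ℕ => mono s.degree s rfl
  refine ⟨∑ s ∈ P.support, P.coeff s • R s, Submodule.sum_mem _ fun s hs => ?_, fun y => ?_⟩
  · have : s.degree = n := by
      rw [hP.degree_eq_sum_deg_support hs]; rfl
    exact Submodule.smul_mem _ _ (this ▸ hR s)
  · have h1 : ∀ u, multiplier P u =
        ∑ s ∈ P.support, ((P.coeff s : ℝ) : ℂ) * multiplier (MvPolynomial.monomial s 1) u := by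
      intro u
      conv_lhs => rw [P.as_sum]
      simp only [multiplier, map_sum]
      refine Finset.sum_congr rfl fun s _ => ?_
      simp [MvPolynomial.aeval_monomial]
    have h2 : gaussTransform q P y =
        ∑ s ∈ P.support, ((P.coeff s : ℝ) : ℂ) * gaussTransform q (MvPolynomial.monomial s 1) y := by
      simp only [gaussTransform, h1, Finset.sum_mul, ← integral_const_mul]
      rw [integral_finsetSum]
      · refine Finset.sum_congr rfl fun s _ => integral_congr_ae (ae_of_all _ fun u => ?_)
        simp only
        ring
      · intro s _
        have := (integrable_gaussTransform hq (MvPolynomial.monomial s 1) y).const_mul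
          ((P.coeff s : ℝ) : ℂ)
        refine this.congr (ae_of_all _ fun u => ?_)
        simp only
        ring
    rw [h2]
    simp only [hRy, map_sum, MvPolynomial.smul_eval, Finset.sum_mul]
    push_cast
    refine Finset.sum_congr rfl fun s _ => ?_
    ring

/-- The parabolic scaling of the Gaussian transform. -/
theorem integral_multiplier_mul_exp_sq (q : ℝ) {ρ : ℝ} (hρ : 0 < ρ) {n : ℕ}
    {P : MvPolynomial (Fin d) ℝ} (hP : P.IsHomogeneous n) (x : EuclideanSpace ℝ (Fin d)) :
    ∫ u, multiplier P u * Real.exp (-(q * ρ ^ 2) * ‖u‖ ^ 2) *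
      Complex.exp (-(inner ℝ x u : ℝ) * Complex.I) =
      ((ρ ^ (n + d))⁻¹ : ℝ) * gaussTransform q P (ρ⁻¹ • x) := by
  have h := Measure.integral_comp_smul_of_nonneg (μ := volume)
    (fun u : EuclideanSpace ℝ (Fin d) => multiplier P u * Real.exp (-q * ‖u‖ ^ 2) *
      Complex.exp (-(inner ℝ (ρ⁻¹ • x) u : ℝ) * Complex.I)) ρ (hR := hρ.le)
  rw [finrank_euclideanSpace_fin] at h
  rw [pow_add, mul_inv, Complex.ofReal_mul, mul_assoc, gaussTransform,
    ← Complex.real_smul (x := (ρ ^ d)⁻¹), ← h, ← integral_const_mul]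
  refine integral_congr_ae (ae_of_all _ fun u => ?_)
  have hρ' : (ρ : ℂ) ≠ 0 := by exact_mod_cast hρ.ne'
  simp only [multiplier_smul hP, norm_smul, Real.norm_eq_abs, abs_of_pos hρ, mul_pow,
    real_inner_smul_left, real_inner_smul_right]
  rw [← mul_assoc, ← mul_assoc, ← mul_assoc]
  push_cast
  rw [inv_mul_cancel₀ (pow_ne_zero n hρ'), one_mul, mul_inv_cancel_left₀ hρ']
  congr 3
  ring

end GaussTransform

end LatticeWalk

/-! ### Quotients of polynomials by powers of the norm, and their kernels -/

namespace LatticeWalk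

section RadialQuotients

variable {d : ℕ}

/-- The functions which, outside the origin, are quotients `P(x) / ‖x‖ ^ α` with `P` a homogeneous
polynomial of degree `n`. -/
def radQuot (d α n : ℕ) : Submodule ℝ (EuclideanSpace ℝ (Fin d) → ℝ) where
  carrier := {g | ∃ P : MvPolynomial (Fin d) ℝ, P.IsHomogeneous n ∧
    ∀ x : EuclideanSpace ℝ (Fin d), x ≠ 0 → g x = MvPolynomial.eval x P / ‖x‖ ^ α}
  add_mem' := by
    rintro f g ⟨P, hP, hf⟩ ⟨Q, hQ, hg⟩
    refine ⟨P + Q, hP.add hQ, fun x hx => ?_⟩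
    rw [Pi.add_apply, hf x hx, hg x hx, map_add, add_div]
  zero_mem' := ⟨0, MvPolynomial.isHomogeneous_zero _ _ _, by simp⟩
  smul_mem' := by
    rintro c f ⟨P, hP, hf⟩
    refine ⟨MvPolynomial.C c * P, hP.C_mul c, fun x hx => ?_⟩
    rw [Pi.smul_apply, hf x hx, map_mul, MvPolynomial.eval_C, smul_eq_mul, mul_div_assoc]

/-- Numerator and denominator can be expanded by `‖x‖ ^ 2`, which is a polynomial. -/
theorem radQuot_le_add_two (α n : ℕ) : radQuot d α n ≤ radQuot d (α + 2) (n + 2) := by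
  rintro f ⟨P, hP, hf⟩
  refine ⟨P * ∑ i, MvPolynomial.X i ^ 2, hP.mul ?_, fun x hx => ?_⟩
  · exact MvPolynomial.IsHomogeneous.sum _ _ _ fun i _ =>
      MvPolynomial.isHomogeneous_X_pow (R := ℝ) i 2
  · have h0 : ‖x‖ ≠ 0 := norm_ne_zero_iff.mpr hx
    rw [hf x hx, map_mul, map_sum]
    simp only [map_pow, MvPolynomial.eval_X]
    have h1 : ∑ i, x i ^ 2 = ‖x‖ ^ 2 := (EuclideanSpace.real_norm_sq_eq x).symm
    rw [h1, pow_add]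
    field_simp

theorem radQuot_le_add_two_mul (α n e : ℕ) :
    radQuot d α n ≤ radQuot d (α + 2 * e) (n + 2 * e) := by
  induction e with
  | zero => exact le_rfl
  | succ e ih => exact ih.trans (radQuot_le_add_two _ _)

theorem continuousOn_of_mem_radQuot {α n : ℕ} {f : EuclideanSpace ℝ (Fin d) → ℝ}
    (hf : f ∈ radQuot d α n) : ContinuousOn f {0}ᶜ := by
  obtain ⟨P, -, hf⟩ := hf
  have h : ContinuousOn (fun x : EuclideanSpace ℝ (Fin d) => MvPolynomial.eval x P / ‖x‖ ^ α)
      {0}ᶜ := by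
    refine ContinuousOn.div ?_ (by fun_prop) ?_
    · simp only [MvPolynomial.eval_eq']
      fun_prop
    · intro x hx
      exact pow_ne_zero _ (norm_ne_zero_iff.mpr hx)
  exact h.congr hf

theorem smul_of_mem_radQuot {α n k : ℕ} (hk : n + k = α) {f : EuclideanSpace ℝ (Fin d) → ℝ}
    (hf : f ∈ radQuot d α n) {t : ℝ} (ht : 0 < t) {x : EuclideanSpace ℝ (Fin d)} (hx : x ≠ 0) :
    f (t • x) = t ^ (-(k : ℤ)) * f x := by
  obtain ⟨P, hP, hf⟩ := hf
  have h0 : ‖x‖ ≠ 0 := norm_ne_zero_iff.mpr hx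
  rw [hf x hx, hf _ (smul_ne_zero ht.ne' hx), eval_smul_of_isHomogeneous hP, norm_smul,
    Real.norm_eq_abs, abs_of_pos ht, ← hk, zpow_neg, zpow_natCast, mul_pow, pow_add, pow_add]
  field_simp

/-- The terms which occur in the expansion of the potential. The summand with index `j` is
homogeneous of order `d + j - 1`; its denominator `‖x‖ ^ (d + 2 j + 2 ν j)` is governed by the
largest number `ν j` of factors of degree at least three in the expansion of the symbol which
contribute to this order. -/
def termSpace (d : ℕ) (ν : ℕ → ℕ) : Submodule ℝ (EuclideanSpace ℝ (Fin d) → ℝ) :=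
  ⨆ j : ℕ, radQuot d (d + 2 * j + 2 * ν j) (j + 1 + 2 * ν j)

end RadialQuotients

section Kernels

variable {d : ℕ}

theorem exp_neg_div_le {q t s : ℝ} (hq : 0 < q) (ht : 0 < t) (hs : 0 < s) (M : ℕ) :
    Real.exp (-s ^ 2 / (4 * q * t)) ≤ M.factorial * (4 * q) ^ M * t ^ M * (s ^ (2 * M))⁻¹ := by
  have h := Real.pow_div_factorial_le_exp (s ^ 2 / (4 * q * t)) (by positivity) M
  rw [neg_div, Real.exp_neg]
  have h1 : 0 < (s ^ 2 / (4 * q * t)) ^ M / M.factorial := by positivity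
  refine (inv_anti₀ h1 h).trans (le_of_eq ?_)
  rw [div_pow, mul_pow, pow_mul]
  field_simp

theorem inv_sqrt_pow_mul_exp_le {q t s : ℝ} (hq : 0 < q) (ht : 0 < t) (hs : 0 < s) (N L : ℕ) :
    (√t)⁻¹ ^ N * Real.exp (-s ^ 2 / (4 * q * t)) ≤
      (N + L).factorial * (4 * q) ^ (N + L) * ((√t) ^ N * t ^ L * (s ^ (2 * (N + L)))⁻¹) := by
  have h0 : 0 < √t := Real.sqrt_pos.mpr ht
  calc _ ≤ (√t)⁻¹ ^ N *
        ((N + L).factorial * (4 * q) ^ (N + L) * t ^ (N + L) * (s ^ (2 * (N + L)))⁻¹) := by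
        gcongr
        exact exp_neg_div_le hq ht hs _
    _ = (N + L).factorial * (4 * q) ^ (N + L) *
        (((√t)⁻¹ ^ N * t ^ N) * t ^ L * (s ^ (2 * (N + L)))⁻¹) := by rw [pow_add t]; ring
    _ = _ := by
        congr 3
        rw [← mul_pow]
        congr 1
        nth_rewrite 2 [← Real.mul_self_sqrt ht.le]
        field_simp

theorem integrableOn_inv_sqrt_pow_Ioi {N : ℕ} (hN : 3 ≤ N) :
    IntegrableOn (fun t : ℝ => (√t)⁻¹ ^ N) (Set.Ioi 1) := by
  have h : IntegrableOn (fun t : ℝ => t ^ (-(N : ℝ) / 2)) (Set.Ioi 1) :=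
    integrableOn_Ioi_rpow_of_lt (by
      have : (3 : ℝ) ≤ N := by exact_mod_cast hN
      linarith) one_pos
  refine h.congr_fun (fun t ht => ?_) measurableSet_Ioi
  have ht0 : (0 : ℝ) ≤ t := (zero_lt_one.trans ht).le
  simp only
  rw [inv_pow, Real.sqrt_eq_rpow, ← Real.rpow_natCast, ← Real.rpow_mul ht0, ← Real.rpow_neg ht0]
  congr 1
  ring

@[fun_prop]
theorem measurable_inv_sqrt_pow (N : ℕ) : Measurable (fun t : ℝ => (√t)⁻¹ ^ N) := by fun_prop

theorem integrableOn_parabolic_Ioc {q s : ℝ} (hq : 0 < q) (hs : 0 < s) (N : ℕ) (T : ℝ) :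
    IntegrableOn (fun t : ℝ => (√t)⁻¹ ^ N * Real.exp (-s ^ 2 / (4 * q * t))) (Set.Ioc 0 T) := by
  refine Measure.integrableOn_of_bounded (M := (N + 0).factorial * (4 * q) ^ (N + 0) *
    ((√T) ^ N * 1 * (s ^ (2 * (N + 0)))⁻¹)) (by simp)
    (Measurable.aestronglyMeasurable (by fun_prop)) ?_
  filter_upwards [ae_restrict_mem measurableSet_Ioc] with t ht
  rw [Real.norm_eq_abs, abs_of_nonneg (by positivity)]
  refine (inv_sqrt_pow_mul_exp_le hq ht.1 hs N 0).trans ?_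
  rw [pow_zero]
  gcongr
  exact ht.2

theorem integrableOn_parabolic {q s : ℝ} (hq : 0 < q) (hs : 0 < s) {N : ℕ} (hN : 3 ≤ N) :
    IntegrableOn (fun t : ℝ => (√t)⁻¹ ^ N * Real.exp (-s ^ 2 / (4 * q * t))) (Set.Ioi 0) := by
  rw [← Set.Ioc_union_Ioi_eq_Ioi zero_le_one]
  refine (integrableOn_parabolic_Ioc hq hs N 1).union ?_
  refine (integrableOn_inv_sqrt_pow_Ioi hN).mono'
    (Measurable.aestronglyMeasurable (by fun_prop)) ?_
  filter_upwards [ae_restrict_mem measurableSet_Ioi] with t ht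
  have ht0 : (0 : ℝ) < t := zero_lt_one.trans ht
  rw [Real.norm_eq_abs, abs_of_nonneg (by positivity)]
  refine mul_le_of_le_one_right (by positivity) (Real.exp_le_one_iff.mpr ?_)
  rw [neg_div]
  have : 0 ≤ s ^ 2 / (4 * q * t) := by positivity
  linarith

theorem integral_parabolic (q : ℝ) {s : ℝ} (hs : 0 < s) (N : ℕ) :
    ∫ t in Set.Ioi (0 : ℝ), (√t)⁻¹ ^ N * Real.exp (-s ^ 2 / (4 * q * t)) =
      s ^ 2 * (s ^ N)⁻¹ *
        ∫ t in Set.Ioi (0 : ℝ), (√t)⁻¹ ^ N * Real.exp (-1 / (4 * q * t)) := by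
  have h := integral_comp_mul_left_Ioi
    (fun t : ℝ => (√t)⁻¹ ^ N * Real.exp (-s ^ 2 / (4 * q * t))) 0 (b := s ^ 2) (by positivity)
  rw [mul_zero, smul_eq_mul] at h
  have h2 : ∫ t in Set.Ioi (0 : ℝ),
      (√(s ^ 2 * t))⁻¹ ^ N * Real.exp (-s ^ 2 / (4 * q * (s ^ 2 * t))) =
      (s ^ N)⁻¹ * ∫ t in Set.Ioi (0 : ℝ), (√t)⁻¹ ^ N * Real.exp (-1 / (4 * q * t)) := by
    rw [← integral_const_mul]
    refine setIntegral_congr_fun measurableSet_Ioi fun t ht => ?_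
    have ht0 : (0 : ℝ) < t := ht
    rw [Real.sqrt_mul (by positivity), Real.sqrt_sq hs.le, mul_inv, mul_pow, inv_pow s, mul_assoc]
    congr 3
    by_cases hq : q = 0
    · simp [hq]
    · field_simp
  rw [h2] at h
  have hs2 : s ^ 2 ≠ 0 := by positivity
  rw [mul_assoc, h, mul_inv_cancel_left₀ hs2]

/-- A function `F t x` on space-time, to be integrated over the time `t > 0`: its time integral
exists and is a combination of the terms of the expansion, and it is negligible for `t` up to a
multiple of `‖x‖`. -/
structure IsTermKernel (d : ℕ) (ν : ℕ → ℕ) (F : ℝ → EuclideanSpace ℝ (Fin d) → ℝ) : Prop where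
  integrableOn : ∀ x, x ≠ 0 → IntegrableOn (fun t => F t x) (Set.Ioi 0)
  integral_mem : ∃ g ∈ termSpace d ν, ∀ x, x ≠ 0 → ∫ t in Set.Ioi (0 : ℝ), F t x = g x
  small_time : ∀ (L : ℕ) (κ : ℝ), 0 < κ → ∃ C : ℝ, ∀ x, 1 ≤ ‖x‖ → ∀ t, 0 < t → t ≤ κ * ‖x‖ →
    |F t x| ≤ C * (‖x‖ ^ L)⁻¹

namespace IsTermKernel

variable {ν : ℕ → ℕ} {F F' : ℝ → EuclideanSpace ℝ (Fin d) → ℝ}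

theorem congr (h : IsTermKernel d ν F) (hF : ∀ t, 0 < t → ∀ x, F t x = F' t x) :
    IsTermKernel d ν F' where
  integrableOn x hx := (h.integrableOn x hx).congr_fun (fun t ht => hF t ht x) measurableSet_Ioi
  integral_mem := by
    obtain ⟨g, hg, h1⟩ := h.integral_mem
    refine ⟨g, hg, fun x hx => ?_⟩
    rw [← h1 x hx]
    exact setIntegral_congr_fun measurableSet_Ioi fun t ht => (hF t ht x).symm
  small_time L κ hκ := by
    obtain ⟨C, hC⟩ := h.small_time L κ hκ
    refine ⟨C, fun x hx t ht htx => ?_⟩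
    rw [← hF t ht x]
    exact hC x hx t ht htx

theorem zero : IsTermKernel d ν (fun _ _ => 0) where
  integrableOn _ _ := integrableOn_zero
  integral_mem := ⟨0, zero_mem _, fun x _ => by simp⟩
  small_time _ _ _ := ⟨0, fun _ _ _ _ _ => by simp⟩

theorem add (h : IsTermKernel d ν F) (h' : IsTermKernel d ν F') :
    IsTermKernel d ν (fun t x => F t x + F' t x) where
  integrableOn x hx := (h.integrableOn x hx).add (h'.integrableOn x hx)
  integral_mem := by
    obtain ⟨g, hg, h1⟩ := h.integral_mem
    obtain ⟨g', hg', h1'⟩ := h'.integral_mem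
    refine ⟨g + g', add_mem hg hg', fun x hx => ?_⟩
    rw [integral_add (h.integrableOn x hx) (h'.integrableOn x hx), h1 x hx, h1' x hx, Pi.add_apply]
  small_time L κ hκ := by
    obtain ⟨C, hC⟩ := h.small_time L κ hκ
    obtain ⟨C', hC'⟩ := h'.small_time L κ hκ
    refine ⟨C + C', fun x hx t ht htx => ?_⟩
    rw [add_mul]
    exact (abs_add_le _ _).trans (add_le_add (hC x hx t ht htx) (hC' x hx t ht htx))

theorem const_mul (h : IsTermKernel d ν F) (c : ℝ) :
    IsTermKernel d ν (fun t x => c * F t x) where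
  integrableOn x hx := (h.integrableOn x hx).const_mul c
  integral_mem := by
    obtain ⟨g, hg, h1⟩ := h.integral_mem
    refine ⟨c • g, Submodule.smul_mem _ _ hg, fun x hx => ?_⟩
    rw [integral_const_mul, h1 x hx, Pi.smul_apply, smul_eq_mul]
  small_time L κ hκ := by
    obtain ⟨C, hC⟩ := h.small_time L κ hκ
    refine ⟨|c| * C, fun x hx t ht htx => ?_⟩
    rw [abs_mul, mul_assoc]
    exact mul_le_mul_of_nonneg_left (hC x hx t ht htx) (abs_nonneg c)

theorem sum {ι : Type*} (s : Finset ι) {F : ι → ℝ → EuclideanSpace ℝ (Fin d) → ℝ}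
    (h : ∀ i ∈ s, IsTermKernel d ν (F i)) :
    IsTermKernel d ν (fun t x => ∑ i ∈ s, F i t x) := by
  classical
  induction s using Finset.induction_on with
  | empty => simpa using zero
  | insert i s hi ih =>
    simp only [Finset.sum_insert hi]
    exact (h i (by simp)).add (ih fun j hj => h j (by simp [hj]))

end IsTermKernel

theorem exists_abs_eval_le {R : MvPolynomial (Fin d) ℝ} {k : ℕ} (hR : R.IsHomogeneous k) :
    ∃ C : ℝ, 0 ≤ C ∧ ∀ x : EuclideanSpace ℝ (Fin d), |MvPolynomial.eval x R| ≤ C * ‖x‖ ^ k := by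
  refine ⟨∑ s ∈ R.support, |R.coeff s|, Finset.sum_nonneg fun _ _ => abs_nonneg _, fun x => ?_⟩
  rw [MvPolynomial.eval_eq', Finset.sum_mul]
  refine (Finset.abs_sum_le_sum_abs _ _).trans (Finset.sum_le_sum fun s hs => ?_)
  rw [abs_mul, Finset.abs_prod]
  refine mul_le_mul_of_nonneg_left ?_ (abs_nonneg _)
  have h : k = ∑ i, s i := by
    rw [hR.degree_eq_sum_deg_support hs]
    exact Finset.sum_subset (Finset.subset_univ _) fun i _ hi => by simpa using hi
  rw [h, ← Finset.prod_pow_eq_pow_sum]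
  refine Finset.prod_le_prod (fun _ _ => abs_nonneg _) fun i _ => ?_
  rw [abs_pow]
  exact pow_le_pow_left₀ (abs_nonneg _) (PiLp.norm_apply_le x i) _

theorem exists_parabolic_small_time {q : ℝ} (hq : 0 < q) (N L : ℕ) {κ : ℝ} (hκ : 0 < κ) :
    ∃ C : ℝ, 0 ≤ C ∧ ∀ s t : ℝ, 1 ≤ s → 0 < t → t ≤ κ * s →
      (√t)⁻¹ ^ N * Real.exp (-s ^ 2 / (4 * q * t)) ≤ C * (s ^ L)⁻¹ := by
  refine ⟨(N + L).factorial * (4 * q) ^ (N + L) * ((1 + κ) ^ N * κ ^ L), by positivity,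
    fun s t hs ht hts => ?_⟩
  have hs0 : 0 < s := by linarith
  refine (inv_sqrt_pow_mul_exp_le hq ht hs0 N L).trans ?_
  rw [mul_assoc _ ((1 + κ) ^ N * κ ^ L)]
  refine mul_le_mul_of_nonneg_left ?_ (by positivity)
  have h1 : √t ≤ (1 + κ) * s := by
    rw [Real.sqrt_le_left (by positivity)]
    nlinarith [mul_pos hκ hs0, mul_pos hκ (mul_pos hs0 hs0), mul_pos hκ hκ]
  calc (√t) ^ N * t ^ L * (s ^ (2 * (N + L)))⁻¹
      ≤ ((1 + κ) * s) ^ N * (κ * s) ^ L * (s ^ (2 * (N + L)))⁻¹ := by gcongr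
    _ = ((1 + κ) ^ N * κ ^ L) * (s ^ L)⁻¹ * (s ^ N)⁻¹ := by
        rw [show 2 * (N + L) = N + N + L + L by ring]
        simp only [pow_add, mul_pow]
        field_simp
    _ ≤ (1 + κ) ^ N * κ ^ L * (s ^ L)⁻¹ :=
        mul_le_of_le_one_right (by positivity) (inv_le_one_of_one_le₀ (one_le_pow₀ hs))

/-- The basic term kernels. Their time integral is `R(x) / ‖x‖ ^ α` up to a constant, by scaling. -/
theorem isTermKernel_eval_mul {q : ℝ} (hq : 0 < q) {ν : ℕ → ℕ} {R : MvPolynomial (Fin d) ℝ}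
    {k α j e : ℕ} (hR : R.IsHomogeneous k) (hα : 1 ≤ α)
    (h1 : α + 2 * e = d + 2 * j + 2 * ν j) (h2 : k + 2 * e = j + 1 + 2 * ν j) :
    IsTermKernel d ν (fun t x => MvPolynomial.eval x R *
      ((√t)⁻¹ ^ (α + 2) * Real.exp (-‖x‖ ^ 2 / (4 * q * t)))) where
  integrableOn x hx :=
    (integrableOn_parabolic hq (norm_pos_iff.mpr hx) (by omega)).const_mul _
  integral_mem := by
    set c := ∫ t in Set.Ioi (0 : ℝ), (√t)⁻¹ ^ (α + 2) * Real.exp (-1 / (4 * q * t)) with hc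
    refine ⟨fun x => ∫ t in Set.Ioi (0 : ℝ), MvPolynomial.eval x R *
      ((√t)⁻¹ ^ (α + 2) * Real.exp (-‖x‖ ^ 2 / (4 * q * t))), ?_, fun x _ => rfl⟩
    refine Submodule.mem_iSup_of_mem j ?_
    rw [← h1, ← h2]
    refine radQuot_le_add_two_mul _ _ _ ⟨MvPolynomial.C c * R, hR.C_mul c, fun x hx => ?_⟩
    have h0 : ‖x‖ ≠ 0 := norm_ne_zero_iff.mpr hx
    beta_reduce
    rw [integral_const_mul, integral_parabolic q (norm_pos_iff.mpr hx), ← hc, map_mul,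
      MvPolynomial.eval_C, pow_add]
    field_simp
  small_time L κ hκ := by
    obtain ⟨C, hC, hb⟩ := exists_abs_eval_le hR
    obtain ⟨C', hC', hb'⟩ := exists_parabolic_small_time hq (α + 2) (L + k) hκ
    refine ⟨C * C', fun x hx t ht htx => ?_⟩
    have hx0 : 0 < ‖x‖ := by linarith
    rw [abs_mul, abs_of_nonneg (a := (√t)⁻¹ ^ (α + 2) * _) (by positivity)]
    calc _ ≤ (C * ‖x‖ ^ k) * (C' * (‖x‖ ^ (L + k))⁻¹) :=
          mul_le_mul (hb x) (hb' ‖x‖ t hx ht htx) (by positivity) (by positivity)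
      _ = _ := by rw [pow_add]; field_simp

/-- The contribution to the heat kernel of a homogeneous polynomial `P` of degree `n = 2 m + j + 1`
in the symbol, multiplied by `t ^ m`; the polynomial `R` comes from the Gaussian transform
of `P`. -/
theorem isTermKernel_of_mem_parityLE {q : ℝ} (hq : 0 < q) (hd : 1 ≤ d) {ν : ℕ → ℕ} {m j : ℕ}
    (hm : m ≤ ν j) {R : MvPolynomial (Fin d) ℝ} (hR : R ∈ parityLE d (2 * m + j + 1)) :
    IsTermKernel d ν (fun t x => t ^ m * ((√t ^ (2 * m + j + 1 + d))⁻¹ *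
      (MvPolynomial.eval ((√t)⁻¹ • x) R * Real.exp (-‖(√t)⁻¹ • x‖ ^ 2 / (4 * q))))) := by
  induction hR using Submodule.span_induction with
  | mem R h =>
    obtain ⟨k, i, hk, hn⟩ := h
    have hα : 1 ≤ d + j + k - 1 := by omega
    refine (isTermKernel_eval_mul hq hk hα (e := ν j - m + i) (j := j) (by omega)
      (by omega)).congr fun t ht x => ?_
    have hs : 0 < √t := Real.sqrt_pos.mpr ht
    have e1 : -‖(√t)⁻¹ • x‖ ^ 2 / (4 * q) = -‖x‖ ^ 2 / (4 * q * t) := by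
      rw [norm_smul, mul_pow, Real.norm_eq_abs, sq_abs, inv_pow, Real.sq_sqrt ht.le]
      field_simp
    have e2 : (√t)⁻¹ ^ (d + j + k - 1 + 2) =
        t ^ m * ((√t ^ (2 * m + j + 1 + d))⁻¹ * (√t)⁻¹ ^ k) := by
      have e3 : t ^ m = √t ^ (2 * m) := by rw [pow_mul, Real.sq_sqrt ht.le]
      rw [e3, show d + j + k - 1 + 2 = (j + 1 + d) + k by omega,
        show 2 * m + j + 1 + d = 2 * m + (j + 1 + d) by omega]
      simp only [pow_add, inv_pow]
      field_simp
    rw [e1, e2, eval_smul_of_isHomogeneous hk]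
    ring
  | zero => exact (IsTermKernel.zero).congr fun t _ x => by simp
  | add P Q _ _ hP hQ => exact (hP.add hQ).congr fun t _ x => by rw [map_add]; ring
  | smul a P _ hP =>
    exact (hP.const_mul a).congr fun t _ x => by rw [MvPolynomial.smul_eval]; ring

end Kernels

end LatticeWalk

/-! ### The leading term -/

namespace LatticeWalk

section LeadingTerm

/-- The Gaussian heat kernel at distance `s` without its constant, subtracted from its value at the
origin. The latter is cut off at times `t ≤ 1`, where it is not integrable. -/
def leadKernel (q : ℝ) (d : ℕ) (t s : ℝ) : ℝ :=
  Set.indicator (Set.Ioi 1) (fun t => (√t)⁻¹ ^ d) t -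
    (√t)⁻¹ ^ d * Real.exp (-s ^ 2 / (4 * q * t))

theorem integrableOn_leadKernel {q s : ℝ} {d : ℕ} (hq : 0 < q) (hs : 0 < s) (hd : 1 ≤ d) :
    IntegrableOn (fun t => leadKernel q d t s) (Set.Ioi 0) := by
  rw [← Set.Ioc_union_Ioi_eq_Ioi zero_le_one]
  refine IntegrableOn.union ?_ ?_
  · refine (integrableOn_parabolic_Ioc hq hs d 1).neg.congr_fun (fun t ht => ?_) measurableSet_Ioc
    simp only [leadKernel, Pi.neg_apply]
    rw [Set.indicator_of_notMem (by simpa using ht.2), zero_sub]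
  · have h := (integrableOn_inv_sqrt_pow_Ioi (N := d + 2) (by omega)).const_mul (s ^ 2 / (4 * q))
    refine h.mono' (Measurable.aestronglyMeasurable ?_) ?_
    · unfold leadKernel
      refine Measurable.sub (Measurable.indicator (by fun_prop) measurableSet_Ioi) (by fun_prop)
    · filter_upwards [ae_restrict_mem measurableSet_Ioi] with t ht
      have ht0 : (0 : ℝ) < t := zero_lt_one.trans ht
      have hst : 0 < √t := Real.sqrt_pos.mpr ht0
      rw [leadKernel, Set.indicator_of_mem ht, ← mul_one_sub, Real.norm_eq_abs, abs_mul,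
        abs_of_nonneg (by positivity : 0 ≤ (√t)⁻¹ ^ d)]
      have h1 : 0 ≤ s ^ 2 / (4 * q * t) := by positivity
      have h2 : Real.exp (-s ^ 2 / (4 * q * t)) ≤ 1 :=
        Real.exp_le_one_iff.mpr (by rw [neg_div]; linarith)
      have h3 := Real.add_one_le_exp (-s ^ 2 / (4 * q * t))
      rw [abs_of_nonneg (by linarith)]
      have h4 : 1 - Real.exp (-s ^ 2 / (4 * q * t)) ≤ s ^ 2 / (4 * q * t) := by
        rw [neg_div] at h3 ⊢; linarith
      calc _ ≤ (√t)⁻¹ ^ d * (s ^ 2 / (4 * q * t)) := by gcongr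
        _ = _ := by
          rw [pow_add, inv_pow _ 2, Real.sq_sqrt ht0.le]
          field_simp

theorem indicator_Ioi_sub_indicator_Ioi (f : ℝ → ℝ) {a : ℝ} (ha : 0 < a)
    (hf : ∀ x y : ℝ, 0 < x → 0 < y → IntervalIntegrable f volume x y) :
    Integrable (fun t => Set.indicator (Set.Ioi a) f t - Set.indicator (Set.Ioi 1) f t) ∧
    ∫ t, (Set.indicator (Set.Ioi a) f t - Set.indicator (Set.Ioi 1) f t) = ∫ t in a..1, f t := by
  rcases le_total a 1 with h | h
  · have e : (fun t => Set.indicator (Set.Ioi a) f t - Set.indicator (Set.Ioi 1) f t) =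
        Set.indicator (Set.Ioc a 1) f := by
      ext t
      by_cases h1 : 1 < t
      · have h2 : a < t := h.trans_lt h1
        simp [Set.indicator, h1, h2, not_le.mpr h1]
      · simp [Set.indicator, h1, not_lt.mp h1]
    rw [e, integral_indicator measurableSet_Ioc, intervalIntegral.integral_of_le h]
    exact ⟨((hf a 1 ha one_pos).1).integrable_indicator measurableSet_Ioc, rfl⟩
  · have e : (fun t => Set.indicator (Set.Ioi a) f t - Set.indicator (Set.Ioi 1) f t) =
        fun t => -Set.indicator (Set.Ioc 1 a) f t := by
      ext t
      by_cases h1 : a < t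
      · have h2 : 1 < t := h.trans_lt h1
        simp [Set.indicator, h1, h2, not_le.mpr h1]
      · simp [Set.indicator, h1, not_lt.mp h1]
    rw [e, integral_neg, integral_indicator measurableSet_Ioc,
      intervalIntegral.integral_of_ge h]
    exact ⟨(((hf 1 a one_pos ha).1).integrable_indicator measurableSet_Ioc).neg, rfl⟩

/-- The leading term: scaling `t` by `s²` shows that the time integral of the Gaussian kernel is, up
to a constant, a multiple of the radial function `μ_d`. The cut-off at time one contributes the
logarithm in dimension two. -/
theorem exists_integral_leadKernel_eq {q : ℝ} (hq : 0 < q) {d : ℕ} (hd : 1 ≤ d) :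
    ∃ τ c : ℝ, ∀ s : ℝ, 0 < s →
      ∫ t in Set.Ioi (0 : ℝ), leadKernel q d t s = τ * radial d s + c := by
  set I₁ := ∫ t in Set.Ioi (0 : ℝ), leadKernel q d t 1 with hI₁
  have hcont : ContinuousOn (fun t : ℝ => (√t)⁻¹ ^ d) (Set.Ioi 0) := by
    refine ContinuousOn.pow (ContinuousOn.inv₀ (by fun_prop) fun t ht => ?_) d
    exact (Real.sqrt_pos.mpr ht).ne'
  have hii : ∀ x y : ℝ, 0 < x → 0 < y →
      IntervalIntegrable (fun t : ℝ => (√t)⁻¹ ^ d) volume x y := by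
    intro x y hx hy
    refine (hcont.mono fun t ht => ?_).intervalIntegrable
    exact (lt_min hx hy).trans_le ht.1
  have scaling : ∀ s : ℝ, 0 < s → ∫ t in Set.Ioi (0 : ℝ), leadKernel q d t s =
      s ^ 2 * (s ^ d)⁻¹ * (I₁ + ∫ t in (s ^ 2)⁻¹..1, (√t)⁻¹ ^ d) := by
    intro s hs
    have ha : 0 < (s ^ 2)⁻¹ := by positivity
    obtain ⟨hi1, hi2⟩ := indicator_Ioi_sub_indicator_Ioi (fun t : ℝ => (√t)⁻¹ ^ d) ha hii
    have hi3 : ∫ t in Set.Ioi (0 : ℝ), (Set.indicator (Set.Ioi (s ^ 2)⁻¹)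
        (fun t => (√t)⁻¹ ^ d) t - Set.indicator (Set.Ioi 1) (fun t => (√t)⁻¹ ^ d) t) =
        ∫ t in (s ^ 2)⁻¹..1, (√t)⁻¹ ^ d := by
      rw [← hi2]
      refine setIntegral_eq_integral_of_forall_compl_eq_zero fun t ht => ?_
      have ht0 : t ≤ 0 := not_lt.mp ht
      rw [Set.indicator_of_notMem (by simp only [Set.mem_Ioi]; linarith),
        Set.indicator_of_notMem (by simp only [Set.mem_Ioi]; linarith), sub_zero]
    have h := integral_comp_mul_left_Ioi (fun t : ℝ => leadKernel q d t s) 0 (b := s ^ 2)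
      (by positivity)
    rw [mul_zero, smul_eq_mul] at h
    have h2 : ∫ t in Set.Ioi (0 : ℝ), leadKernel q d (s ^ 2 * t) s = (s ^ d)⁻¹ *
        (I₁ + ∫ t in (s ^ 2)⁻¹..1, (√t)⁻¹ ^ d) := by
      rw [hI₁, ← hi3, ← integral_add (integrableOn_leadKernel hq one_pos hd) hi1.integrableOn,
        ← integral_const_mul]
      refine setIntegral_congr_fun measurableSet_Ioi fun t ht => ?_
      have ht0 : (0 : ℝ) < t := ht
      have e1 : Set.indicator (Set.Ioi 1) (fun t => (√t)⁻¹ ^ d) (s ^ 2 * t) =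
          (s ^ d)⁻¹ * Set.indicator (Set.Ioi (s ^ 2)⁻¹) (fun t => (√t)⁻¹ ^ d) t := by
        have hiff : 1 < s ^ 2 * t ↔ (s ^ 2)⁻¹ < t := by
          rw [inv_lt_iff_one_lt_mul₀' (by positivity)]
        simp only [Set.indicator, Set.mem_Ioi, hiff]
        split_ifs
        · rw [Real.sqrt_mul (by positivity), Real.sqrt_sq hs.le, mul_inv, mul_pow, inv_pow s]
        · simp
      have e2 : (√(s ^ 2 * t))⁻¹ ^ d = (s ^ d)⁻¹ * (√t)⁻¹ ^ d := by
        rw [Real.sqrt_mul (by positivity), Real.sqrt_sq hs.le, mul_inv, mul_pow, inv_pow s]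
      have e3 : -s ^ 2 / (4 * q * (s ^ 2 * t)) = -1 ^ 2 / (4 * q * t) := by
        field_simp
      simp only [leadKernel]
      rw [e1, e2, e3]
      ring
    rw [h2] at h
    have hs2 : s ^ 2 ≠ 0 := by positivity
    rw [mul_assoc, h, mul_inv_cancel_left₀ hs2]
  have hrpow : ∀ a : ℝ, 0 < a → ∫ t in a..1, (√t)⁻¹ ^ d = ∫ t in a..1, t ^ (-(d : ℝ) / 2) := by
    intro a ha
    refine intervalIntegral.integral_congr fun t ht => ?_
    have ht0 : (0 : ℝ) ≤ t := ((lt_min ha one_pos).trans_le ht.1).le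
    rw [inv_pow, Real.sqrt_eq_rpow, ← Real.rpow_natCast, ← Real.rpow_mul ht0, ← Real.rpow_neg ht0]
    congr 1
    ring
  by_cases h2 : d = 2
  · refine ⟨2, I₁, fun s hs => ?_⟩
    have ha : 0 < (s ^ 2)⁻¹ := by positivity
    have hs2 : s ^ 2 ≠ 0 := by positivity
    rw [scaling s hs, hrpow _ ha, radial, if_pos h2, h2]
    have e : ∫ t in (s ^ 2)⁻¹..1, t ^ (-((2 : ℕ) : ℝ) / 2) = 2 * Real.log s := by
      have : ∀ t : ℝ, t ^ (-((2 : ℕ) : ℝ) / 2) = t⁻¹ := by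
        intro t
        rw [show -((2 : ℕ) : ℝ) / 2 = -1 by norm_num, Real.rpow_neg_one]
      simp only [this]
      rw [integral_inv_of_pos ha one_pos, one_div, inv_inv, Real.log_pow]
      norm_num
    rw [e, mul_inv_cancel₀ hs2]
    ring
  · have hd2 : (d : ℝ) ≠ 2 := by exact_mod_cast h2
    have hβ : -(d : ℝ) / 2 + 1 ≠ 0 := by
      intro h; apply hd2; linarith
    refine ⟨I₁ + (-(d : ℝ) / 2 + 1)⁻¹, -(-(d : ℝ) / 2 + 1)⁻¹, fun s hs => ?_⟩
    have ha : 0 < (s ^ 2)⁻¹ := by positivity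
    rw [scaling s hs, hrpow _ ha, radial, if_neg h2, integral_rpow (Or.inr ⟨by
      intro h; apply hβ; linarith, Set.notMem_uIcc_of_lt ha one_pos⟩), Real.one_rpow]
    have e : ((s ^ 2)⁻¹) ^ (-(d : ℝ) / 2 + 1) = s ^ d * (s ^ 2)⁻¹ := by
      rw [← Real.rpow_natCast s 2, ← Real.rpow_neg hs.le, ← Real.rpow_mul hs.le,
        ← Real.rpow_natCast s d, ← Real.rpow_add hs]
      congr 1
      push_cast
      ring
    have e2 : s ^ (2 - (d : ℤ)) = s ^ 2 * (s ^ d)⁻¹ := by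
      rw [zpow_sub₀ hs.ne', zpow_natCast, div_eq_mul_inv]
      norm_cast
    rw [e, e2]
    have : s ^ 2 * (s ^ d)⁻¹ * (s ^ d * (s ^ 2)⁻¹) = 1 := by field_simp
    rw [div_eq_mul_inv]
    linear_combination (-(-(d : ℝ) / 2 + 1)⁻¹) * this

end LeadingTerm

end LatticeWalk

/-! ### The Edgeworth approximation of the symbol -/

namespace LatticeWalk

theorem norm_pow_sub_pow_le_of_le {a b : ℂ} {r : ℝ} (ha : ‖a‖ ≤ r) (hb : ‖b‖ ≤ r) (m : ℕ) :
    ‖a ^ (m + 1) - b ^ (m + 1)‖ ≤ (m + 1) * r ^ m * ‖a - b‖ := by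
  have hr : 0 ≤ r := (norm_nonneg a).trans ha
  induction m with
  | zero => simp
  | succ m ih =>
    have e : a ^ (m + 1 + 1) - b ^ (m + 1 + 1) =
        a * (a ^ (m + 1) - b ^ (m + 1)) + (a - b) * b ^ (m + 1) := by ring
    rw [e]
    refine (norm_add_le _ _).trans ?_
    rw [norm_mul, norm_mul, norm_pow]
    have h1 : ‖a‖ * ‖a ^ (m + 1) - b ^ (m + 1)‖ ≤ r * ((m + 1) * r ^ m * ‖a - b‖) := by gcongr
    have h2 : ‖a - b‖ * ‖b‖ ^ (m + 1) ≤ ‖a - b‖ * r ^ (m + 1) := by gcongr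
    refine (add_le_add h1 h2).trans (le_of_eq ?_)
    push_cast
    ring

namespace SphericalWalk

variable {G : Type*} [AddCommGroup G] {d : ℕ} (W : SphericalWalk G d)

/-- The moment polynomial `𝔼 ⟨R, X⟩ ^ n`. -/
def moment (n : ℕ) : MvPolynomial (Fin d) ℝ :=
  ∑ x ∈ W.steps, MvPolynomial.C (W.wt x) *
    (∑ k, MvPolynomial.C (W.pos x k) * MvPolynomial.X k) ^ n

theorem isHomogeneous_moment (n : ℕ) : (W.moment n).IsHomogeneous n := by
  refine MvPolynomial.IsHomogeneous.sum _ _ _ fun x _ => MvPolynomial.IsHomogeneous.C_mul ?_ _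
  have := (MvPolynomial.IsHomogeneous.sum Finset.univ
    (fun k => MvPolynomial.C (W.pos x k) * MvPolynomial.X k) 1 fun k _ =>
      MvPolynomial.isHomogeneous_C_mul_X (W.pos x k) k).pow n
  rwa [one_mul] at this

theorem eval_moment (n : ℕ) (u : EuclideanSpace ℝ (Fin d)) :
    MvPolynomial.eval u (W.moment n) = ∑ x ∈ W.steps, W.wt x * (inner ℝ (W.pos x) u) ^ n := by
  simp only [moment, map_sum, map_mul, map_pow, MvPolynomial.eval_C, MvPolynomial.eval_X]
  refine Finset.sum_congr rfl fun x _ => ?_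
  rw [PiLp.inner_apply]
  congr 2
  refine Finset.sum_congr rfl fun k _ => ?_
  simp [mul_comm]

theorem multiplier_moment (n : ℕ) (u : EuclideanSpace ℝ (Fin d)) :
    multiplier (W.moment n) u =
      ∑ x ∈ W.steps, (W.wt x : ℂ) * ((inner ℝ (W.pos x) u : ℝ) * Complex.I) ^ n := by
  simp only [multiplier, moment, map_sum, map_mul, map_pow, MvPolynomial.aeval_C,
    MvPolynomial.aeval_X, Complex.coe_algebraMap]
  refine Finset.sum_congr rfl fun x _ => ?_
  rw [PiLp.inner_apply]
  congr 2
  push_cast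
  rw [Finset.sum_mul]
  refine Finset.sum_congr rfl fun k _ => ?_
  simp
  ring

/-- The part of degree at least three, and less than `N`, of the Taylor expansion of the
characteristic function. -/
def cubicPart (N : ℕ) : MvPolynomial (Fin d) ℝ :=
  ∑ n ∈ Finset.Ico 3 N, MvPolynomial.C ((n.factorial : ℝ)⁻¹) * W.moment n

/-- The difference between the symbol and its quadratic part. -/
def remainder (u : EuclideanSpace ℝ (Fin d)) : ℂ := W.q * ‖u‖ ^ 2 - W.symbol u

/-- As the walk is centred and spherical, its Taylor polynomial of degree two is `1 - q ‖u‖²`. -/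
theorem remainder_sub_multiplier {N : ℕ} (hN : 3 ≤ N) (u : EuclideanSpace ℝ (Fin d)) :
    W.remainder u - multiplier (W.cubicPart N) u = ∑ x ∈ W.steps, (W.wt x : ℂ) *
      (Complex.exp ((inner ℝ (W.pos x) u : ℝ) * Complex.I) -
        ∑ n ∈ range N, ((inner ℝ (W.pos x) u : ℝ) * Complex.I) ^ n / n.factorial) := by
  have h1 : multiplier (W.cubicPart N) u =
      ∑ n ∈ Finset.Ico 3 N, multiplier (W.moment n) u / n.factorial := by
    have : ∀ (c : ℝ) (P : MvPolynomial (Fin d) ℝ),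
        multiplier (MvPolynomial.C c * P) u = c * multiplier P u := by
      intro c P; simp [multiplier]
    have h2 : multiplier (W.cubicPart N) u = ∑ n ∈ Finset.Ico 3 N,
        multiplier (MvPolynomial.C ((n.factorial : ℝ)⁻¹) * W.moment n) u := by
      simp only [multiplier, cubicPart, map_sum]
    rw [h2]
    refine Finset.sum_congr rfl fun n _ => ?_
    rw [this]
    push_cast
    ring
  have h3 : ∑ x ∈ W.steps, (W.wt x : ℂ) *
      ∑ n ∈ range N, ((inner ℝ (W.pos x) u : ℝ) * Complex.I) ^ n / n.factorial =
      ∑ n ∈ range N, multiplier (W.moment n) u / n.factorial := by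
    simp only [Finset.mul_sum, multiplier_moment, Finset.sum_div]
    rw [Finset.sum_comm]
    refine Finset.sum_congr rfl fun n _ => Finset.sum_congr rfl fun x _ => ?_
    ring
  have m0 : multiplier (W.moment 0) u = 1 := by
    simp only [multiplier_moment, pow_zero, mul_one]
    exact_mod_cast W.sum_wt
  have m1 : multiplier (W.moment 1) u = 0 := by
    simp only [multiplier_moment, pow_one, ← mul_assoc, ← Finset.sum_mul]
    rw [mul_eq_zero]
    left
    exact_mod_cast W.sum_wt_inner u
  have m2 : multiplier (W.moment 2) u = -(2 * W.q * ‖u‖ ^ 2 : ℝ) := by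
    rw [← W.sum_wt_inner_sq, multiplier_moment]
    push_cast
    rw [← Finset.sum_neg_distrib]
    refine Finset.sum_congr rfl fun x _ => ?_
    rw [mul_pow, Complex.I_sq]
    ring
  have h4 : ∑ n ∈ range N, multiplier (W.moment n) u / n.factorial =
      1 - W.q * ‖u‖ ^ 2 + multiplier (W.cubicPart N) u := by
    rw [← Finset.sum_range_add_sum_Ico _ hN, h1]
    congr 1
    simp [Finset.sum_range_succ, m0, m1, m2]
    ring
  simp only [mul_sub, Finset.sum_sub_distrib]
  rw [h3, h4, remainder, symbol, char]
  ring

theorem exists_norm_remainder_sub_le {N : ℕ} (hN : 3 ≤ N) : ∃ C : ℝ, 0 ≤ C ∧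
    ∀ u : EuclideanSpace ℝ (Fin d), ‖u‖ ≤ 1 →
      ‖W.remainder u - multiplier (W.cubicPart N) u‖ ≤ C * ‖u‖ ^ N := by
  have hB := W.one_le_B
  refine ⟨W.B ^ N * Real.exp W.B, by positivity, fun u hu => ?_⟩
  rw [W.remainder_sub_multiplier hN]
  have h2 : W.B ^ N * Real.exp W.B * ‖u‖ ^ N =
      ∑ x ∈ W.steps, W.wt x * (W.B ^ N * Real.exp W.B * ‖u‖ ^ N) := by
    rw [← Finset.sum_mul, W.sum_wt, one_mul]
  rw [h2]
  refine norm_sum_le_of_le _ fun x hx => ?_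
  rw [norm_mul, Complex.norm_real, Real.norm_eq_abs, abs_of_nonneg (W.wt_nonneg x)]
  refine mul_le_mul_of_nonneg_left ?_ (W.wt_nonneg x)
  refine (Complex.norm_exp_sub_sum_le_norm_mul_exp _ N).trans ?_
  rw [norm_mul, Complex.norm_I, mul_one, Complex.norm_real, Real.norm_eq_abs]
  have h3 := W.abs_inner_le hx u
  have h4 : W.B * ‖u‖ ≤ W.B := mul_le_of_le_one_right (by linarith) hu
  calc _ ≤ (W.B * ‖u‖) ^ N * Real.exp W.B := by
        gcongr
        exact h3.trans h4
    _ = _ := by rw [mul_pow]; ring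

theorem exists_norm_remainder_le : ∃ K : ℝ, 0 ≤ K ∧
    ∀ u : EuclideanSpace ℝ (Fin d), ‖u‖ ≤ 1 → ‖W.remainder u‖ ≤ K * ‖u‖ ^ 3 := by
  obtain ⟨C, hC, h⟩ := W.exists_norm_remainder_sub_le le_rfl
  refine ⟨C, hC, fun u hu => ?_⟩
  have := h u hu
  simpa [cubicPart, multiplier] using this

theorem exists_norm_cubicPart_le {N : ℕ} (hN : 3 ≤ N) : ∃ K : ℝ, 0 ≤ K ∧
    ∀ u : EuclideanSpace ℝ (Fin d), ‖u‖ ≤ 1 →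
      ‖multiplier (W.cubicPart N) u‖ ≤ K * ‖u‖ ^ 3 := by
  obtain ⟨C, hC, h⟩ := W.exists_norm_remainder_sub_le hN
  obtain ⟨K, hK, h'⟩ := W.exists_norm_remainder_le
  refine ⟨K + C, by positivity, fun u hu => ?_⟩
  have h1 : ‖u‖ ^ N ≤ ‖u‖ ^ 3 := pow_le_pow_of_le_one (norm_nonneg u) hu hN
  calc ‖multiplier (W.cubicPart N) u‖
      = ‖W.remainder u - (W.remainder u - multiplier (W.cubicPart N) u)‖ := by
        rw [sub_sub_cancel]
    _ ≤ ‖W.remainder u‖ + ‖W.remainder u - multiplier (W.cubicPart N) u‖ := norm_sub_le _ _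
    _ ≤ K * ‖u‖ ^ 3 + C * ‖u‖ ^ N := add_le_add (h' u hu) (h u hu)
    _ ≤ _ := by rw [add_mul]; gcongr

/-- The Edgeworth approximation of order `J` to `exp (-t symbol)`. -/
def edgeworth (J : ℕ) (t : ℝ) (u : EuclideanSpace ℝ (Fin d)) : ℂ :=
  Real.exp (-(W.q * t) * ‖u‖ ^ 2) *
    ∑ m ∈ range J, (t ^ m / m.factorial : ℝ) * multiplier (W.cubicPart (J + 3)) u ^ m

/-- The monomials in `t` and `r = ‖u‖` which dominate the error of the Edgeworth approximation. For
`t` of the order `r ^ (-2)`, `r ≤ 1` and `2 ≤ M`, each of them is at most of the order `r ^ J`. The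
exponent `M` allows for the growth of the polynomials at infinity. -/
def errorSum (J M : ℕ) (t r : ℝ) : ℝ :=
  ∑ m ∈ range (J + 1), (t ^ m * r ^ (2 * m + J) + t ^ m * r ^ (M * m + J))

theorem le_errorSum {J M m : ℕ} {t r : ℝ} (ht : 0 ≤ t) (hr : 0 ≤ r) (hm : m ≤ J) :
    t ^ m * r ^ (2 * m + J) ≤ errorSum J M t r ∧ t ^ m * r ^ (M * m + J) ≤ errorSum J M t r := by
  have h := Finset.single_le_sum
    (f := fun m => t ^ m * r ^ (2 * m + J) + t ^ m * r ^ (M * m + J))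
    (fun m _ => by positivity) (Finset.mem_range.mpr (Nat.lt_succ_of_le hm))
  have h1 : 0 ≤ t ^ m * r ^ (2 * m + J) := by positivity
  have h2 : 0 ≤ t ^ m * r ^ (M * m + J) := by positivity
  unfold errorSum
  constructor <;> linarith

theorem errorSum_nonneg {J M : ℕ} {t r : ℝ} (ht : 0 ≤ t) (hr : 0 ≤ r) : 0 ≤ errorSum J M t r :=
  Finset.sum_nonneg fun m _ => by positivity

/-- Near the origin, `exp (-t symbol)` is `exp (-t q ‖u‖²)` times the exponential of a cubically
small quantity, and the latter is expanded in a power series. -/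
theorem exists_edgeworth_near (J M : ℕ) : ∃ δ C : ℝ, 0 < δ ∧ δ ≤ 1 ∧ 0 ≤ C ∧
    (∀ u, ‖u‖ ≤ δ → u ∈ W.cell) ∧ ∀ t : ℝ, 0 ≤ t → ∀ u : EuclideanSpace ℝ (Fin d), ‖u‖ ≤ δ →
      ‖Complex.exp (-t * W.symbol u) - W.edgeworth J t u‖ ≤
        C * (Real.exp (-(W.q / 2 * t) * ‖u‖ ^ 2) * errorSum J M t ‖u‖) := by
  have hq := W.q_pos
  obtain ⟨δ₀, hδ₀, hcell⟩ := W.exists_ball_subset_cell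
  obtain ⟨K₁, hK₁, hr⟩ := W.exists_norm_remainder_le
  obtain ⟨K₂, hK₂, hg⟩ := W.exists_norm_cubicPart_le (N := J + 3) (by omega)
  obtain ⟨C₃, hC₃, hrg⟩ := W.exists_norm_remainder_sub_le (N := J + 3) (by omega)
  set K := max K₁ K₂ with hK
  have hK0 : 0 ≤ K := hK₁.trans (le_max_left _ _)
  -- For `‖u‖ ≤ δ` the remainder is at most half of the quadratic part of the symbol.
  set δ := min (min δ₀ 1) (W.q / (2 * (K + 1))) with hδ
  refine ⟨δ, K ^ J + ∑ m ∈ range J, (m * K ^ (m - 1) * C₃), by positivity,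
    (min_le_left _ _).trans (min_le_right _ _), by positivity, fun u hu => hcell u
    (hu.trans ((min_le_left _ _).trans (min_le_left _ _))), fun t ht u hu => ?_⟩
  set r := ‖u‖ with hrdef
  have hr0 : 0 ≤ r := norm_nonneg u
  have hr1 : r ≤ 1 := hu.trans ((min_le_left _ _).trans (min_le_right _ _))
  have hr2 : K * r ≤ W.q / 2 := by
    have h1 : r ≤ W.q / (2 * (K + 1)) := hu.trans (min_le_right _ _)
    rw [le_div_iff₀ (by positivity)] at h1
    nlinarith
  have hrem : ‖W.remainder u‖ ≤ K * r ^ 3 :=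
    (hr u hr1).trans (by gcongr; exact le_max_left _ _)
  have hcub : ‖multiplier (W.cubicPart (J + 3)) u‖ ≤ K * r ^ 3 :=
    (hg u hr1).trans (by gcongr; exact le_max_right _ _)
  set g := W.remainder u with hgdef
  set P := multiplier (W.cubicPart (J + 3)) u with hPdef
  set E := errorSum J M t r with hE
  have hE0 : 0 ≤ E := errorSum_nonneg ht hr0
  have e1 : Complex.exp (-t * W.symbol u) =
      Real.exp (-(W.q * t) * r ^ 2) * Complex.exp (t * g) := by
    rw [Complex.ofReal_exp, ← Complex.exp_add]
    congr 1
    rw [hgdef, remainder]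
    push_cast
    ring
  have e2 : Complex.exp (t * g) - ∑ m ∈ range J, (t ^ m / m.factorial : ℝ) * P ^ m =
      (Complex.exp (t * g) - ∑ m ∈ range J, (t * g) ^ m / m.factorial) +
        ∑ m ∈ range J, (t ^ m / m.factorial : ℝ) * (g ^ m - P ^ m) := by
    simp only [mul_sub, Finset.sum_sub_distrib]
    have : ∑ m ∈ range J, (t * g) ^ m / (m.factorial : ℂ) =
        ∑ m ∈ range J, ((t ^ m / m.factorial : ℝ) : ℂ) * g ^ m := by
      refine Finset.sum_congr rfl fun m _ => ?_
      push_cast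
      rw [mul_pow]; ring
    rw [this]; ring
  have b0 : ‖(t : ℂ) * g‖ ≤ t * (K * r ^ 3) := by
    rw [norm_mul, Complex.norm_real, Real.norm_eq_abs, abs_of_nonneg ht]
    gcongr
  have b1 : ‖Complex.exp (t * g) - ∑ m ∈ range J, (t * g) ^ m / (m.factorial : ℂ)‖ ≤
      K ^ J * E * Real.exp (W.q / 2 * t * r ^ 2) := by
    refine (Complex.norm_exp_sub_sum_le_norm_mul_exp _ J).trans ?_
    have h1 : ‖(t : ℂ) * g‖ ^ J ≤ K ^ J * E := by
      calc _ ≤ (t * (K * r ^ 3)) ^ J := by gcongr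
        _ = K ^ J * (t ^ J * r ^ (2 * J + J)) := by
          rw [mul_pow, mul_pow, ← pow_mul, show 2 * J + J = 3 * J by ring]; ring
        _ ≤ _ := by
          gcongr
          exact (le_errorSum ht hr0 le_rfl).1
    have h2 : ‖(t : ℂ) * g‖ ≤ W.q / 2 * t * r ^ 2 := by
      refine b0.trans ?_
      have : t * (K * r ^ 3) = (K * r) * (t * r ^ 2) := by ring
      rw [this]
      have h3 : 0 ≤ t * r ^ 2 := by positivity
      nlinarith
    gcongr
  have b2 : ‖∑ m ∈ range J, ((t ^ m / m.factorial : ℝ) : ℂ) * (g ^ m - P ^ m)‖ ≤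
      (∑ m ∈ range J, (m * K ^ (m - 1) * C₃)) * E := by
    rw [Finset.sum_mul]
    refine norm_sum_le_of_le _ fun m hm => ?_
    rcases m with _ | m
    · simp
    have hm' : m + 1 ≤ J := (Finset.mem_range.mp hm).le
    rw [norm_mul, Complex.norm_real, Real.norm_eq_abs, abs_of_nonneg (by positivity)]
    have h1 := norm_pow_sub_pow_le_of_le hrem hcub m
    have h2 : ‖g - P‖ ≤ C₃ * r ^ (J + 3) := hrg u hr1
    have h3 : t ^ (m + 1) / ((m + 1).factorial : ℝ) ≤ t ^ (m + 1) := by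
      apply div_le_self (by positivity)
      exact_mod_cast Nat.one_le_iff_ne_zero.mpr (Nat.factorial_ne_zero _)
    have h4 : r ^ (3 * (m + 1) + J) ≤ r ^ (2 * (m + 1) + J) :=
      pow_le_pow_of_le_one hr0 hr1 (by omega)
    calc _ ≤ t ^ (m + 1) * ((m + 1) * (K * r ^ 3) ^ m * (C₃ * r ^ (J + 3))) := by
          refine mul_le_mul h3 (h1.trans ?_) (norm_nonneg _) (by positivity)
          gcongr
      _ = ((m + 1) * K ^ m * C₃) * (t ^ (m + 1) * r ^ (3 * (m + 1) + J)) := by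
          rw [mul_pow, ← pow_mul, show 3 * (m + 1) + J = 3 * m + (J + 3) by ring, pow_add r]
          ring
      _ ≤ ((m + 1) * K ^ m * C₃) * E := by
          gcongr
          refine le_trans ?_ (le_errorSum (M := M) ht hr0 hm').1
          gcongr
      _ = _ := by simp
  rw [e1, edgeworth, ← mul_sub, norm_mul, Complex.norm_real, Real.norm_eq_abs, Real.abs_exp]
  rw [e2]
  have hexp1 : 1 ≤ Real.exp (W.q / 2 * t * r ^ 2) := Real.one_le_exp (by positivity)
  calc _ ≤ Real.exp (-(W.q * t) * r ^ 2) * (K ^ J * E * Real.exp (W.q / 2 * t * r ^ 2) +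
        (∑ m ∈ range J, (m * K ^ (m - 1) * C₃)) * E * Real.exp (W.q / 2 * t * r ^ 2)) := by
        refine mul_le_mul_of_nonneg_left ((norm_add_le _ _).trans (add_le_add b1 (b2.trans ?_)))
          (Real.exp_pos _).le
        exact le_mul_of_one_le_right (by positivity) hexp1
    _ = (K ^ J + ∑ m ∈ range J, (m * K ^ (m - 1) * C₃)) *
        ((Real.exp (-(W.q * t) * r ^ 2) * Real.exp (W.q / 2 * t * r ^ 2)) * E) := by ring
    _ = _ := by
        rw [← Real.exp_add]
        congr 4
        ring

/-- The global bound for the error of the Edgeworth approximation. Away from the origin powers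
of `‖u‖` are inserted for free. -/
theorem exists_edgeworth_bound (J : ℕ) : ∃ c C : ℝ, ∃ M : ℕ, 0 < c ∧ 0 ≤ C ∧ 2 ≤ M ∧
    ∀ t : ℝ, 0 ≤ t → ∀ u : EuclideanSpace ℝ (Fin d),
      ‖W.cell.indicator (fun u => Complex.exp (-t * W.symbol u)) u - W.edgeworth J t u‖ ≤
        C * (Real.exp (-(c * t) * ‖u‖ ^ 2) * errorSum J M t ‖u‖) := by
  have hq := W.q_pos
  have hc := W.c_pos
  obtain ⟨A, M₀, hA, hpoly⟩ := exists_norm_multiplier_le (W.cubicPart (J + 3))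
  set M := M₀ + 2 with hM
  obtain ⟨δ, C₁, hδ, hδ1, hC₁, hcell, hnear⟩ := W.exists_edgeworth_near J M
  set A' := A * (1 / δ + 1) ^ M with hA'
  have hA'0 : 0 ≤ A' := by positivity
  set C₂ := (1 / δ) ^ J * (1 + ∑ m ∈ range J, A' ^ m) with hC₂
  have hC₂0 : 0 ≤ C₂ := by positivity
  refine ⟨min W.c (W.q / 2), C₁ + C₂, M, by positivity, by positivity, by omega,
    fun t ht u => ?_⟩
  set r := ‖u‖ with hr
  have hr0 : 0 ≤ r := norm_nonneg u
  have hE0 : 0 ≤ errorSum J M t r := errorSum_nonneg ht hr0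
  have hexp : ∀ a : ℝ, min W.c (W.q / 2) ≤ a →
      Real.exp (-(a * t) * r ^ 2) ≤ Real.exp (-(min W.c (W.q / 2) * t) * r ^ 2) := by
    intro a ha
    apply Real.exp_le_exp.mpr
    have : 0 ≤ t * r ^ 2 := by positivity
    nlinarith
  rcases le_or_gt r δ with h | h
  · rw [Set.indicator_of_mem (hcell u h)]
    refine (hnear t ht u h).trans ?_
    have := hexp _ (min_le_right W.c (W.q / 2))
    gcongr
    linarith
  · have hone : 1 ≤ 1 / δ * r := by
      rw [div_mul_eq_mul_div, one_mul, le_div_iff₀ hδ]; linarith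
    have honeJ : 1 ≤ (1 / δ) ^ J * r ^ J := by
      rw [← mul_pow]; exact one_le_pow₀ hone
    have b1 : ‖W.cell.indicator (fun u => Complex.exp (-t * W.symbol u)) u‖ ≤
        Real.exp (-(min W.c (W.q / 2) * t) * r ^ 2) * ((1 / δ) ^ J * errorSum J M t r) := by
      have h1 : ‖W.cell.indicator (fun u => Complex.exp (-t * W.symbol u)) u‖ ≤
          Real.exp (-(W.c * t) * r ^ 2) := by
        by_cases hu : u ∈ W.cell
        · rw [Set.indicator_of_mem hu]
          refine (W.norm_exp_neg_mul_symbol_le ht hu).trans (le_of_eq ?_)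
          congr 1; ring
        · rw [Set.indicator_of_notMem hu, norm_zero]; positivity
      refine h1.trans ((hexp _ (min_le_left _ _)).trans (le_mul_of_one_le_right (by positivity) ?_))
      have h2 := (le_errorSum (M := M) ht hr0 (Nat.zero_le J)).1
      simp only [pow_zero, one_mul, mul_zero, zero_add] at h2
      exact honeJ.trans (by gcongr)
    have b2 : ‖W.edgeworth J t u‖ ≤ Real.exp (-(min W.c (W.q / 2) * t) * r ^ 2) *
        ((1 / δ) ^ J * (∑ m ∈ range J, A' ^ m) * errorSum J M t r) := by
      rw [edgeworth, norm_mul, Complex.norm_real, Real.norm_eq_abs, Real.abs_exp]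
      refine mul_le_mul (hexp W.q ((min_le_right _ _).trans (by linarith))) ?_ (norm_nonneg _)
        (Real.exp_pos _).le
      rw [Finset.mul_sum, Finset.sum_mul]
      refine norm_sum_le_of_le _ fun m hm => ?_
      rw [norm_mul, norm_pow, Complex.norm_real, Real.norm_eq_abs, abs_of_nonneg (by positivity)]
      have h3 : t ^ m / (m.factorial : ℝ) ≤ t ^ m := by
        apply div_le_self (by positivity)
        exact_mod_cast Nat.one_le_iff_ne_zero.mpr (Nat.factorial_ne_zero _)
      have h4 : ‖multiplier (W.cubicPart (J + 3)) u‖ ≤ A' * r ^ M := by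
        refine (hpoly u).trans ?_
        rw [hA', mul_assoc, ← mul_pow]
        have h5 : 1 + r ≤ (1 / δ + 1) * r := by rw [add_mul]; linarith
        have h6 : (1 : ℝ) ≤ 1 + r := by linarith
        calc A * (1 + ‖u‖) ^ M₀ ≤ A * (1 + r) ^ M := by
              gcongr
              omega
          _ ≤ _ := by gcongr
      calc _ ≤ t ^ m * (A' * r ^ M) ^ m * ((1 / δ) ^ J * r ^ J) := by
            refine (mul_le_mul h3 (pow_le_pow_left₀ (norm_nonneg _) h4 m) (by positivity)
              (by positivity)).trans ?_
            exact le_mul_of_one_le_right (by positivity) honeJ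
        _ = (1 / δ) ^ J * A' ^ m * (t ^ m * r ^ (M * m + J)) := by
            rw [mul_pow, ← pow_mul, pow_add]; ring
        _ ≤ _ := by
            gcongr
            exact (le_errorSum ht hr0 (Finset.mem_range.mp hm).le).2
    refine (norm_sub_le _ _).trans ((add_le_add b1 b2).trans ?_)
    have e : Real.exp (-(min W.c (W.q / 2) * t) * r ^ 2) * ((1 / δ) ^ J * errorSum J M t r) +
        Real.exp (-(min W.c (W.q / 2) * t) * r ^ 2) *
        ((1 / δ) ^ J * (∑ m ∈ range J, A' ^ m) * errorSum J M t r) =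
        C₂ * (Real.exp (-(min W.c (W.q / 2) * t) * r ^ 2) * errorSum J M t r) := by
      rw [hC₂]; ring
    rw [e]
    gcongr
    linarith

end SphericalWalk
end LatticeWalk

/-! ### The expansion of the heat kernel -/

namespace LatticeWalk
namespace SphericalWalk

variable {G : Type*} [AddCommGroup G] {d : ℕ} (W : SphericalWalk G d)

theorem edgeworth_eq_multiplier (J : ℕ) (t : ℝ) (u : EuclideanSpace ℝ (Fin d)) :
    W.edgeworth J t u = multiplier (∑ m ∈ range J,
      MvPolynomial.C (t ^ m / m.factorial : ℝ) * W.cubicPart (J + 3) ^ m) u *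
        Real.exp (-(W.q * t) * ‖u‖ ^ 2) := by
  rw [edgeworth, mul_comm]
  congr 1
  simp only [multiplier, map_sum, map_mul, map_pow, MvPolynomial.aeval_C, Complex.coe_algebraMap]

theorem integrable_edgeworth_mul_wave (J : ℕ) {t : ℝ} (ht : 0 < t) (z : G) :
    Integrable fun u => W.edgeworth J t u * W.wave z u := by
  simp only [edgeworth_eq_multiplier, wave]
  exact integrable_gaussTransform (mul_pos W.q_pos ht) _ (W.pos z)

theorem heat_eq_re (t : ℝ) (z : G) : W.heat t z = W.vol⁻¹ * (∫ u,
    W.cell.indicator (fun u => Complex.exp (-t * W.symbol u)) u * W.wave z u).re := by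
  have h1 : ∫ u, W.cell.indicator (fun u => Complex.exp (-t * W.symbol u)) u * W.wave z u =
      ∫ u in W.cell, Complex.exp (-t * W.symbol u) * W.wave z u := by
    rw [← integral_indicator W.measurableSet_cell]
    refine integral_congr_ae (ae_of_all _ fun u => ?_)
    by_cases hu : u ∈ W.cell <;> simp [hu]
  have h2 := integral_re (𝕜 := ℂ) (f := fun u => Complex.exp (-t * W.symbol u) * W.wave z u)
    (W.integrableOn_cell (by fun_prop))
  rw [h1, heat]
  exact congrArg _ h2

/-- The Edgeworth approximation of the heat kernel in the sup norm. -/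
theorem exists_abs_heat_sub_edgeworth_le (J : ℕ) : ∃ C : ℝ, 0 ≤ C ∧ ∀ t : ℝ, 1 ≤ t → ∀ z : G,
    |W.heat t z - W.vol⁻¹ * (∫ u, W.edgeworth J t u * W.wave z u).re| ≤ C * (√t ^ J)⁻¹ := by
  obtain ⟨c, C, M, hc, hC, hM, hbound⟩ := W.exists_edgeworth_bound J
  have hv := W.vol_pos
  set I : ℕ → ℝ := fun n => ∫ u : EuclideanSpace ℝ (Fin d), ‖u‖ ^ n * Real.exp (-c * ‖u‖ ^ 2)
    with hI
  have hI0 : ∀ n, 0 ≤ I n := fun n => integral_nonneg fun u => by positivity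
  refine ⟨W.vol⁻¹ * (C * ∑ m ∈ range (J + 1), (I (2 * m + J) + I (M * m + J))),
    mul_nonneg (by positivity) (mul_nonneg hC (Finset.sum_nonneg fun m _ =>
      add_nonneg (hI0 _) (hI0 _))), fun t ht z => ?_⟩
  have ht0 : 0 < t := by linarith
  set ρ := √t with hρ
  have hρ1 : 1 ≤ ρ := by rw [hρ]; exact Real.one_le_sqrt.mpr ht
  have hρ0 : 0 < ρ := by linarith
  have hρt : t = ρ ^ 2 := (Real.sq_sqrt ht0.le).symm
  have hmono : ∀ n, Integrable fun u : EuclideanSpace ℝ (Fin d) =>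
      ‖u‖ ^ n * Real.exp (-(c * ρ ^ 2) * ‖u‖ ^ 2) := fun n =>
    integrable_pow_mul_exp (by positivity) n
  have hterm : ∀ m n : ℕ, 2 * m + J ≤ n →
      t ^ m * ∫ u : EuclideanSpace ℝ (Fin d), ‖u‖ ^ n * Real.exp (-(c * ρ ^ 2) * ‖u‖ ^ 2) ≤
        (ρ ^ J)⁻¹ * I n := by
    intro m n hn
    rw [integral_pow_mul_exp_sq hρ0, ← mul_assoc]
    refine mul_le_mul_of_nonneg_right ?_ (hI0 n)
    rw [hρt, ← pow_mul, ← div_eq_mul_inv, div_le_iff₀ (by positivity),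
      ← div_eq_inv_mul, le_div_iff₀ (by positivity), ← pow_add]
    exact pow_le_pow_right₀ hρ1 (by omega)
  have hbint : Integrable fun u : EuclideanSpace ℝ (Fin d) =>
      C * ∑ m ∈ range (J + 1),
        (t ^ m * (‖u‖ ^ (2 * m + J) * Real.exp (-(c * ρ ^ 2) * ‖u‖ ^ 2)) +
          t ^ m * (‖u‖ ^ (M * m + J) * Real.exp (-(c * ρ ^ 2) * ‖u‖ ^ 2))) :=
    (integrable_finsetSum _ fun m _ =>
      ((hmono _).const_mul _).add ((hmono _).const_mul _)).const_mul C
  have hind : Integrable fun u =>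
      W.cell.indicator (fun u => Complex.exp (-t * W.symbol u)) u * W.wave z u := by
    have := (W.integrableOn_cell (f := fun u => Complex.exp (-t * W.symbol u) * W.wave z u)
      (by fun_prop)).integrable_indicator W.measurableSet_cell
    refine this.congr (ae_of_all _ fun u => ?_)
    by_cases hu : u ∈ W.cell <;> simp [hu]
  rw [heat_eq_re, ← mul_sub, ← Complex.sub_re,
    ← integral_sub hind (W.integrable_edgeworth_mul_wave J ht0 z), abs_mul,
    abs_of_pos (inv_pos.mpr hv), mul_assoc]
  refine mul_le_mul_of_nonneg_left ((Complex.abs_re_le_norm _).trans ?_) (by positivity)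
  refine (norm_integral_le_of_norm_le hbint (ae_of_all _ fun u => ?_)).trans ?_
  · rw [← sub_mul, norm_mul, norm_wave, mul_one]
    refine (hbound t ht0.le u).trans (le_of_eq ?_)
    rw [errorSum, Finset.mul_sum, ← hρt]
    congr 1
    refine Finset.sum_congr rfl fun m _ => ?_
    ring
  · rw [integral_const_mul, mul_assoc]
    refine mul_le_mul_of_nonneg_left ?_ hC
    rw [integral_finsetSum]
    swap
    · exact fun m _ => ((hmono _).const_mul _).add ((hmono _).const_mul _)
    rw [Finset.sum_mul]
    refine Finset.sum_le_sum fun m _ => ?_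
    rw [integral_add ((hmono _).const_mul _) ((hmono _).const_mul _), integral_const_mul,
      integral_const_mul, add_mul, mul_comm (I _), mul_comm (I _)]
    exact add_le_add (hterm m _ le_rfl) (hterm m _ (by nlinarith))

/-- The coefficient of the Gaussian leading term of the heat kernel. -/
def leadCoeff : ℝ := W.vol⁻¹ * (Real.pi / W.q) ^ ((d : ℝ) / 2)

theorem integral_edgeworth_mul_wave (J : ℕ) {t : ℝ} (ht : 0 < t) (z : G) :
    ∫ u, W.edgeworth J t u * W.wave z u =
      ∑ m ∈ range J, ∑ n ∈ range ((W.cubicPart (J + 3) ^ m).totalDegree + 1),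
        (t ^ m / m.factorial : ℝ) * (((√t ^ (n + d))⁻¹ : ℝ) * gaussTransform W.q
          (MvPolynomial.homogeneousComponent n (W.cubicPart (J + 3) ^ m)) ((√t)⁻¹ • W.pos z)) := by
  have hs : 0 < √t := Real.sqrt_pos.mpr ht
  have hst : √t ^ 2 = t := Real.sq_sqrt ht.le
  have e1 : ∀ u, W.edgeworth J t u * W.wave z u =
      ∑ m ∈ range J, ∑ n ∈ range ((W.cubicPart (J + 3) ^ m).totalDegree + 1),
        ((t ^ m / m.factorial : ℝ) : ℂ) *
        (multiplier (MvPolynomial.homogeneousComponent n (W.cubicPart (J + 3) ^ m)) u *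
          Real.exp (-(W.q * √t ^ 2) * ‖u‖ ^ 2) *
          Complex.exp (-(inner ℝ (W.pos z) u : ℝ) * Complex.I)) := by
    intro u
    rw [edgeworth, hst, mul_assoc, Finset.sum_mul, Finset.mul_sum]
    refine Finset.sum_congr rfl fun m _ => ?_
    have h1 : multiplier (W.cubicPart (J + 3)) u ^ m =
        ∑ n ∈ range ((W.cubicPart (J + 3) ^ m).totalDegree + 1),
          multiplier (MvPolynomial.homogeneousComponent n (W.cubicPart (J + 3) ^ m)) u := by
      have h2 := congrArg (fun P => multiplier P u)
        (MvPolynomial.sum_homogeneousComponent (W.cubicPart (J + 3) ^ m))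
      simp only [multiplier, map_sum, map_pow] at h2 ⊢
      exact h2.symm
    rw [h1, ← Finset.mul_sum, ← Finset.sum_mul, ← Finset.sum_mul, wave]
    ring
  have hint : ∀ m n, Integrable fun u : EuclideanSpace ℝ (Fin d) =>
      ((t ^ m / m.factorial : ℝ) : ℂ) *
        (multiplier (MvPolynomial.homogeneousComponent n (W.cubicPart (J + 3) ^ m)) u *
          Real.exp (-(W.q * √t ^ 2) * ‖u‖ ^ 2) *
          Complex.exp (-(inner ℝ (W.pos z) u : ℝ) * Complex.I)) := by
    intro m n
    exact (integrable_gaussTransform (mul_pos W.q_pos (by positivity)) _ (W.pos z)).const_mul _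
  simp only [e1]
  rw [integral_finsetSum _ fun m _ => integrable_finsetSum _ fun n _ => hint m n]
  refine Finset.sum_congr rfl fun m _ => ?_
  rw [integral_finsetSum _ fun n _ => hint m n]
  refine Finset.sum_congr rfl fun n _ => ?_
  rw [integral_const_mul, integral_multiplier_mul_exp_sq W.q hs
    (MvPolynomial.homogeneousComponent_isHomogeneous n _)]

/-- The heat kernel is its Gaussian leading term plus a combination of term kernels, up to an error
which decays fast in time. The hypothesis bounds the number of factors of degree at least three
which contribute to each order. -/
theorem exists_heat_expansion (hd : 1 ≤ d) {ν : ℕ → ℕ}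
    (hν : ∀ N m n, 1 ≤ m → MvPolynomial.homogeneousComponent n (W.cubicPart N ^ m) ≠ 0 →
      ∃ j, n = 2 * m + j + 1 ∧ m ≤ ν j) {J : ℕ} (hJ : 1 ≤ J) :
    ∃ F : ℝ → EuclideanSpace ℝ (Fin d) → ℝ, IsTermKernel d ν F ∧ ∃ C : ℝ, 0 ≤ C ∧
      ∀ t : ℝ, 1 ≤ t → ∀ z : G, |W.heat t z - (W.leadCoeff * ((√t)⁻¹ ^ d *
        Real.exp (-‖W.pos z‖ ^ 2 / (4 * W.q * t))) + F t (W.pos z))| ≤ C * (√t ^ J)⁻¹ := by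
  have hq := W.q_pos
  obtain ⟨C, hC, hbound⟩ := W.exists_abs_heat_sub_edgeworth_le J
  have hR : ∀ m n, ∃ R ∈ parityLE d n,
      (∀ y, gaussTransform W.q
        (MvPolynomial.homogeneousComponent n (W.cubicPart (J + 3) ^ m)) y =
        ((MvPolynomial.eval y R * Real.exp (-‖y‖ ^ 2 / (4 * W.q)) : ℝ) : ℂ)) ∧
      (MvPolynomial.homogeneousComponent n (W.cubicPart (J + 3) ^ m) = 0 → R = 0) := by
    intro m n
    by_cases h : MvPolynomial.homogeneousComponent n (W.cubicPart (J + 3) ^ m) = 0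
    · exact ⟨0, zero_mem _, fun y => by simp [h, gaussTransform, multiplier], fun _ => rfl⟩
    · obtain ⟨R, hR, h1⟩ := exists_gaussTransform_eq hq
        (MvPolynomial.homogeneousComponent_isHomogeneous n (W.cubicPart (J + 3) ^ m))
      exact ⟨R, hR, h1, fun h0 => absurd h0 h⟩
  choose R hRmem hRy hR0 using hR
  set F : ℝ → EuclideanSpace ℝ (Fin d) → ℝ := fun t x => ∑ m ∈ Finset.Ico 1 J,
    ∑ n ∈ range ((W.cubicPart (J + 3) ^ m).totalDegree + 1), (W.vol⁻¹ * (m.factorial : ℝ)⁻¹) *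
      (t ^ m * ((√t ^ (n + d))⁻¹ * (MvPolynomial.eval ((√t)⁻¹ • x) (R m n) *
        Real.exp (-‖(√t)⁻¹ • x‖ ^ 2 / (4 * W.q))))) with hF
  refine ⟨F, ?_, C, hC, fun t ht z => ?_⟩
  · refine IsTermKernel.sum _ fun m hm => IsTermKernel.sum _ fun n _ => IsTermKernel.const_mul ?_ _
    by_cases h : MvPolynomial.homogeneousComponent n (W.cubicPart (J + 3) ^ m) = 0
    · refine (IsTermKernel.zero).congr fun t _ x => ?_
      rw [hR0 m n h]
      simp
    · obtain ⟨j, rfl, hmj⟩ := hν _ m n (Finset.mem_Ico.mp hm).1 h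
      exact isTermKernel_of_mem_parityLE hq hd hmj (hRmem m _)
  · have ht0 : 0 < t := by linarith
    have hs : 0 < √t := Real.sqrt_pos.mpr ht0
    have key : W.vol⁻¹ * (∫ u, W.edgeworth J t u * W.wave z u).re =
        W.leadCoeff * ((√t)⁻¹ ^ d * Real.exp (-‖W.pos z‖ ^ 2 / (4 * W.q * t))) +
          F t (W.pos z) := by
      rw [W.integral_edgeworth_mul_wave J ht0 z, Finset.range_eq_Ico,
        Finset.sum_eq_sum_Ico_succ_bot (by omega)]
      rw [Complex.add_re, mul_add]
      congr 1
      · have h1 : MvPolynomial.homogeneousComponent 0 (1 : MvPolynomial (Fin d) ℝ) = 1 := by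
          rw [MvPolynomial.homogeneousComponent_zero]; simp
        have e1 : -‖(√t)⁻¹ • W.pos z‖ ^ 2 / (4 * W.q) = -‖W.pos z‖ ^ 2 / (4 * W.q * t) := by
          rw [norm_smul, mul_pow, Real.norm_eq_abs, sq_abs, inv_pow, Real.sq_sqrt ht0.le]
          field_simp
        simp only [pow_zero, MvPolynomial.totalDegree_one, zero_add,
          Finset.sum_range_one, h1, gaussTransform_one hq, Nat.factorial_zero, Nat.cast_one,
          div_one, Complex.ofReal_one, one_mul, e1]
        rw [← Complex.ofReal_mul, Complex.ofReal_re, leadCoeff, inv_pow]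
        ring
      · rw [hF]
        simp only [Complex.re_sum, Finset.mul_sum, hRy, zero_add, Finset.range_eq_Ico]
        refine Finset.sum_congr rfl fun m _ => Finset.sum_congr rfl fun n _ => ?_
        rw [← Complex.ofReal_mul, ← Complex.ofReal_mul, Complex.ofReal_re]
        ring
    rw [← key]
    exact hbound t ht z

end SphericalWalk
end LatticeWalk

/-! ### The expansion of the potential -/

namespace LatticeWalk
namespace SphericalWalk

variable {G : Type*} [AddCommGroup G] {d : ℕ} (W : SphericalWalk G d)

theorem continuous_heat (z : G) : Continuous fun t => W.heat t z := by
  unfold heat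
  refine continuous_const.mul
    (continuous_parametric_integral_of_continuous (by fun_prop) W.isCompact_cell)

theorem exp_neg_le_pow (L : ℕ) {B s : ℝ} (hB : 0 < B) (hs : 0 < s) :
    Real.exp (-(s / (2 * B))) ≤ L.factorial * (2 * B) ^ L * (s ^ L)⁻¹ := by
  have h := Real.pow_div_factorial_le_exp (s / (2 * B)) (by positivity) L
  rw [Real.exp_neg]
  refine (inv_anti₀ (by positivity) h).trans (le_of_eq ?_)
  rw [div_pow]
  field_simp

theorem integral_Ioi_pow_inv {T : ℝ} (hT : 0 < T) (K : ℕ) :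
    IntegrableOn (fun t : ℝ => (t ^ (K + 2))⁻¹) (Set.Ioi T) ∧
      ∫ t in Set.Ioi T, (t ^ (K + 2))⁻¹ ≤ (T ^ (K + 1))⁻¹ := by
  have e : ∀ (n : ℕ) (t : ℝ), 0 < t → t ^ (-(n : ℝ)) = (t ^ n)⁻¹ := by
    intro n t ht
    rw [Real.rpow_neg ht.le, Real.rpow_natCast]
  have hlt : -((K + 2 : ℕ) : ℝ) < -1 := by push_cast; linarith [(Nat.cast_nonneg K : (0 : ℝ) ≤ K)]
  have h1 := integrableOn_Ioi_rpow_of_lt hlt hT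
  have h2 := integral_Ioi_rpow_of_lt hlt hT
  refine ⟨h1.congr_fun (fun t ht => e _ t (hT.trans ht)) measurableSet_Ioi, ?_⟩
  rw [← setIntegral_congr_fun measurableSet_Ioi (fun t ht => e (K + 2) t (hT.trans ht)), h2]
  have e2 : -((K + 2 : ℕ) : ℝ) + 1 = -((K + 1 : ℕ) : ℝ) := by push_cast; ring
  rw [e2, e _ _ hT, neg_div_neg_eq]
  refine div_le_self (by positivity) ?_
  push_cast
  linarith [(Nat.cast_nonneg K : (0 : ℝ) ≤ K)]

/-- The expansion of the potential up to a given order. The heat kernel is replaced by its Gaussian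
leading term and the term kernels; the error is small in the time integral because for `t` below a
multiple of `‖x‖` everything is negligible, and for larger `t` the error decays fast in `t`. -/
theorem exists_expansion_of_order [NeZero d] {ν : ℕ → ℕ}
    (hν : ∀ N m n, 1 ≤ m → MvPolynomial.homogeneousComponent n (W.cubicPart N ^ m) ≠ 0 →
      ∃ j, n = 2 * m + j + 1 ∧ m ≤ ν j) :
    ∃ τ : ℝ, ∀ K : ℕ, ∃ c : ℝ, ∃ g ∈ termSpace d ν, ∃ C : ℝ, ∀ z : G, 4 * W.B ≤ ‖W.pos z‖ →
      |harmonicPotential W.law z - τ * radial d ‖W.pos z‖ - c - g (W.pos z)| ≤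
        C * (‖W.pos z‖ ^ K)⁻¹ := by
  have hd : 1 ≤ d := NeZero.one_le
  have hq := W.q_pos
  have hB := W.one_le_B
  have hB0 : 0 < W.B := by linarith
  obtain ⟨τ, c₁, hlead⟩ := exists_integral_leadKernel_eq hq hd
  refine ⟨W.leadCoeff * τ, fun K => ?_⟩
  obtain ⟨F, hF, C₁, hC₁, hheat⟩ := W.exists_heat_expansion hd hν (J := 2 * (K + 2)) (by omega)
  obtain ⟨g, hg, hFg⟩ := hF.integral_mem
  -- Finite speed of propagation makes the heat kernel negligible for `t ≤ κ * ‖x‖`.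
  set κ : ℝ := 1 / (4 * W.B) with hκ
  have hκ0 : 0 < κ := by positivity
  obtain ⟨C₂, hFsmall⟩ := hF.small_time (K + 1) κ hκ0
  obtain ⟨C₃, hC₃, hlsmall⟩ := exists_parabolic_small_time hq d (K + 1) hκ0
  -- This does not depend on the point and contributes to the constant term.
  set D : ℝ → ℝ := fun t => W.heat t 0 -
    W.leadCoeff * Set.indicator (Set.Ioi 1) (fun t => (√t)⁻¹ ^ d) t with hD
  set c₂ := ∫ t in Set.Ioi (0 : ℝ), D t with hc₂
  refine ⟨c₂ + W.leadCoeff * c₁, -g, neg_mem hg,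
    ((K + 1).factorial * (2 * W.B) ^ (K + 1) + |W.leadCoeff| * C₃ + C₂) * κ +
      C₁ * (κ ^ (K + 1))⁻¹, fun z hz => ?_⟩
  set x := W.pos z with hx
  set s := ‖x‖ with hs
  have hs1 : 1 ≤ s := by linarith
  have hs0 : 0 < s := by linarith
  have hx0 : x ≠ 0 := norm_pos_iff.mp hs0
  set Δ : ℝ → ℝ := fun t => W.heat t z - (W.leadCoeff * ((√t)⁻¹ ^ d *
    Real.exp (-s ^ 2 / (4 * W.q * t))) + F t x) with hΔ
  have hΔlarge : ∀ t, 1 ≤ t → |Δ t| ≤ C₁ * (t ^ (K + 2))⁻¹ := by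
    intro t ht
    refine (hheat t ht z).trans (le_of_eq ?_)
    rw [pow_mul, Real.sq_sqrt (by linarith)]
  have hΔint : IntegrableOn Δ (Set.Ioi 0) := by
    have hloc : ∀ T : ℝ, IntegrableOn Δ (Set.Ioc 0 T) := fun T =>
      ((W.continuous_heat z).integrableOn_Ioc).sub
        (((integrableOn_parabolic_Ioc hq hs0 d T).const_mul _).add
          ((hF.integrableOn x hx0).mono_set Set.Ioc_subset_Ioi_self))
    rw [← Set.Ioc_union_Ioi_eq_Ioi zero_le_one]
    refine (hloc 1).union (((integral_Ioi_pow_inv one_pos K).1.const_mul C₁).mono' ?_ ?_)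
    · refine ((W.continuous_heat z).aestronglyMeasurable).sub
        ((Measurable.aestronglyMeasurable (by fun_prop)).add ?_)
      exact ((hF.integrableOn x hx0).mono_set (Set.Ioi_subset_Ioi zero_le_one)).1
    · filter_upwards [ae_restrict_mem measurableSet_Ioi] with t ht
      exact hΔlarge t (le_of_lt ht)
  have hsplit : ∀ t, W.heat t 0 - W.heat t z =
      D t + W.leadCoeff * leadKernel W.q d t s - F t x - Δ t := by
    intro t
    simp only [hD, hΔ, leadKernel]
    ring
  have hlint := (integrableOn_leadKernel hq hs0 hd).const_mul W.leadCoeff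
  have hDint : IntegrableOn D (Set.Ioi 0) := by
    refine ((((W.integrableOn_heat_sub z).sub hlint).add (hF.integrableOn x hx0)).add
      hΔint).congr_fun (fun t _ => ?_) measurableSet_Ioi
    simp only [Pi.add_apply, Pi.sub_apply]
    rw [hsplit t]
    ring
  have hpot : harmonicPotential W.law z - W.leadCoeff * τ * radial d s -
      (c₂ + W.leadCoeff * c₁) - (-g) x = -∫ t in Set.Ioi (0 : ℝ), Δ t := by
    rw [W.harmonicPotential_eq, Pi.neg_apply, ← hFg x hx0]
    simp only [hsplit]
    have hi₁ : IntegrableOn (fun t => D t + W.leadCoeff * leadKernel W.q d t s) (Set.Ioi 0) :=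
      hDint.add hlint
    have hi₂ : IntegrableOn (fun t => D t + W.leadCoeff * leadKernel W.q d t s - F t x)
        (Set.Ioi 0) := hi₁.sub (hF.integrableOn x hx0)
    rw [integral_sub hi₂ hΔint, integral_sub hi₁ (hF.integrableOn x hx0),
      integral_add hDint hlint, integral_const_mul, hlead s hs0]
    ring
  have hT1 : 1 ≤ κ * s := by
    rw [hκ, div_mul_eq_mul_div, one_mul, le_div_iff₀ (by positivity)]
    linarith
  have hT0 : 0 < κ * s := by linarith
  have hsmall : ∀ t ∈ Set.Ioc 0 (κ * s), ‖Δ t‖ ≤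
      ((K + 1).factorial * (2 * W.B) ^ (K + 1) + |W.leadCoeff| * C₃ + C₂) * (s ^ (K + 1))⁻¹ := by
    intro t ht
    have h1 := W.abs_heat_le ht.1.le z
    have h2 : 2 * t - s / W.B ≤ -(s / (2 * W.B)) := by
      have h3 : t ≤ s / (4 * W.B) := by
        have := ht.2
        rw [hκ] at this
        rw [div_eq_mul_one_div]
        linarith
      have e1 : s / W.B = 4 * (s / (4 * W.B)) := by field_simp
      have e2 : s / (2 * W.B) = 2 * (s / (4 * W.B)) := by field_simp; norm_num
      rw [e1, e2]
      linarith
    have h4 := (h1.trans (Real.exp_le_exp.mpr h2)).trans (exp_neg_le_pow (K + 1) hB0 hs0)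
    have h5 := hlsmall s t hs1 ht.1 ht.2
    have h6 := hFsmall x hs1 t ht.1 ht.2
    rw [Real.norm_eq_abs]
    refine (abs_sub _ _).trans ?_
    rw [add_assoc, add_mul]
    refine add_le_add h4 ((abs_add_le _ _).trans ?_)
    rw [add_mul]
    refine add_le_add ?_ h6
    rw [abs_mul, mul_assoc |W.leadCoeff|]
    refine mul_le_mul_of_nonneg_left ?_ (abs_nonneg _)
    rwa [abs_of_nonneg (by have := ht.1; positivity)]
  have hb1 := norm_setIntegral_le_of_norm_le_const (μ := volume) (s := Set.Ioc 0 (κ * s))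
    (by simp) hsmall
  have hb2 : ‖∫ t in Set.Ioi (κ * s), Δ t‖ ≤ C₁ * ((κ * s) ^ (K + 1))⁻¹ := by
    obtain ⟨h1, h2⟩ := integral_Ioi_pow_inv hT0 K
    refine (norm_integral_le_of_norm_le (h1.const_mul C₁) ?_).trans ?_
    · filter_upwards [ae_restrict_mem measurableSet_Ioi] with t ht
      exact hΔlarge t (hT1.trans (le_of_lt ht))
    · rw [integral_const_mul]
      gcongr
  rw [hpot, abs_neg, ← Set.Ioc_union_Ioi_eq_Ioi hT0.le, setIntegral_union
    (Set.Ioc_disjoint_Ioi le_rfl) measurableSet_Ioi (hΔint.mono_set Set.Ioc_subset_Ioi_self)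
    (hΔint.mono_set (Set.Ioi_subset_Ioi hT0.le))]
  refine (abs_add_le _ _).trans ?_
  rw [add_mul]
  have hsK : (s ^ (K + 1))⁻¹ ≤ (s ^ K)⁻¹ :=
    inv_anti₀ (by positivity) (pow_le_pow_right₀ hs1 (by omega))
  refine add_le_add (hb1.trans (le_of_eq ?_)) (hb2.trans ?_)
  · rw [Measure.real, Real.volume_Ioc, sub_zero, ENNReal.toReal_ofReal hT0.le, pow_succ s K]
    field_simp
  · rw [mul_pow, mul_inv, ← mul_assoc]
    gcongr

end SphericalWalk
end LatticeWalk

/-! ### Counting the factors of a term -/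

namespace LatticeWalk

/-- All monomials of `f` have degree at least `a`. -/
def OrderGE {σ : Type*} (f : MvPolynomial σ ℝ) (a : ℕ) : Prop :=
  ∀ s : σ →₀ ℕ, s.degree < a → MvPolynomial.coeff s f = 0

theorem OrderGE.mul {σ : Type*} {f g : MvPolynomial σ ℝ} {a b : ℕ} (hf : OrderGE f a)
    (hg : OrderGE g b) : OrderGE (f * g) (a + b) := by
  classical
  intro s hs
  rw [MvPolynomial.coeff_mul]
  refine Finset.sum_eq_zero fun x hx => ?_
  have hx' := Finset.HasAntidiagonal.mem_antidiagonal.mp hx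
  have hdeg : x.1.degree + x.2.degree = s.degree := by
    rw [← hx', map_add]
  by_cases h : x.1.degree < a
  · rw [hf _ h, zero_mul]
  · rw [hg _ (by omega), mul_zero]

theorem OrderGE.pow {σ : Type*} {f : MvPolynomial σ ℝ} {a : ℕ} (hf : OrderGE f a) (m : ℕ) :
    OrderGE (f ^ m) (a * m) := by
  induction m with
  | zero => intro s hs; simp at hs
  | succ m ih => rw [pow_succ, Nat.mul_succ]; exact ih.mul hf

theorem OrderGE.le_of_homogeneousComponent_ne_zero {σ : Type*} {f : MvPolynomial σ ℝ} {a n : ℕ}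
    (hf : OrderGE f a) (h : MvPolynomial.homogeneousComponent n f ≠ 0) : a ≤ n := by
  by_contra hlt
  refine h (MvPolynomial.ext _ _ fun s => ?_)
  rw [MvPolynomial.coeff_homogeneousComponent, MvPolynomial.coeff_zero]
  split_ifs with hs
  · exact hf s (by omega)
  · rfl

theorem OrderGE.sum {σ ι : Type*} {s : Finset ι} {f : ι → MvPolynomial σ ℝ} {a : ℕ}
    (hf : ∀ i ∈ s, OrderGE (f i) a) : OrderGE (∑ i ∈ s, f i) a := by
  intro t ht
  rw [MvPolynomial.coeff_sum]
  exact Finset.sum_eq_zero fun i hi => hf i hi t ht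

theorem orderGE_C_mul {σ : Type*} {f : MvPolynomial σ ℝ} {n a : ℕ} (c : ℝ)
    (hf : f.IsHomogeneous n) (h : a ≤ n ∨ f = 0) : OrderGE (MvPolynomial.C c * f) a := by
  intro s hs
  rw [MvPolynomial.coeff_C_mul]
  rcases h with h | h
  · rw [hf.coeff_eq_zero (by omega), mul_zero]
  · rw [h, MvPolynomial.coeff_zero, mul_zero]

namespace SphericalWalk

variable {G : Type*} [AddCommGroup G] {d : ℕ} (W : SphericalWalk G d)

theorem orderGE_cubicPart (N : ℕ) : OrderGE (W.cubicPart N) 3 :=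
  OrderGE.sum fun n hn => orderGE_C_mul _ (W.isHomogeneous_moment n)
    (Or.inl (Finset.mem_Ico.mp hn).1)

theorem orderGE_cubicPart_of_moment_eq_zero (h : W.moment 3 = 0) (N : ℕ) :
    OrderGE (W.cubicPart N) 4 :=
  OrderGE.sum fun n hn => orderGE_C_mul _ (W.isHomogeneous_moment n) <| by
    obtain hn | rfl := (Finset.mem_Ico.mp hn).1.lt_or_eq
    · exact Or.inl hn
    · exact Or.inr h

/-- The product of `m` polynomials of order at least three has order at least `3 * m`, whence the
terms with index `j` arise from at most `j + 1` factors. -/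
theorem exists_eq_of_homogeneousComponent_ne_zero (N m n : ℕ) (hm : 1 ≤ m)
    (h : MvPolynomial.homogeneousComponent n (W.cubicPart N ^ m) ≠ 0) :
    ∃ j, n = 2 * m + j + 1 ∧ m ≤ j + 1 := by
  have := ((W.orderGE_cubicPart N).pow m).le_of_homogeneousComponent_ne_zero h
  exact ⟨n - 2 * m - 1, by omega, by omega⟩

/-- If the third moments vanish, the factors have order at least four, and at most half as many of
them contribute. -/
theorem exists_eq_of_homogeneousComponent_ne_zero_of_moment_eq_zero (h3 : W.moment 3 = 0)
    (N m n : ℕ) (hm : 1 ≤ m)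
    (h : MvPolynomial.homogeneousComponent n (W.cubicPart N ^ m) ≠ 0) :
    ∃ j, n = 2 * m + j + 1 ∧ m ≤ (j + 1) / 2 := by
  have := ((W.orderGE_cubicPart_of_moment_eq_zero h3 N).pow m).le_of_homogeneousComponent_ne_zero h
  exact ⟨n - 2 * m - 1, by omega, by omega⟩

end SphericalWalk
end LatticeWalk

/-! ### Homogeneous terms and their uniqueness -/

namespace LatticeWalk

variable {d : ℕ}

/-- Continuity and homogeneity of degree `-k` outside the origin. -/
structure IsHomTerm (k : ℕ) (f : EuclideanSpace ℝ (Fin d) → ℝ) : Prop where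
  continuousOn : ContinuousOn f {0}ᶜ
  map_smul : ∀ t : ℝ, 0 < t → ∀ x, x ≠ 0 → f (t • x) = t ^ (-(k : ℤ)) * f x

namespace IsHomTerm

variable {k : ℕ} {f g : EuclideanSpace ℝ (Fin d) → ℝ}

theorem zero : IsHomTerm k (0 : EuclideanSpace ℝ (Fin d) → ℝ) :=
  ⟨continuousOn_const, fun t _ x _ => by simp⟩

theorem add (hf : IsHomTerm k f) (hg : IsHomTerm k g) : IsHomTerm k (f + g) :=
  ⟨hf.1.add hg.1, fun t ht x hx => by
    rw [Pi.add_apply, Pi.add_apply, hf.2 t ht x hx, hg.2 t ht x hx]; ring⟩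

theorem sub (hf : IsHomTerm k f) (hg : IsHomTerm k g) : IsHomTerm k (f - g) :=
  ⟨hf.1.sub hg.1, fun t ht x hx => by
    rw [Pi.sub_apply, Pi.sub_apply, hf.2 t ht x hx, hg.2 t ht x hx]; ring⟩

theorem const (c : ℝ) : IsHomTerm 0 (fun _ : EuclideanSpace ℝ (Fin d) => c) :=
  ⟨continuousOn_const, fun t _ x _ => by simp⟩

theorem of_mem_radQuot {α n : ℕ} (hk : n + k = α) (hf : f ∈ radQuot d α n) : IsHomTerm k f :=
  ⟨continuousOn_of_mem_radQuot hf, fun _ ht _ hx => smul_of_mem_radQuot hk hf ht hx⟩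

theorem exists_abs_le (hf : IsHomTerm k f) :
    ∃ M : ℝ, 0 ≤ M ∧ ∀ x, x ≠ 0 → |f x| ≤ M * (‖x‖ ^ k)⁻¹ := by
  have hs : Metric.sphere (0 : EuclideanSpace ℝ (Fin d)) 1 ⊆ {0}ᶜ := by
    intro x hx h0
    rw [Set.mem_singleton_iff] at h0
    simp [h0] at hx
  obtain ⟨M, hM⟩ := (isCompact_sphere (0 : EuclideanSpace ℝ (Fin d)) 1).exists_bound_of_continuousOn
    (hf.continuousOn.mono hs)
  refine ⟨max M 0, le_max_right _ _, fun x hx => ?_⟩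
  have hx0 : 0 < ‖x‖ := norm_pos_iff.mpr hx
  have h1 : ‖‖x‖⁻¹ • x‖ = 1 := by rw [norm_smul, norm_inv, norm_norm, inv_mul_cancel₀ hx0.ne']
  have hy : ‖x‖⁻¹ • x ≠ 0 := smul_ne_zero (inv_ne_zero hx0.ne') hx
  have h2 := hf.map_smul ‖x‖ hx0 _ hy
  rw [smul_inv_smul₀ hx0.ne', zpow_neg, zpow_natCast] at h2
  rw [h2, abs_mul, abs_of_nonneg (by positivity), mul_comm]
  refine mul_le_mul_of_nonneg_right ?_ (by positivity)
  exact (hM _ (by simpa using h1)).trans (le_max_left _ _)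

end IsHomTerm

/-- The possible terms of order `k` in the expansion of the potential: the summand of `termSpace d ν`
with index `k + 1 - d`, and nothing if `k + 1 < d`. -/
def orderSpace (d : ℕ) (ν : ℕ → ℕ) (k : ℕ) : Submodule ℝ (EuclideanSpace ℝ (Fin d) → ℝ) :=
  if d ≤ k + 1 then
    radQuot d (d + 2 * (k + 1 - d) + 2 * ν (k + 1 - d)) (k + 1 - d + 1 + 2 * ν (k + 1 - d))
  else ⊥

theorem IsHomTerm.of_mem_orderSpace {ν : ℕ → ℕ} {k : ℕ} {f : EuclideanSpace ℝ (Fin d) → ℝ}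
    (hf : f ∈ orderSpace d ν k) : IsHomTerm k f := by
  unfold orderSpace at hf
  split_ifs at hf with h
  · exact IsHomTerm.of_mem_radQuot (by omega) hf
  · rw [Submodule.mem_bot] at hf
    exact hf ▸ IsHomTerm.zero

/-- The summand with index `j` of `termSpace d ν` has order `d + j - 1`. -/
theorem exists_sum_orderSpace_eq (hd : 1 ≤ d) {ν : ℕ → ℕ} {g : EuclideanSpace ℝ (Fin d) → ℝ}
    (hg : g ∈ termSpace d ν) (K : ℕ) :
    ∃ f : ℕ → EuclideanSpace ℝ (Fin d) → ℝ, (∀ k, f k ∈ orderSpace d ν k) ∧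
      ∃ M, K ≤ M ∧ ∑ k ∈ range M, f k = g := by
  obtain ⟨φ, hφ, hsum⟩ := (Submodule.mem_iSup_iff_exists_finsupp _ _).mp hg
  obtain ⟨e, rfl⟩ : ∃ e, d = e + 1 := ⟨d - 1, by omega⟩
  refine ⟨fun k => if e + 1 ≤ k + 1 then φ (k - e) else 0, fun k => ?_, ?_⟩
  · unfold orderSpace
    dsimp only
    split_ifs with h
    · have h1 : k + 1 - (e + 1) = k - e := by omega
      rw [h1]
      exact hφ _
    · exact Submodule.zero_mem _
  · set N := max K (φ.support.sup id + 1)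
    refine ⟨e + N, by omega, ?_⟩
    rw [Finset.sum_range_add, Finset.sum_eq_zero, zero_add, ← hsum, Finsupp.sum]
    · symm
      refine (Finset.sum_subset (s₂ := range N) ?_ ?_).trans ?_
      · intro j hj
        have := Finset.le_sup (f := id) hj
        simp only [id, mem_range] at this ⊢
        omega
      · intro j _ hj
        exact Finsupp.notMem_support_iff.mp hj
      · refine Finset.sum_congr rfl fun j _ => ?_
        rw [if_pos (by omega), Nat.add_sub_cancel_left]
    · intro k hk
      rw [mem_range] at hk
      rw [if_neg (by omega)]

/-- A polynomial in `t` which is `O(t ^ K)` along the sequence `1, 1/2, 1/3, …` has no terms of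
order less than `K`. -/
theorem eq_zero_of_abs_sum_le {K : ℕ} {c : ℕ → ℝ} {C : ℝ}
    (h : ∀ n : ℕ, 1 ≤ n → |∑ k ∈ range K, c k * ((n : ℝ) ^ k)⁻¹| ≤ C * ((n : ℝ) ^ K)⁻¹) :
    ∀ k < K, c k = 0 := by
  induction K generalizing C with
  | zero => intro k hk; omega
  | succ K ih =>
    have hlow : ∀ k < K, c k = 0 := by
      refine ih (C := |C| + |c K|) fun n hn => ?_
      have hn1 : (1 : ℝ) ≤ n := by exact_mod_cast hn
      have h1 := h n hn
      rw [Finset.sum_range_succ] at h1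
      have h2 : |c K * ((n : ℝ) ^ K)⁻¹| = |c K| * ((n : ℝ) ^ K)⁻¹ := by
        rw [abs_mul, abs_of_nonneg (a := ((n : ℝ) ^ K)⁻¹) (by positivity)]
      have h3 : C * ((n : ℝ) ^ (K + 1))⁻¹ ≤ |C| * ((n : ℝ) ^ K)⁻¹ :=
        mul_le_mul (le_abs_self _) (inv_anti₀ (by positivity)
          (pow_le_pow_right₀ hn1 (by omega))) (by positivity) (abs_nonneg _)
      have h4 := abs_sub_abs_le_abs_sub (∑ k ∈ range K, c k * ((n : ℝ) ^ k)⁻¹)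
        (-(c K * ((n : ℝ) ^ K)⁻¹))
      rw [sub_neg_eq_add, abs_neg] at h4
      rw [add_mul]
      linarith
    intro k hk
    obtain hk | rfl := Nat.lt_succ_iff_lt_or_eq.mp hk
    · exact hlow k hk
    · by_contra hne
      have hpos : 0 < |c k| := abs_pos.mpr hne
      obtain ⟨n, hn⟩ := exists_nat_gt (|C| / |c k|)
      have hn0 : (0 : ℝ) < n := lt_of_le_of_lt (by positivity) hn
      have h1 := h n (by exact_mod_cast hn0)
      rw [Finset.sum_range_succ, Finset.sum_eq_zero (fun i hi => by
        rw [hlow i (mem_range.mp hi), zero_mul]), zero_add, abs_mul,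
        abs_of_nonneg (a := ((n : ℝ) ^ k)⁻¹) (by positivity), pow_succ, mul_inv, mul_comm,
        mul_left_comm, mul_le_mul_iff_right₀ (by positivity)] at h1
      rw [div_lt_iff₀ hpos] at hn
      have h2 : |c k| * n ≤ C := by
        have := mul_le_mul_of_nonneg_right h1 hn0.le
        rwa [mul_assoc, inv_mul_cancel₀ hn0.ne', mul_one] at this
      linarith [le_abs_self C]

namespace SphericalWalk

variable {G : Type*} [AddCommGroup G] (W : SphericalWalk G d)

/-- The expansion of the potential with terms `f k`, up to an error of order `K`. -/
def HasExpansionUpTo (τ : ℝ) (f : ℕ → EuclideanSpace ℝ (Fin d) → ℝ) (K : ℕ) : Prop :=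
  ∃ C : ℝ, ∀ z : G, z ≠ 0 → |harmonicPotential W.law z - τ * radial d ‖W.pos z‖ -
    ∑ k ∈ range K, f k (W.pos z)| ≤ C * (‖W.pos z‖ ^ K)⁻¹

theorem pos_ne_zero {z : G} (hz : z ≠ 0) : W.pos z ≠ 0 :=
  (map_ne_zero_iff W.pos W.pos_injective).mpr hz

theorem finite_norm_pos_lt (R : ℝ) : {z : G | ‖W.pos z‖ < R}.Finite := by
  refine Set.Finite.of_finite_image (f := W.pos) ?_ W.pos_injective.injOn
  refine (ZSpan.setFinite_inter W.basis (Metric.isBounded_ball (x := 0) (r := R))).subset ?_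
  rintro _ ⟨z, hz, rfl⟩
  refine ⟨by simpa using hz, ?_⟩
  rw [SetLike.mem_coe, Module.Basis.mem_span_iff_repr_mem]
  intro i
  obtain ⟨n, hn⟩ := W.coord_int z i
  exact ⟨n, by simp [hn]⟩

variable {W} in
/-- Terms of higher order and the finitely many lattice points near the origin can be moved to the
error. -/
theorem HasExpansionUpTo.of_le {τ : ℝ} {f : ℕ → EuclideanSpace ℝ (Fin d) → ℝ} {K M : ℕ}
    (hKM : K ≤ M) (hf : ∀ k, IsHomTerm k (f k)) {R C : ℝ}
    (h : ∀ z : G, R ≤ ‖W.pos z‖ → |harmonicPotential W.law z - τ * radial d ‖W.pos z‖ -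
      ∑ k ∈ range M, f k (W.pos z)| ≤ C * (‖W.pos z‖ ^ K)⁻¹) :
    W.HasExpansionUpTo τ f K := by
  choose m hm0 hm using fun k => (hf k).exists_abs_le
  set R' := max R 1
  obtain ⟨C', hC'⟩ : ∃ C' : ℝ, ∀ z ∈ {z : G | ‖W.pos z‖ < R'}, |harmonicPotential W.law z -
      τ * radial d ‖W.pos z‖ - ∑ k ∈ range K, f k (W.pos z)| * ‖W.pos z‖ ^ K ≤ C' := by
    obtain ⟨C', hC'⟩ := ((W.finite_norm_pos_lt R').image fun z => |harmonicPotential W.law z -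
      τ * radial d ‖W.pos z‖ - ∑ k ∈ range K, f k (W.pos z)| * ‖W.pos z‖ ^ K).bddAbove
    exact ⟨C', fun z hz => hC' ⟨z, hz, rfl⟩⟩
  refine ⟨max C' (C + ∑ k ∈ Ico K M, m k), fun z hz => ?_⟩
  have hr : 0 < ‖W.pos z‖ := norm_pos_iff.mpr (W.pos_ne_zero hz)
  rw [max_mul_of_nonneg _ _ (by positivity)]
  rcases lt_or_ge ‖W.pos z‖ R' with hz' | hz'
  · refine le_max_of_le_left ?_
    rw [← div_eq_mul_inv, le_div_iff₀ (by positivity)]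
    exact hC' z hz'
  · refine le_max_of_le_right ?_
    have hr1 : 1 ≤ ‖W.pos z‖ := (le_max_right _ _).trans hz'
    have h1 := h z ((le_max_left _ _).trans hz')
    rw [← Finset.sum_range_add_sum_Ico _ hKM] at h1
    have h2 : |∑ k ∈ Ico K M, f k (W.pos z)| ≤ (∑ k ∈ Ico K M, m k) * (‖W.pos z‖ ^ K)⁻¹ := by
      rw [Finset.sum_mul]
      refine (Finset.abs_sum_le_sum_abs _ _).trans (Finset.sum_le_sum fun k hk => ?_)
      refine (hm k _ (W.pos_ne_zero hz)).trans (mul_le_mul_of_nonneg_left ?_ (hm0 k))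
      exact inv_anti₀ (by positivity) (pow_le_pow_right₀ hr1 (Finset.mem_Ico.mp hk).1)
    have h3 := abs_add_le (harmonicPotential W.law z - τ * radial d ‖W.pos z‖ -
      (∑ k ∈ range K, f k (W.pos z) + ∑ k ∈ Ico K M, f k (W.pos z)))
      (∑ k ∈ Ico K M, f k (W.pos z))
    rw [← sub_sub, sub_add_cancel] at h3
    rw [← sub_sub] at h1
    rw [add_mul]
    linarith

/-- The expansion of a given order, with its terms sorted by their degree of homogeneity. The terms
may still depend on the order. -/
theorem exists_hasExpansionUpTo [NeZero d] {ν : ℕ → ℕ}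
    (hν : ∀ N m n, 1 ≤ m → MvPolynomial.homogeneousComponent n (W.cubicPart N ^ m) ≠ 0 →
      ∃ j, n = 2 * m + j + 1 ∧ m ≤ ν j) :
    ∃ τ : ℝ, ∀ K : ℕ, ∃ f : ℕ → EuclideanSpace ℝ (Fin d) → ℝ, (∀ k, IsHomTerm k (f k)) ∧
      (∀ k, 1 ≤ k → f k ∈ orderSpace d ν k) ∧ W.HasExpansionUpTo τ f K := by
  obtain ⟨τ, hτ⟩ := W.exists_expansion_of_order hν
  refine ⟨τ, fun K => ?_⟩
  obtain ⟨c, g, hg, C, hC⟩ := hτ K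
  obtain ⟨φ, hφ, M, hM, hsum⟩ := exists_sum_orderSpace_eq NeZero.one_le hg (K + 1)
  set κ : ℕ → EuclideanSpace ℝ (Fin d) → ℝ := fun k => if k = 0 then fun _ => c else 0 with hκ
  have hhom : ∀ k, IsHomTerm k (φ k + κ k) := by
    intro k
    refine (IsHomTerm.of_mem_orderSpace (hφ k)).add ?_
    simp only [hκ]
    split_ifs with h
    · exact h ▸ IsHomTerm.const c
    · exact IsHomTerm.zero
  refine ⟨fun k => φ k + κ k, hhom, fun k hk => ?_,
    HasExpansionUpTo.of_le (M := M) (by omega) hhom (R := 4 * W.B) (C := C) fun z hz => ?_⟩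
  · have h1 : κ k = 0 := if_neg (by omega)
    simp only [h1, add_zero]
    exact hφ k
  · have h1 : ∑ k ∈ range M, (φ k + κ k) (W.pos z) = c + g (W.pos z) := by
      have h2 : ∑ k ∈ range M, (φ k + κ k) = g + fun _ => c := by
        rw [Finset.sum_add_distrib, hsum, Finset.sum_ite_eq', if_pos (mem_range.mpr (by omega))]
      rw [← Finset.sum_apply, h2, Pi.add_apply, add_comm]
    rw [h1, ← sub_sub]
    exact hC z hz

/-- Rays through lattice points are dense, so a term is determined by its values on the lattice. -/
theorem eq_zero_of_forall_pos_eq_zero {k : ℕ} {f : EuclideanSpace ℝ (Fin d) → ℝ}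
    (hf : IsHomTerm k f) (h : ∀ z : G, z ≠ 0 → f (W.pos z) = 0)
    (x : EuclideanSpace ℝ (Fin d)) (hx : x ≠ 0) : f x = 0 := by
  have hrange : ∀ y ∈ Submodule.span ℤ (Set.range W.basis), ∃ z : G, W.pos z = y := by
    intro y hy
    have : Submodule.span ℤ (Set.range W.basis) ≤ W.pos.toIntLinearMap.range := by
      rw [Submodule.span_le]
      rintro _ ⟨i, rfl⟩
      obtain ⟨z, hz⟩ := W.basis_mem i
      exact ⟨z, hz⟩
    obtain ⟨z, hz⟩ := this hy
    exact ⟨z, hz⟩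
  set y : ℕ → EuclideanSpace ℝ (Fin d) := fun n =>
    ((n : ℝ) + 1)⁻¹ • (ZSpan.floor W.basis (((n : ℝ) + 1) • x) : EuclideanSpace ℝ (Fin d))
  have hy : Tendsto y atTop (𝓝 x) := by
    rw [tendsto_iff_norm_sub_tendsto_zero]
    have hlim : Tendsto (fun n : ℕ => ((n : ℝ) + 1)⁻¹ * ∑ i, ‖W.basis i‖) atTop (𝓝 0) := by
      have h1 := tendsto_one_div_add_atTop_nhds_zero_nat (𝕜 := ℝ)
      simpa [one_div] using h1.mul_const (∑ i, ‖W.basis i‖)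
    refine squeeze_zero (fun _ => norm_nonneg _) (fun n => ?_) hlim
    have hn : (0 : ℝ) < (n : ℝ) + 1 := by positivity
    have h1 : y n - x = -(((n : ℝ) + 1)⁻¹ • ZSpan.fract W.basis (((n : ℝ) + 1) • x)) := by
      rw [ZSpan.fract_apply, smul_sub, inv_smul_smul₀ hn.ne', neg_sub]
    rw [h1, norm_neg, norm_smul, Real.norm_of_nonneg (by positivity)]
    exact mul_le_mul_of_nonneg_left (ZSpan.norm_fract_le W.basis _) (by positivity)
  have hc : ContinuousAt f x := hf.continuousOn.continuousAt (isOpen_compl_singleton.mem_nhds hx)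
  have h0 : ∀ᶠ n in atTop, f (y n) = 0 := by
    filter_upwards [hy.eventually (isOpen_compl_singleton.mem_nhds hx)] with n hn
    obtain ⟨z, hz⟩ := hrange _ (ZSpan.floor W.basis (((n : ℝ) + 1) • x)).2
    have hz0 : z ≠ 0 := by
      rintro rfl
      refine hn ?_
      simp only [y, ← hz, map_zero, smul_zero, Set.mem_singleton_iff]
    simp only [y, ← hz]
    rw [hf.map_smul _ (by positivity) _ (W.pos_ne_zero hz0), h z hz0, mul_zero]
  exact tendsto_nhds_unique (hc.tendsto.comp hy) (tendsto_const_nhds.congr' (h0.mono fun n hn => by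
    simp [hn]))

/-- On the ray through a lattice point an expansion is an expansion in powers of `n⁻¹`, whence
its terms are unique. -/
theorem eq_zero_of_abs_sum_pos_le {f : ℕ → EuclideanSpace ℝ (Fin d) → ℝ} {K : ℕ}
    (hf : ∀ k, IsHomTerm k (f k)) {C : ℝ}
    (h : ∀ z : G, z ≠ 0 → |∑ k ∈ range K, f k (W.pos z)| ≤ C * (‖W.pos z‖ ^ K)⁻¹) {k : ℕ}
    (hk : k < K) (x : EuclideanSpace ℝ (Fin d)) (hx : x ≠ 0) : f k x = 0 := by
  refine W.eq_zero_of_forall_pos_eq_zero (hf k) (fun z hz => ?_) x hx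
  refine eq_zero_of_abs_sum_le (K := K) (c := fun k => f k (W.pos z))
    (C := C * (‖W.pos z‖ ^ K)⁻¹) (fun n hn => ?_) k hk
  have hn0 : (0 : ℝ) < n := by exact_mod_cast hn
  have hpz := W.pos_ne_zero hz
  have hpos : W.pos (n • z) = (n : ℝ) • W.pos z := by rw [map_nsmul, Nat.cast_smul_eq_nsmul]
  have hnz : n • z ≠ 0 := by
    intro h0
    rw [h0, map_zero] at hpos
    exact (smul_ne_zero hn0.ne' hpz) hpos.symm
  have h1 := h _ hnz
  rw [hpos, norm_smul, Real.norm_of_nonneg hn0.le, mul_pow, mul_inv] at h1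
  have h2 : ∀ i ∈ range K, f i ((n : ℝ) • W.pos z) = f i (W.pos z) * ((n : ℝ) ^ i)⁻¹ := by
    intro i _
    rw [(hf i).map_smul _ hn0 _ hpz, zpow_neg, zpow_natCast, mul_comm]
  rw [Finset.sum_congr rfl h2] at h1
  linarith [h1, mul_comm ((n : ℝ) ^ K)⁻¹ (‖W.pos z‖ ^ K)⁻¹]

end SphericalWalk
end LatticeWalk

/-! ### Arbitrary expansions -/

namespace LatticeWalk

variable {d : ℕ}

theorem mem_radQuot_congr {α n : ℕ} {f g : EuclideanSpace ℝ (Fin d) → ℝ} (hf : f ∈ radQuot d α n)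
    (h : ∀ x, x ≠ 0 → g x = f x) : g ∈ radQuot d α n := by
  obtain ⟨P, hP, hfP⟩ := hf
  exact ⟨P, hP, fun x hx => (h x hx).trans (hfP x hx)⟩

theorem mul_norm_pow_inv_mem_radQuot (s : ℝ) (k : ℕ) :
    (fun x : EuclideanSpace ℝ (Fin d) => s * (‖x‖ ^ k)⁻¹) ∈ radQuot d k 0 :=
  ⟨MvPolynomial.C s, MvPolynomial.isHomogeneous_C _ _, fun x _ => by
    rw [MvPolynomial.eval_C, div_eq_mul_inv]⟩

/-- In dimension one, `x ^ 2 = ‖x‖ ^ 2` allows to reduce the numerator to a constant or a multiple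
of `x`. -/
theorem radQuot_one_le {α n k : ℕ} (hk : n + k = α) :
    radQuot 1 α n ≤ radQuot 1 (n % 2 + k) (n % 2) := by
  rintro f ⟨P, hP, hf⟩
  set e : EuclideanSpace ℝ (Fin 1) := WithLp.toLp 2 fun _ => 1
  refine ⟨MvPolynomial.C (MvPolynomial.eval e P) * MvPolynomial.X 0 ^ (n % 2),
    (MvPolynomial.isHomogeneous_X_pow (R := ℝ) 0 _).C_mul _, fun x hx => ?_⟩
  have hxe : x = x 0 • e := by
    ext i
    rw [Subsingleton.elim i 0]
    simp [e]
  have hsq : x 0 ^ 2 = ‖x‖ ^ 2 := by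
    rw [EuclideanSpace.real_norm_sq_eq, Fin.sum_univ_one]
  have h0 : ‖x‖ ≠ 0 := norm_ne_zero_iff.mpr hx
  have hP' : MvPolynomial.eval x P = x 0 ^ n * MvPolynomial.eval e P := by
    conv_lhs => rw [hxe]
    exact eval_smul_of_isHomogeneous hP (x 0) e
  have hn : x 0 ^ n = ‖x‖ ^ (2 * (n / 2)) * x 0 ^ (n % 2) := by
    rw [pow_mul, ← hsq, ← pow_mul, ← pow_add, Nat.div_add_mod]
  have hα : ‖x‖ ^ α = ‖x‖ ^ (2 * (n / 2)) * ‖x‖ ^ (n % 2 + k) := by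
    rw [← pow_add, ← hk]
    congr 1
    omega
  rw [hf x hx, hP', hn, hα, map_mul, map_pow, MvPolynomial.eval_C, MvPolynomial.eval_X, mul_assoc,
    mul_div_mul_left _ _ (pow_ne_zero _ h0), mul_comm]

/-- The radial function is unbounded in dimensions one and two. -/
theorem tendsto_radial_mul_atTop (hd : 1 ≤ d) (hd2 : d ≤ 2) {r : ℝ} (hr : 0 < r) :
    Tendsto (fun n : ℕ => radial d (n * r)) atTop atTop := by
  have h1 : Tendsto (fun n : ℕ => (n : ℝ) * r) atTop atTop :=
    tendsto_natCast_atTop_atTop.atTop_mul_const hr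
  obtain rfl | rfl : d = 1 ∨ d = 2 := by omega
  · simpa [radial] using h1
  · simpa [radial, Function.comp_def] using Real.tendsto_log_atTop.comp h1

namespace SphericalWalk

variable {G : Type*} [AddCommGroup G] {W : SphericalWalk G d}

theorem HasExpansionUpTo.mono {τ : ℝ} {f : ℕ → EuclideanSpace ℝ (Fin d) → ℝ} {K M : ℕ}
    (h : W.HasExpansionUpTo τ f M) (hf : ∀ k, IsHomTerm k (f k)) (hKM : K ≤ M) :
    W.HasExpansionUpTo τ f K := by
  obtain ⟨C, hC⟩ := h
  refine HasExpansionUpTo.of_le hKM hf (R := 1) (C := |C|) fun z hz => ?_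
  have hz0 : z ≠ 0 := by
    rintro rfl
    rw [map_zero, norm_zero] at hz
    linarith
  refine (hC z hz0).trans (mul_le_mul (le_abs_self C) ?_ (by positivity) (abs_nonneg _))
  exact inv_anti₀ (by positivity) (pow_le_pow_right₀ hz hKM)

theorem HasExpansionUpTo.exists_sub_le {τ σ : ℝ} {f g : ℕ → EuclideanSpace ℝ (Fin d) → ℝ} {K : ℕ}
    (hf : W.HasExpansionUpTo τ f K) (hg : W.HasExpansionUpTo σ g K) :
    ∃ C : ℝ, ∀ z : G, z ≠ 0 → |(σ - τ) * radial d ‖W.pos z‖ +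
      ∑ k ∈ range K, (g k (W.pos z) - f k (W.pos z))| ≤ C * (‖W.pos z‖ ^ K)⁻¹ := by
  obtain ⟨C₁, h₁⟩ := hf
  obtain ⟨C₂, h₂⟩ := hg
  refine ⟨C₁ + C₂, fun z hz => ?_⟩
  have h := (abs_sub _ _).trans (add_le_add (h₁ z hz) (h₂ z hz))
  rw [add_mul]
  refine le_trans (le_of_eq ?_) h
  rw [Finset.sum_sub_distrib]
  congr 1
  ring

theorem HasExpansionUpTo.eq {τ : ℝ} {f g : ℕ → EuclideanSpace ℝ (Fin d) → ℝ} {K : ℕ}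
    (hf : W.HasExpansionUpTo τ f K) (hg : W.HasExpansionUpTo τ g K)
    (hf' : ∀ k, IsHomTerm k (f k)) (hg' : ∀ k, IsHomTerm k (g k)) {k : ℕ} (hk : k < K)
    {x : EuclideanSpace ℝ (Fin d)} (hx : x ≠ 0) : g k x = f k x := by
  obtain ⟨C, hC⟩ := hf.exists_sub_le hg
  refine sub_eq_zero.mp (W.eq_zero_of_abs_sum_pos_le (f := fun k => g k - f k)
    (fun k => (hg' k).sub (hf' k)) (C := C) (fun z hz => ?_) hk x hx)
  simpa only [sub_self, zero_mul, zero_add, Pi.sub_apply] using hC z hz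

/-- In dimensions one and two the radial term is the only unbounded one. -/
theorem HasExpansionUpTo.coeff_eq [NeZero d] (hd : d ≤ 2) {τ σ : ℝ}
    {f g : ℕ → EuclideanSpace ℝ (Fin d) → ℝ}
    (hf : W.HasExpansionUpTo τ f 0) (hg : W.HasExpansionUpTo σ g 0) : σ = τ := by
  obtain ⟨C, hC⟩ := hf.exists_sub_le hg
  simp only [range_zero, Finset.sum_empty, add_zero, pow_zero, inv_one, mul_one] at hC
  obtain ⟨z, hz⟩ := W.basis_mem 0
  have hr : 0 < ‖W.pos z‖ := norm_pos_iff.mpr (hz ▸ W.basis.ne_zero 0)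
  by_contra hne
  have hpos : 0 < |σ - τ| := abs_pos.mpr (sub_ne_zero.mpr hne)
  obtain ⟨n, hn, hn1⟩ := (((tendsto_radial_mul_atTop (NeZero.one_le) hd hr).eventually_gt_atTop
    (C / |σ - τ|)).and (eventually_ge_atTop 1)).exists
  have hn0 : (0 : ℝ) < n := by exact_mod_cast hn1
  have hpz : ‖W.pos (n • z)‖ = n * ‖W.pos z‖ := by
    rw [map_nsmul, ← Nat.cast_smul_eq_nsmul ℝ, norm_smul, Real.norm_of_nonneg hn0.le]
  have hnz : n • z ≠ 0 := by
    intro h0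
    rw [h0, map_zero, norm_zero] at hpz
    have : 0 < (n : ℝ) * ‖W.pos z‖ := by positivity
    linarith
  have h1 := hC _ hnz
  rw [hpz, abs_mul] at h1
  rw [div_lt_iff₀ hpos] at hn
  nlinarith [le_abs_self (radial d (n * ‖W.pos z‖))]

variable (W)

/-- By uniqueness the term of order `k` is the same in all expansions of order greater than `k`. -/
theorem exists_hasExpansion [NeZero d] : ∃ (τ : ℝ) (h : ℕ → EuclideanSpace ℝ (Fin d) → ℝ),
    (∀ k, IsHomTerm k (h k)) ∧ ∀ K, W.HasExpansionUpTo τ h K := by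
  obtain ⟨τ, hτ⟩ := W.exists_hasExpansionUpTo W.exists_eq_of_homogeneousComponent_ne_zero
  choose f hf _ hexp using hτ
  refine ⟨τ, fun k => f (k + 1) k, fun k => hf _ k, fun K => ?_⟩
  obtain ⟨C, hC⟩ := hexp K
  refine ⟨C, fun z hz => ?_⟩
  have h : ∀ k ∈ range K, f (k + 1) k (W.pos z) = f K k (W.pos z) := fun k hk =>
    ((hexp K).mono (hf K) (mem_range.mp hk)).eq (hexp (k + 1)) (hf K) (hf (k + 1)) k.lt_succ_self
      (W.pos_ne_zero hz)
  rw [Finset.sum_congr rfl h]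
  exact hC z hz

/-- Two expansions can only differ by a multiple of the fundamental solution, which is itself a
term if the dimension is at least three. -/
theorem exists_eq_add_of_hasExpansion [NeZero d] {ν : ℕ → ℕ}
    (hν : ∀ N m n, 1 ≤ m → MvPolynomial.homogeneousComponent n (W.cubicPart N ^ m) ≠ 0 →
      ∃ j, n = 2 * m + j + 1 ∧ m ≤ ν j)
    {σ : ℝ} {h : ℕ → EuclideanSpace ℝ (Fin d) → ℝ} (hh : ∀ k, IsHomTerm k (h k))
    (hexp : ∀ K, W.HasExpansionUpTo σ h K) {k : ℕ} (hk : 1 ≤ k) :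
    ∃ f ∈ orderSpace d ν k, ∃ s : ℝ, ∀ x, x ≠ 0 →
      h k x = f x + if k + 2 = d then s * (‖x‖ ^ k)⁻¹ else 0 := by
  obtain ⟨τ, hτ⟩ := W.exists_hasExpansionUpTo hν
  obtain ⟨f, hf, hmem, hfexp⟩ := hτ (k + d)
  refine ⟨f k, hmem k hk, τ - σ, fun x hx => ?_⟩
  rcases le_or_gt d 2 with hd | hd
  · have hστ : σ = τ := HasExpansionUpTo.coeff_eq hd (hfexp.mono hf (Nat.zero_le _)) (hexp 0)
    subst hστ
    rw [if_neg (by omega), add_zero]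
    exact hfexp.eq (hexp _) hf hh (by have := NeZero.pos d; omega) hx
  · set κ : ℕ → EuclideanSpace ℝ (Fin d) → ℝ := fun i =>
      if i + 2 = d then fun x => (τ - σ) * (‖x‖ ^ i)⁻¹ else 0 with hκ
    have hκhom : ∀ i, IsHomTerm i (κ i) := by
      intro i
      simp only [hκ]
      split_ifs
      · exact IsHomTerm.of_mem_radQuot (zero_add i) (mul_norm_pow_inv_mem_radQuot _ i)
      · exact IsHomTerm.zero
    have hfκ : W.HasExpansionUpTo σ (fun i => f i + κ i) (k + d) := by
      obtain ⟨C, hC⟩ := hfexp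
      refine ⟨C, fun z hz => ?_⟩
      refine le_trans (le_of_eq ?_) (hC z hz)
      have hsum : ∑ i ∈ range (k + d), κ i (W.pos z) = (τ - σ) * radial d ‖W.pos z‖ := by
        rw [Finset.sum_eq_single_of_mem (d - 2) (mem_range.mpr (by omega))]
        · simp only [hκ]
          rw [if_pos (by omega), radial, if_neg (by omega)]
          have : (2 - (d : ℤ)) = -((d - 2 : ℕ) : ℤ) := by omega
          rw [this, zpow_neg, zpow_natCast]
        · intro i _ hi
          simp only [hκ]
          rw [if_neg (by omega), Pi.zero_apply]
      simp only [Pi.add_apply, Finset.sum_add_distrib, hsum]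
      congr 1
      ring
    rw [hfκ.eq (hexp _) (fun i => (hf i).add (hκhom i)) hh (by omega) hx, Pi.add_apply]
    simp only [hκ]
    split_ifs <;> rfl

/-- The shape of the terms of an arbitrary expansion. The denominator of the term of order `k` has the
exponent `d + 2 j + 2 ν j` with `j = k + 1 - d`, which is at most `(c + 2) k + 2 - d` if `2 ≤ d`. In
dimension one the quotient is reduced to lowest terms, with exponent `k` or `k + 1`. -/
theorem exists_mem_radQuot_of_hasExpansion [NeZero d] {ν : ℕ → ℕ}
    (hν : ∀ N m n, 1 ≤ m → MvPolynomial.homogeneousComponent n (W.cubicPart N ^ m) ≠ 0 →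
      ∃ j, n = 2 * m + j + 1 ∧ m ≤ ν j)
    {c : ℕ} (hc : ∀ j, 2 * ν j ≤ c * (j + 1))
    {σ : ℝ} {h : ℕ → EuclideanSpace ℝ (Fin d) → ℝ} (hh : ∀ k, IsHomTerm k (h k))
    (hexp : ∀ K, W.HasExpansionUpTo σ h K) {k : ℕ} (hk : 1 ≤ k) :
    ∃ α n : ℕ, n + k = α ∧ h k ∈ radQuot d α n ∧
      (α + d ≤ (c + 2) * k + 2 ∨ ∀ x, x ≠ 0 → h k x = 0) := by
  obtain ⟨f, hf, s, hs⟩ := W.exists_eq_add_of_hasExpansion hν hh hexp hk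
  unfold orderSpace at hf
  split_ifs at hf with hdk
  · have hhf : ∀ x, x ≠ 0 → h k x = f x := fun x hx => by
      rw [hs x hx, if_neg (by omega), add_zero]
    have hmem := mem_radQuot_congr hf hhf
    by_cases hd : d = 1
    · subst hd
      refine ⟨_, _, rfl, radQuot_one_le (by omega) hmem, Or.inl ?_⟩
      have h2 := Nat.mod_lt (k + 1 - 1 + 1 + 2 * ν (k + 1 - 1)) two_pos
      have h3 : k ≤ (c + 2) * k := Nat.le_mul_of_pos_left k (by omega)
      omega
    · refine ⟨_, _, by omega, hmem, Or.inl ?_⟩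
      have hd0 := NeZero.pos d
      obtain ⟨j, hj⟩ : ∃ j, k + 1 - d = j := ⟨_, rfl⟩
      have h1 := hc j
      have h2 : c * (j + 1) ≤ c * k := Nat.mul_le_mul_left c (by omega)
      rw [hj, add_mul]
      omega
  · rw [Submodule.mem_bot] at hf
    subst hf
    simp only [Pi.zero_apply, zero_add] at hs
    by_cases hkd : k + 2 = d
    · simp only [if_pos hkd] at hs
      refine ⟨k, 0, zero_add k, mem_radQuot_congr (mul_norm_pow_inv_mem_radQuot s k) hs,
        Or.inl ?_⟩
      rw [add_mul]
      omega
    · simp only [if_neg hkd] at hs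
      exact ⟨k, 0, zero_add k, mem_radQuot_congr (Submodule.zero_mem _) hs, Or.inr hs⟩

end SphericalWalk
end LatticeWalk

/-! ### Lattices in Euclidean spaces -/

namespace LatticeWalk

section Lattice

theorem tsum_eq_sum_steps {G : Type*} {p : PMF G} {S : Finset G} (hS : ∀ x, p x ≠ 0 → x ∈ S) {F : Type*}
    [AddCommGroup F] [Module ℝ F] [TopologicalSpace F] (f : G → F) :
    ∑' x : G, (p x).toReal • f x = ∑ x ∈ S, (p x).toReal • f x := by
  refine tsum_eq_sum fun x hx => ?_
  have : p x = 0 := by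
    by_contra h
    exact hx (hS x h)
  rw [this, ENNReal.toReal_zero, zero_smul]

variable {V : Type*} [NormedAddCommGroup V] [InnerProductSpace ℝ V]
  {Z : Submodule ℤ V} {p : PMF Z}

/-- A lattice has finitely many points in a bounded set. -/
theorem exists_steps [FiniteDimensional ℝ V] [DiscreteTopology Z] [IsZLattice ℝ Z]
    (hbdd : IsBoundedWalk p) : ∃ S : Finset Z, ∀ x, p x ≠ 0 → x ∈ S := by
  have : Module.Free ℤ Z := ZLattice.module_free ℝ Z
  set b := (Module.Free.chooseBasis ℤ Z).ofZLatticeBasis ℝ Z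
  have hfin : (Subtype.val '' p.support : Set V).Finite := by
    refine (ZSpan.setFinite_inter b (Bornology.isBounded_image_subtype_val.mpr hbdd)).subset ?_
    rintro _ ⟨x, hx, rfl⟩
    refine ⟨⟨x, hx, rfl⟩, ?_⟩
    rw [Module.Basis.ofZLatticeBasis_span]
    exact x.2
  have hfin' : p.support.Finite := hfin.of_finite_image Subtype.val_injective.injOn
  exact ⟨hfin'.toFinset, fun x hx => hfin'.mem_toFinset.mpr hx⟩

/-- The covariance form is positive definite, since the steps generate the lattice. -/
theorem eq_zero_of_sum_sq_eq_zero [DiscreteTopology Z] [IsZLattice ℝ Z]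
    (hwalk : IsRandomWalk p) {S : Finset Z}
    (hS : ∀ x, p x ≠ 0 → x ∈ S) (φ : V →ₗ[ℝ] ℝ)
    (h : ∑ x ∈ S, (p x).toReal * φ x ^ 2 = 0) : φ = 0 := by
  have h0 : ∀ x : Z, p x ≠ 0 → φ x = 0 := by
    intro x hx
    have h1 := (Finset.sum_eq_zero_iff_of_nonneg fun y _ => by positivity).mp h x (hS x hx)
    have h2 : (p x).toReal ≠ 0 := ENNReal.toReal_ne_zero.mpr ⟨hx, PMF.apply_ne_top _ _⟩
    simpa [h2] using h1
  have h1 : ∀ z : Z, φ z = 0 := by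
    intro z
    obtain ⟨n, hn⟩ := hwalk z
    exact mem_of_stepProb_ne_zero p
      (AddMonoidHom.mker (φ.toAddMonoidHom.comp Z.subtype.toAddMonoidHom)) h0 n z hn.ne'
  refine LinearMap.ext_on (IsZLattice.span_top (K := ℝ) (L := Z)) fun z hz => ?_
  exact h1 ⟨z, hz⟩

/-- The dual of a basis which is orthonormal for the covariance form. -/
theorem exists_isSphericalUnder [FiniteDimensional ℝ V] [DiscreteTopology Z] [IsZLattice ℝ Z]
    (hwalk : IsRandomWalk p) (hbdd : IsBoundedWalk p) :
    ∃ A : V ≃ₗ[ℝ] V, IsSphericalUnder p A := by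
  obtain ⟨S, hS⟩ := exists_steps hbdd
  set Q : LinearMap.BilinForm ℝ V := ∑ x ∈ S,
    (p x).toReal • LinearMap.BilinForm.linMulLin (innerₗ V (x : V)) (innerₗ V (x : V)) with hQ
  have hQapply : ∀ u v, Q u v =
      ∑ x ∈ S, (p x).toReal * (inner ℝ (x : V) u * inner ℝ (x : V) v) := by
    intro u v
    simp [hQ, LinearMap.sum_apply]
  have hsymm : LinearMap.IsSymm Q := ⟨fun u v => by
    rw [RingHom.id_apply, hQapply, hQapply]
    exact Finset.sum_congr rfl fun x _ => by ring⟩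
  have hQpos : ∀ u, u ≠ 0 → 0 < Q u u := by
    intro u hu
    have h1 : Q u u = ∑ x ∈ S, (p x).toReal * (innerₗ V u) (x : V) ^ 2 := by
      rw [hQapply]
      refine Finset.sum_congr rfl fun x _ => ?_
      rw [innerₗ_apply_apply, real_inner_comm, sq]
    have h2 : 0 ≤ Q u u := h1 ▸ Finset.sum_nonneg fun x _ => by positivity
    refine lt_of_le_of_ne h2 fun h3 => hu ?_
    have h4 := eq_zero_of_sum_sq_eq_zero hwalk hS _ (h1 ▸ h3.symm)
    have h5 := LinearMap.congr_fun h4 u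
    simpa using h5
  obtain ⟨v, hv⟩ := LinearMap.BilinForm.exists_orthogonal_basis hsymm
  set e := stdOrthonormalBasis ℝ V
  set T : V →ₗ[ℝ] V := e.toBasis.constr ℝ fun i => (√(Q (v i) (v i)))⁻¹ • v i with hT
  have hTe : ∀ i, T (e i) = (√(Q (v i) (v i)))⁻¹ • v i := by
    intro i
    rw [← e.coe_toBasis, hT, Module.Basis.constr_basis]
  have hvpos : ∀ i, 0 < Q (v i) (v i) := fun i => hQpos _ (v.ne_zero i)
  have hQT : Q.compl₁₂ T T = innerₗ V := by
    refine LinearMap.BilinForm.ext_basis e.toBasis fun i j => ?_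
    rw [LinearMap.compl₁₂_apply, e.coe_toBasis, hTe, hTe, innerₗ_apply_apply,
      e.inner_eq_ite, map_smul, map_smul, LinearMap.smul_apply, smul_eq_mul, smul_eq_mul]
    split_ifs with hij
    · subst hij
      have h1 := Real.mul_self_sqrt (hvpos i).le
      have h2 := Real.sqrt_ne_zero'.mpr (hvpos i)
      field_simp
      rw [sq, h1]
    · rw [(LinearMap.isOrthoᵢ_def.mp hv) i j hij]
      ring
  have hinj : Function.Injective (LinearMap.adjoint T) := by
    rw [← LinearMap.ker_eq_bot, LinearMap.ker_eq_bot']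
    intro x hx
    have h0 : innerₗ V x = 0 := v.ext fun i => ?_
    · simpa using LinearMap.congr_fun h0 x
    have h1 : inner ℝ (LinearMap.adjoint T x) (e i) = 0 := by rw [hx, inner_zero_left]
    rw [LinearMap.adjoint_inner_left, hTe, real_inner_smul_right] at h1
    exact (mul_eq_zero.mp h1).resolve_left (inv_ne_zero (Real.sqrt_ne_zero'.mpr (hvpos i)))
  refine ⟨LinearEquiv.ofInjectiveEndo (LinearMap.adjoint T) hinj, 1, fun u w => ?_⟩
  have h := tsum_eq_sum_steps hS fun x : Z =>
    inner ℝ (LinearMap.adjoint T (x : V)) u * inner ℝ (LinearMap.adjoint T (x : V)) w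
  simp only [smul_eq_mul] at h
  simp only [LinearEquiv.coe_ofInjectiveEndo]
  rw [h, one_mul]
  simp only [LinearMap.adjoint_inner_left]
  rw [← hQapply, ← LinearMap.compl₁₂_apply, hQT, innerₗ_apply_apply]

theorem IsReversible.diffOpVanishes_three (h : IsReversible p) : DiffOpVanishes p 3 := by
  intro f _ z
  have h1 : ∑' x : Z, (p x).toReal * iteratedFDeriv ℝ 3 f z (fun _ => (x : V)) =
      -∑' x : Z, (p x).toReal * iteratedFDeriv ℝ 3 f z (fun _ => (x : V)) := by
    rw [← tsum_neg]
    conv_lhs => rw [← (Equiv.neg Z).tsum_eq]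
    refine tsum_congr fun x => ?_
    have h2 : (fun _ : Fin 3 => ((-x : Z) : V)) = fun _ => (-1 : ℝ) • (x : V) := by
      ext
      simp
    rw [Equiv.neg_apply, h x, h2, (iteratedFDeriv ℝ 3 f z).map_smul_univ (fun _ => -1)]
    simp only [Finset.prod_const, Finset.card_univ, Fintype.card_fin, smul_eq_mul]
    ring
  rw [diffOp, self_eq_neg.mp h1, mul_zero]

variable {d : ℕ}

/-- A walk on a lattice in `V` which is spherical after the linear change of variables `A`,
as a walk in coordinates with respect to an orthonormal basis. -/
theorem exists_sphericalWalk [FiniteDimensional ℝ V] [DiscreteTopology Z] [IsZLattice ℝ Z]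
    [NeZero d] (hd : Module.finrank ℝ V = d) (hwalk : IsRandomWalk p) (hbdd : IsBoundedWalk p)
    (hbal : IsBalanced p) {A : V ≃ₗ[ℝ] V} (hA : IsSphericalUnder p A) :
    ∃ (W : SphericalWalk Z d) (L : V ≃L[ℝ] EuclideanSpace ℝ (Fin d)), W.law = p ∧
      (∀ z : Z, W.pos z = L z) ∧ ∀ v, ‖L v‖ = ‖A v‖ := by
  have : Module.Free ℤ Z := ZLattice.module_free ℝ Z
  have : Module.Finite ℤ Z := ZLattice.module_finite ℝ Z
  obtain ⟨S, hS⟩ := exists_steps hbdd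
  obtain ⟨C, hC⟩ := hA
  set I : V ≃ₗᵢ[ℝ] EuclideanSpace ℝ (Fin d) :=
    ((stdOrthonormalBasis ℝ V).reindex (finCongr hd)).repr
  set L : V ≃ₗ[ℝ] EuclideanSpace ℝ (Fin d) := A.trans I.toLinearEquiv
  have hLapply : ∀ v, L v = I (A v) := fun v => rfl
  have hsq : ∀ u : EuclideanSpace ℝ (Fin d),
      ∑ x ∈ S, (p x).toReal * inner ℝ (L (x : V)) u ^ 2 = C * ‖u‖ ^ 2 := by
    intro u
    have h1 := hC (I.symm u) (I.symm u)
    have h2 := tsum_eq_sum_steps hS fun x : Z =>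
      inner ℝ (A (x : V)) (I.symm u) * inner ℝ (A (x : V)) (I.symm u)
    simp only [smul_eq_mul] at h2
    rw [h2, real_inner_self_eq_norm_sq, I.symm.norm_map] at h1
    rw [← h1]
    refine Finset.sum_congr rfl fun x _ => ?_
    rw [hLapply, ← I.inner_map_map, I.apply_symm_apply, sq]
  have hCpos : 0 < C := by
    set u : EuclideanSpace ℝ (Fin d) := EuclideanSpace.single 0 1
    have hu : ‖u‖ = 1 := by simp [u]
    have h1 := hsq u
    rw [hu, one_pow, mul_one] at h1
    have h2 : 0 ≤ C := h1 ▸ Finset.sum_nonneg fun x _ => by positivity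
    refine lt_of_le_of_ne h2 fun h3 => ?_
    have h4 := eq_zero_of_sum_sq_eq_zero hwalk hS ((innerₗ _ u).comp L.toLinearMap) (by
      rw [← h3] at h1
      rw [← h1]
      refine Finset.sum_congr rfl fun x _ => ?_
      rw [LinearMap.comp_apply, innerₗ_apply_apply, real_inner_comm]
      rfl)
    have h5 := LinearMap.congr_fun h4 (L.symm u)
    rw [LinearMap.comp_apply, LinearEquiv.coe_coe, L.apply_symm_apply, innerₗ_apply_apply,
      real_inner_self_eq_norm_sq, hu] at h5
    norm_num at h5
  set bZ : Module.Basis (Fin d) ℤ Z :=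
    Module.finBasisOfFinrankEq ℤ Z ((ZLattice.rank ℝ Z).trans hd)
  refine ⟨{ law := p
            pos := L.toLinearMap.toAddMonoidHom.comp Z.subtype.toAddMonoidHom
            steps := S
            mem_steps := hS
            reach := hwalk
            mean_zero := ?_
            q := C / 2
            q_pos := by positivity
            spherical := fun u => ?_
            basis := (bZ.ofZLatticeBasis ℝ Z).map L
            basis_mem := fun i => ⟨bZ i, ?_⟩
            coord_int := fun z i => ⟨bZ.repr z i, ?_⟩
            pos_injective := ?_ }, L.toContinuousLinearEquiv, rfl, fun z => rfl, fun v => ?_⟩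
  · have h1 := hbal
    rw [IsBalanced, tsum_eq_sum_steps hS fun x : Z => (x : V)] at h1
    have h2 := congrArg L h1
    rw [map_sum, map_zero] at h2
    rw [← h2]
    exact Finset.sum_congr rfl fun x _ => (L.map_smul _ _).symm
  · rw [mul_div_cancel₀ _ two_ne_zero]
    exact hsq u
  · rw [Module.Basis.map_apply, Module.Basis.ofZLatticeBasis_apply]
    rfl
  · rw [← Module.Basis.ofZLatticeBasis_repr_apply ℝ Z bZ z i, Module.Basis.map_repr,
      LinearEquiv.trans_apply]
    congr 2
    exact L.symm_apply_apply _
  · exact L.injective.comp Subtype.val_injective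
  · exact I.norm_map (A v)

/-- Applied to the cube of a linear functional, `D_3` gives its third moment. -/
theorem SphericalWalk.moment_three_eq_zero {W : SphericalWalk Z d}
    {L : V ≃L[ℝ] EuclideanSpace ℝ (Fin d)} (hL : ∀ z : Z, W.pos z = L z)
    (h : DiffOpVanishes W.law 3) : W.moment 3 = 0 := by
  refine MvPolynomial.funext fun u' => ?_
  set u : EuclideanSpace ℝ (Fin d) := WithLp.toLp 2 u'
  have hev : MvPolynomial.eval u (W.moment 3) = 0 := by
    set ℓ : V →L[ℝ] ℝ := (innerSL ℝ u).comp (L : V →L[ℝ] EuclideanSpace ℝ (Fin d))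
    have hg : ContDiff ℝ ((⊤ : ℕ∞) : WithTop ℕ∞) (fun s : ℝ => s ^ 3) := by fun_prop
    have h1 := h ((fun s : ℝ => s ^ 3) ∘ ℓ) (hg.comp ℓ.contDiff) 0
    rw [diffOp] at h1
    have h2 : ∀ x : Z, iteratedFDeriv ℝ 3 ((fun s : ℝ => s ^ 3) ∘ ℓ) 0 (fun _ => (x : V)) =
        6 * inner ℝ (W.pos x) u ^ 3 := by
      intro x
      rw [ContinuousLinearMap.iteratedFDeriv_comp_right (n := ((3 : ℕ) : WithTop ℕ∞)) ℓ
          (by fun_prop) 0 le_rfl,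
        ContinuousMultilinearMap.compContinuousLinearMap_apply,
        iteratedFDeriv_apply_eq_iteratedDeriv_mul_prod, iteratedDeriv_pow]
      have h3 : ℓ x = inner ℝ (W.pos x) u := by
        rw [hL, real_inner_comm]
        rfl
      simp [h3, Nat.descFactorial]
      ring
    simp only [h2] at h1
    have h3 := tsum_eq_sum_steps W.mem_steps fun x : Z => 6 * inner ℝ (W.pos x) u ^ 3
    simp only [smul_eq_mul] at h3
    rw [h3, mul_eq_zero, or_iff_right (by positivity)] at h1
    rw [W.eval_moment]
    have h4 : ∑ x ∈ W.steps, (W.law x).toReal * (6 * inner ℝ (W.pos x) u ^ 3) =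
        6 * ∑ x ∈ W.steps, W.wt x * inner ℝ (W.pos x) u ^ 3 := by
      rw [Finset.mul_sum]
      exact Finset.sum_congr rfl fun x _ => by rw [SphericalWalk.wt]; ring
    rw [h4] at h1
    simpa using h1
  rw [map_zero]
  exact hev

end Lattice

end LatticeWalk

/-! ### Transfer to linear coordinates -/

namespace LatticeWalk

section Transfer

variable {V : Type*} [NormedAddCommGroup V] [InnerProductSpace ℝ V] {Z : Submodule ℤ V} {d : ℕ}

theorem exists_norm_pow_inv_le {E F : Type*} [NormedAddCommGroup E] [NormedSpace ℝ E]
    [NormedAddCommGroup F] [NormedSpace ℝ F] (M : E ≃L[ℝ] F) (K : ℕ) :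
    ∃ c : ℝ, 0 ≤ c ∧ ∀ x, x ≠ 0 → (‖x‖ ^ K)⁻¹ ≤ c * (‖M x‖ ^ K)⁻¹ := by
  refine ⟨(‖(M : E →L[ℝ] F)‖) ^ K, by positivity, fun x hx => ?_⟩
  have h1 : 0 < ‖x‖ := norm_pos_iff.mpr hx
  have h2 : 0 < ‖M x‖ := norm_pos_iff.mpr ((map_ne_zero_iff M M.injective).mpr hx)
  rw [← div_eq_mul_inv, le_div_iff₀ (by positivity), ← div_eq_inv_mul,
    div_le_iff₀ (by positivity), ← mul_pow]
  exact pow_le_pow_left₀ h2.le ((M : E →L[ℝ] F).le_opNorm x) K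

theorem isHomTerm_comp_symm (L : V ≃L[ℝ] EuclideanSpace ℝ (Fin d)) {k : ℕ} {h : V → ℝ}
    (hc : ContinuousOn h {0}ᶜ)
    (hs : ∀ t : ℝ, 0 < t → ∀ z : V, z ≠ 0 → h (t • z) = t ^ (-(k : ℤ)) * h z) :
    IsHomTerm k fun x => h (L.symm x) := by
  refine ⟨hc.comp L.symm.continuous.continuousOn fun x hx => ?_, fun t ht x hx => ?_⟩
  · exact (map_ne_zero_iff L.symm L.symm.injective).mpr hx
  · rw [map_smul]
    exact hs t ht _ ((map_ne_zero_iff L.symm L.symm.injective).mpr hx)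

namespace SphericalWalk

variable {W : SphericalWalk Z d} {L : V ≃L[ℝ] EuclideanSpace ℝ (Fin d)} {A : V ≃ₗ[ℝ] V}

theorem isExpansion_of_hasExpansion (hL : ∀ z : Z, W.pos z = L z) (hA : ∀ v, ‖L v‖ = ‖A v‖)
    {τ : ℝ} {h : ℕ → EuclideanSpace ℝ (Fin d) → ℝ} (hh : ∀ k, IsHomTerm k (h k))
    (hexp : ∀ K, W.HasExpansionUpTo τ h K) :
    IsExpansion d (harmonicPotential W.law) A τ fun k v => h k (L v) := by
  have hne : ∀ v : V, v ≠ 0 → L v ≠ 0 := fun v hv => (map_ne_zero_iff L L.injective).mpr hv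
  refine ⟨fun k => (hh k).continuousOn.comp L.continuous.continuousOn fun v hv => hne v hv,
    fun k t ht v hv => ?_, fun K => ?_⟩
  · rw [map_smul]
    exact (hh k).map_smul t ht _ (hne v hv)
  · obtain ⟨C, hC⟩ := hexp K
    obtain ⟨c, hc0, hc⟩ := exists_norm_pow_inv_le L.symm K
    refine ⟨|C| * c, fun z hz => ?_⟩
    have hz' : (z : V) ≠ 0 := by simpa using hz
    have h1 := hC z hz
    have h2 := hc (L z) (hne _ hz')
    rw [L.symm_apply_apply] at h2
    rw [hL] at h1
    rw [← hA, zpow_neg, zpow_natCast, mul_assoc]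
    exact h1.trans (mul_le_mul (le_abs_self C) h2 (by positivity) (abs_nonneg _))

theorem hasExpansionUpTo_of_isExpansion (hL : ∀ z : Z, W.pos z = L z) (hA : ∀ v, ‖L v‖ = ‖A v‖)
    {τ : ℝ} {h : ℕ → V → ℝ} (hexp : IsExpansion d (harmonicPotential W.law) A τ h) (K : ℕ) :
    W.HasExpansionUpTo τ (fun k x => h k (L.symm x)) K := by
  obtain ⟨C, hC⟩ := hexp.bound K
  obtain ⟨c, hc0, hc⟩ := exists_norm_pow_inv_le L K
  refine ⟨|C| * c, fun z hz => ?_⟩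
  have hz' : (z : V) ≠ 0 := by simpa using hz
  have h1 := hC z hz
  have h2 := hc z hz'
  rw [zpow_neg, zpow_natCast, ← hA] at h1
  simp only [hL, L.symm_apply_apply]
  rw [mul_assoc]
  exact h1.trans (mul_le_mul (le_abs_self C) h2 (by positivity) (abs_nonneg _))

end SphericalWalk

/-- A quotient of a polynomial by a power of the norm remains one in other linear coordinates. -/
theorem isQuotientTerm_of_mem_radQuot (b : Module.Basis (Fin d) ℝ V)
    (L : V ≃L[ℝ] EuclideanSpace ℝ (Fin d)) {A : V ≃ₗ[ℝ] V} (hA : ∀ v, ‖L v‖ = ‖A v‖)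
    {k α n : ℕ} (hα : n + k = α) {g : V → ℝ}
    (hg : (fun x => g (L.symm x)) ∈ radQuot d α n) {αMax : ℤ}
    (hmax : (α : ℤ) ≤ αMax ∨ ∀ v, v ≠ 0 → g v = 0) :
    IsQuotientTerm b A k g αMax (αMax - k) := by
  rcases hmax with hmax | h0
  · obtain ⟨P, hP, hgP⟩ := hg
    set ℓ : Fin d → MvPolynomial (Fin d) ℝ := fun i =>
      ∑ j, MvPolynomial.C (L (b j) i) * MvPolynomial.X j
    have hℓ : ∀ i, (ℓ i).IsHomogeneous 1 := fun i =>
      MvPolynomial.IsHomogeneous.sum _ _ _ fun j _ =>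
        (MvPolynomial.isHomogeneous_X ℝ j).C_mul _
    have hhom : (MvPolynomial.aeval ℓ P).IsHomogeneous n := by
      simpa using hP.aeval ℓ hℓ
    have hcoord : ∀ (v : V) (i : Fin d),
        MvPolynomial.eval (fun i => b.repr v i) (ℓ i) = L v i := by
      intro v i
      conv_rhs => rw [← b.sum_repr v, map_sum]
      simp [ℓ, mul_comm]
    refine ⟨α, MvPolynomial.aeval ℓ P, by omega, ?_, fun v hv => ?_, fun hne => ⟨hmax, ?_⟩⟩
    · rwa [← hα, Nat.add_sub_cancel]
    · have h1 := hgP (L v) ((map_ne_zero_iff L L.injective).mpr hv)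
      simp only [L.symm_apply_apply, hA] at h1
      have h2 := MvPolynomial.comp_aeval_apply (f := ℓ)
        (MvPolynomial.aeval (R := ℝ) fun i => b.repr v i) P
      simp only [MvPolynomial.aeval_eq_eval, hcoord] at h2
      rw [h1, h2]
    · rw [hhom.totalDegree hne]
      omega
  · exact ⟨k, 0, le_rfl, MvPolynomial.isHomogeneous_zero _ _ _, fun v hv => by simp [h0 v hv],
      fun h => absurd rfl h⟩

/-- The shape of the terms in terms of a bound for the number `ν j` of factors: `c = 2` holds in
general, and `c = 1` if the third moments vanish. -/
theorem SphericalWalk.isQuotientTerm [NeZero d] {W : SphericalWalk Z d}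
    {L : V ≃L[ℝ] EuclideanSpace ℝ (Fin d)} {A : V ≃ₗ[ℝ] V} (hL : ∀ z : Z, W.pos z = L z)
    (hA : ∀ v, ‖L v‖ = ‖A v‖) (b : Module.Basis (Fin d) ℝ V) {ν : ℕ → ℕ}
    (hν : ∀ N m n, 1 ≤ m → MvPolynomial.homogeneousComponent n (W.cubicPart N ^ m) ≠ 0 →
      ∃ j, n = 2 * m + j + 1 ∧ m ≤ ν j)
    {c : ℕ} (hc : ∀ j, 2 * ν j ≤ c * (j + 1)) {τ : ℝ} {h : ℕ → V → ℝ}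
    (hexp : IsExpansion d (harmonicPotential W.law) A τ h) {k : ℕ} (hk : 1 ≤ k) :
    IsQuotientTerm b A k (h k) ((c + 2) * k + 2 - d) ((c + 2) * k + 2 - d - k) := by
  obtain ⟨α, n, hα, hmem, hmax⟩ := W.exists_mem_radQuot_of_hasExpansion hν hc
    (fun k => isHomTerm_comp_symm L (hexp.continuousOn k) (hexp.homogeneous k))
    (hasExpansionUpTo_of_isExpansion hL hA hexp) hk
  refine isQuotientTerm_of_mem_radQuot b L hA hα hmem (hmax.imp (fun h1 => ?_) fun h1 v hv => ?_)
  · have h2 : (α : ℤ) + d ≤ (c + 2) * k + 2 := by exact_mod_cast h1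
    linarith
  · have h2 := h1 (L v) ((map_ne_zero_iff L L.injective).mpr hv)
    rwa [L.symm_apply_apply] at h2

/-- In dimension zero the lattice is trivial, and so is the potential. -/
theorem tendsto_harmonicPotential_of_subsingleton {G : Type*} [AddMonoid G] [Subsingleton G]
    (p : PMF G) (z : G) :
    Tendsto (potentialPartialSum p z) atTop (𝓝 (harmonicPotential p z)) := by
  have hz : z = 0 := Subsingleton.elim _ _
  subst hz
  refine tendsto_nhds_limUnder ⟨0, ?_⟩
  have h : potentialPartialSum p (0 : G) = fun _ => 0 := by
    funext N
    simp [potentialPartialSum]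
  rw [h]
  exact tendsto_const_nhds

end Transfer

end LatticeWalk

end

theorem mainTheorem3 {V : Type*} [NormedAddCommGroup V] [InnerProductSpace ℝ V]
    {d : ℕ} (b : Module.Basis (Fin d) ℝ V)
    (Z : Submodule ℤ V) [DiscreteTopology Z] [IsZLattice ℝ Z]
    (p : PMF Z) (hwalk : LatticeWalk.IsRandomWalk p)
    (hbdd : LatticeWalk.IsBoundedWalk p) (hbal : LatticeWalk.IsBalanced p) :
    -- the harmonic potential exists
    (∀ z : Z, Filter.Tendsto (LatticeWalk.potentialPartialSum p z) Filter.atTop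
      (nhds (LatticeWalk.harmonicPotential p z))) ∧
    -- the walk can be made spherical by a linear change of variables
    (∃ A : V ≃ₗ[ℝ] V, LatticeWalk.IsSphericalUnder p A) ∧
    -- a reversible walk has `D_3 ≡ 0`
    (LatticeWalk.IsReversible p → LatticeWalk.DiffOpVanishes p 3) ∧
    (∀ A : V ≃ₗ[ℝ] V, LatticeWalk.IsSphericalUnder p A →
      -- the expansion exists
      (∃ (τ : ℝ) (h : ℕ → V → ℝ),
        LatticeWalk.IsExpansion d (LatticeWalk.harmonicPotential p) A τ h) ∧
      -- the form of its terms
      (∀ (τ : ℝ) (h : ℕ → V → ℝ),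
        LatticeWalk.IsExpansion d (LatticeWalk.harmonicPotential p) A τ h →
        ∀ k : ℕ, 1 ≤ k →
          LatticeWalk.IsQuotientTerm b A k (h k) (4 * k + 2 - d) (3 * k + 2 - d) ∧
          (LatticeWalk.DiffOpVanishes p 3 →
            LatticeWalk.IsQuotientTerm b A k (h k) (3 * k + 2 - d) (2 * k + 2 - d)))) := by
  have : FiniteDimensional ℝ V := b.finiteDimensional_of_finite
  have hd : Module.finrank ℝ V = d := by
    rw [Module.finrank_eq_card_basis b, Fintype.card_fin]
  obtain ⟨A₀, hA₀⟩ := LatticeWalk.exists_isSphericalUnder hwalk hbdd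
  refine ⟨?_, ⟨A₀, hA₀⟩, fun h => h.diffOpVanishes_three, fun A hA => ?_⟩
  · rcases Nat.eq_zero_or_pos d with rfl | hd0
    · have : Subsingleton V := Module.finrank_zero_iff.mp hd
      exact LatticeWalk.tendsto_harmonicPotential_of_subsingleton p
    · have : NeZero d := ⟨hd0.ne'⟩
      obtain ⟨W, -, rfl, -⟩ := LatticeWalk.exists_sphericalWalk hd hwalk hbdd hbal hA₀
      exact W.tendsto_harmonicPotential
  rcases Nat.eq_zero_or_pos d with rfl | hd0
  · -- There are no points outside the origin.
    have : Subsingleton V := Module.finrank_zero_iff.mp hd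
    have hV : ∀ v : V, ¬ v ≠ 0 := fun v => not_not.mpr (Subsingleton.elim v 0)
    have hterm : ∀ (k : ℕ) (g : V → ℝ) (αMax degMax : ℤ),
        LatticeWalk.IsQuotientTerm b A k g αMax degMax := fun k g _ _ =>
      ⟨k, 0, le_rfl, MvPolynomial.isHomogeneous_zero _ _ _, fun v hv => absurd hv (hV v),
        fun h => absurd rfl h⟩
    refine ⟨⟨0, fun _ _ => 0, fun _ => continuousOn_const, fun _ _ _ v hv => absurd hv (hV v),
      fun _ => ⟨0, fun z hz => absurd (by simpa using hz) (hV z)⟩⟩,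
      fun _ _ _ k _ => ⟨hterm _ _ _ _, fun _ => hterm _ _ _ _⟩⟩
  · have : NeZero d := ⟨hd0.ne'⟩
    obtain ⟨W, L, rfl, hL, hLA⟩ := LatticeWalk.exists_sphericalWalk hd hwalk hbdd hbal hA
    obtain ⟨τ, h, hh, hexp⟩ := W.exists_hasExpansion
    refine ⟨⟨τ, _, LatticeWalk.SphericalWalk.isExpansion_of_hasExpansion hL hLA hh hexp⟩,
      fun τ' h' hexp' k hk => ⟨?_, fun h3 => ?_⟩⟩
    · have := LatticeWalk.SphericalWalk.isQuotientTerm hL hLA b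
        W.exists_eq_of_homogeneousComponent_ne_zero (c := 2) (fun j => by omega) hexp' hk
      convert! this using 1
      all_goals
        push_cast
        ring
    · have := LatticeWalk.SphericalWalk.isQuotientTerm hL hLA b
        (W.exists_eq_of_homogeneousComponent_ne_zero_of_moment_eq_zero
          (LatticeWalk.SphericalWalk.moment_three_eq_zero hL h3)) (c := 1)
        (fun j => by omega) hexp' hk
      convert! this using 1
      all_goals
        push_cast
        ring
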